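/- Let $q$ be an odd prime power and let $r\ge 4$ be even. Let $A$ be an invertible symmetric $(r+1)\times(r+1)$ matrix over $\mathrm{GF}(q)$, and let $\mathcal Q(r,q)=\{\langle x\rangle : x^{T}Ax=0\}$ be the corresponding parabolic quadric of $\Sigma=\mathrm{PG}(r,q)$. Embed $\Sigma$ in $\mathrm{PG}(r,q^2)$. Let $\mathcal H(r,q^2)=\{\langle x\rangle : x^{T}A\,x^{(q)}=0\}$, where $x^{(q)}$ is obtained from $x$ by raising every coordinate to the $q$-th power; this is the non-degenerate Hermitian variety of $\mathrm{PG}(r,q^2)$ whose unitary polarity $\perp_h$ commutes with the orthogonal polarity $\perp$ of $A$ and satisfies $\perp\perp_h=\perp_h\perp=\tau$, where $\tau$ is the semilinear involution fixing $\Sigma$ pointwise. Let $G\cong\mathrm{PGO}(r+1,q)$ be the group of projectivities of $\Sigma$ stabilizing $\mathcal Q(r,q)$, that is, those induced by the invertible matrices $g$ over $\mathrm{GF}(q)$ with $g^{T}Ag=cA$ for some $c\in\mathrm{GF}(q)$, $c\ne 0$; consider $G$ as acting on $\mathrm{PG}(r,q^2)$. An extended line of $\Sigma$ is the line of $\mathrm{PG}(r,q^2)$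 spanned by a line of $\Sigma$. Put $\theta_{n,s}=s^n+\dots+s+1$. A set $\mathcal X$ of points of $\mathcal H(r,q^2)$ is called $i$-tight if, for every point $P$ of $\mathcal H(r,q^2)$, $$|P^{\perp_h}\cap\mathcal X|=\begin{cases} i\,\theta_{\frac{r-4}{2},q^2}+q^{r-2} & \text{if } P\in\mathcal X,\\ i\,\theta_{\frac{r-4}{2},q^2} & \text{if } P\notin\mathcal X.\end{cases}$$ Theorem. The group $G$ has exactly four orbits on the points of $\mathcal H(r,q^2)$: (1) $\mathcal Q(r,q)$; (2) $\mathcal O$, the points not in $\Sigma$ on the extended lines of $\Sigma$ contained in $\mathcal Q(r,q)$; (3) $\mathcal E$, the points of $\mathcal H(r,q^2)$ on the extended lines of $\Sigma$ having no point in common with $\mathcal Q(r,q)$; (4) $\mathcal S$, the points of $\mathcal H(r,q^2)\setminus\mathcal Q(r,q)$ on the extended lines of $\Sigma$ having exactly two points in common with $\mathcal Q(r,q)$. Each of $\mathcal Q(r,q)$, $\mathcal O$, $\mathcal E$, $\mathcal S$ is an $i$-tight set of $\mathcal H(r,q^2)$, with parameter $i=q+1$, $q^{r-1}-q$, $\frac{q^{r+1}-q^{r-1}}{2}$,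 $\frac{q^{r+1}-q^{r-1}}{2}$, respectively. -/

import Mathlib

open scoped LinearAlgebra.Projectivization MatrixGroups

noncomputable section

namespace HermTight

/-- `θ_{n,q} = q ^ n + ⋯ + q + 1`, the number of points of an `n`-dimensional projective space
over the field with `q` elements. -/
def theta (n q : ℕ) : ℕ := ∑ j ∈ Finset.range (n + 1), q ^ j

section

variable {F : Type*} [Field F] {r : ℕ}

/-- The points of the quadric of `PG(r, F)` with symmetric Gram matrix `A`. -/
def quadric (A : Matrix (Fin (r + 1)) (Fin (r + 1)) F) : Set (ℙ F (Fin (r + 1) → F)) :=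
  {P | P.rep ⬝ᵥ A.mulVec P.rep = 0}

/-- The similitudes of the form with Gram matrix `A`: invertible linear maps that multiply the
form by a nonzero scalar. Modulo scalars, this is the group `PGO`. -/
def similitudes (A : Matrix (Fin (r + 1)) (Fin (r + 1)) F) : Subgroup (GL (Fin (r + 1)) F) where
  carrier := {g | ∃ c : F, c ≠ 0 ∧ g.val.transpose * A * g.val = c • A}
  one_mem' := ⟨1, one_ne_zero, by simp⟩
  mul_mem' := by
    rintro g h ⟨c, hc, hg⟩ ⟨d, hd, hh⟩
    refine ⟨c * d, mul_ne_zero hc hd, ?_⟩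
    calc (g * h).val.transpose * A * (g * h).val
        = h.val.transpose * (g.val.transpose * A * g.val) * h.val := by
          simp only [Units.val_mul, Matrix.transpose_mul, Matrix.mul_assoc]
      _ = (c * d) • A := by
          rw [hg, Matrix.mul_smul, Matrix.smul_mul, hh, smul_smul]
  inv_mem' := by
    rintro g ⟨c, hc, hg⟩
    refine ⟨c⁻¹, inv_ne_zero hc, ?_⟩
    have h1 : g.val * (g⁻¹).val = 1 := by rw [← Units.val_mul]; simp
    have h2 : (g⁻¹).val.transpose * g.val.transpose = 1 := by
      rw [← Matrix.transpose_mul, h1, Matrix.transpose_one]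
    have h3 : A = c • ((g⁻¹).val.transpose * A * (g⁻¹).val) := by
      calc A = ((g⁻¹).val.transpose * g.val.transpose) * A * (g.val * (g⁻¹).val) := by
            rw [h1, h2, Matrix.one_mul, Matrix.mul_one]
        _ = (g⁻¹).val.transpose * (g.val.transpose * A * g.val) * (g⁻¹).val := by
            simp only [Matrix.mul_assoc]
        _ = _ := by rw [hg, Matrix.mul_smul, Matrix.smul_mul]
    conv_rhs => rw [h3]
    rw [smul_smul, inv_mul_cancel₀ hc, one_smul]

/-- The points of `PG(r, F)` on the quadric that lie on the subspace `l`. -/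
def quadricOn (A : Matrix (Fin (r + 1)) (Fin (r + 1)) F) (l : Submodule F (Fin (r + 1) → F)) :
    Set (ℙ F (Fin (r + 1) → F)) :=
  {P | P ∈ quadric A ∧ P.submodule ≤ l}

/-- A line of `PG(r, F)` (a vector subspace of dimension two) contained in the quadric. -/
def IsLineOfQuadric (A : Matrix (Fin (r + 1)) (Fin (r + 1)) F)
    (l : Submodule F (Fin (r + 1) → F)) : Prop :=
  Module.finrank F l = 2 ∧ ∀ P : ℙ F (Fin (r + 1) → F), P.submodule ≤ l → P ∈ quadric A

/-- A line of `PG(r, F)` having no point in common with the quadric. -/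
def IsExternalLine (A : Matrix (Fin (r + 1)) (Fin (r + 1)) F)
    (l : Submodule F (Fin (r + 1) → F)) : Prop :=
  Module.finrank F l = 2 ∧ quadricOn A l = ∅

/-- A line of `PG(r, F)` having exactly two points in common with the quadric. -/
def IsSecantLine (A : Matrix (Fin (r + 1)) (Fin (r + 1)) F)
    (l : Submodule F (Fin (r + 1) → F)) : Prop :=
  Module.finrank F l = 2 ∧ (quadricOn A l).ncard = 2

end

section

variable {F : Type*} (K : Type*) [Field F] [Field K] [Algebra F K] {r : ℕ}

/-- The inclusion `F ^ (r + 1) → K ^ (r + 1)`, as a semilinear map. -/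
def incl (F K : Type*) [Field F] [Field K] [Algebra F K] (r : ℕ) :
    (Fin (r + 1) → F) →ₛₗ[algebraMap F K] (Fin (r + 1) → K) where
  toFun v := fun i => algebraMap F K (v i)
  map_add' _ _ := by ext i; simp
  map_smul' _ _ := by ext i; simp

theorem incl_injective (F K : Type*) [Field F] [Field K] [Algebra F K] (r : ℕ) :
    Function.Injective (incl F K r) := fun _ _ h =>
  funext fun i => (algebraMap F K).injective (congrFun h i)

/-- The embedding of `Σ = PG(r, F)` in `PG(r, K)`. -/
def embed : ℙ F (Fin (r + 1) → F) → ℙ K (Fin (r + 1) → K) :=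
  Projectivization.map (incl F K r) (incl_injective F K r)

/-- The extension over `K` of a subspace of `PG(r, F)`. -/
def extend (l : Submodule F (Fin (r + 1) → F)) : Submodule K (Fin (r + 1) → K) :=
  Submodule.span K (incl F K r '' l)

/-- The Hermitian form `h(x, y) = ∑ A i j * x i * (y j) ^ q`, where `q = |F|`. When `A` is the
Gram matrix over `F` of the orthogonal polarity `⊥`, this is the Hermitian form, unique up to a
scalar, whose unitary polarity `⊥ₕ` satisfies `⊥ ⊥ₕ = ⊥ₕ ⊥ = τ`, with `τ` the involution induced
by `x ↦ x ^ q` on coordinates. -/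
def herm (A : Matrix (Fin (r + 1)) (Fin (r + 1)) F) (x y : Fin (r + 1) → K) : K :=
  x ⬝ᵥ (A.map (algebraMap F K)).mulVec (fun j => y j ^ Nat.card F)

/-- The points of the Hermitian variety `H(r, q²)`. -/
def hermVariety (A : Matrix (Fin (r + 1)) (Fin (r + 1)) F) : Set (ℙ K (Fin (r + 1) → K)) :=
  {P | herm K A P.rep P.rep = 0}

/-- The points of the polar hyperplane of `P` with respect to the unitary polarity `⊥ₕ`. -/
def hermPerp (A : Matrix (Fin (r + 1)) (Fin (r + 1)) F) (P : ℙ K (Fin (r + 1) → K)) :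
    Set (ℙ K (Fin (r + 1) → K)) :=
  {R | herm K A R.rep P.rep = 0}

/-- `X` is an `i`-tight set of `H(r, q²)`, `r ≥ 4` even, where `q = |F|`. -/
def IsTight (A : Matrix (Fin (r + 1)) (Fin (r + 1)) F) (i : ℕ)
    (X : Set (ℙ K (Fin (r + 1) → K))) : Prop :=
  X ⊆ hermVariety K A ∧
    ∀ P ∈ hermVariety K A,
      (P ∈ X → (hermPerp K A P ∩ X).ncard =
        i * theta ((r - 4) / 2) (Nat.card F ^ 2) + Nat.card F ^ (r - 2)) ∧
      (P ∉ X → (hermPerp K A P ∩ X).ncard = i * theta ((r - 4) / 2) (Nat.card F ^ 2))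

/-- The group `G ≅ PGO(r + 1, q)` of projectivities of `Σ` stabilizing `Q(r, q)`, considered as a
group of projectivities of `PG(r, K)`. -/
def groupG (A : Matrix (Fin (r + 1)) (Fin (r + 1)) F) : Subgroup PGL(Fin (r + 1), K) :=
  (similitudes A).map
    (Matrix.ProjGenLinGroup.mk.comp (Matrix.GeneralLinearGroup.map (algebraMap F K)))

/-- `Q(r, q)` as a set of points of `PG(r, K)`. -/
def setQ (A : Matrix (Fin (r + 1)) (Fin (r + 1)) F) : Set (ℙ K (Fin (r + 1) → K)) :=
  embed K '' quadric A

/-- The points, not in `Σ`, on the extended lines of `Q(r, q)`. -/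
def setO (A : Matrix (Fin (r + 1)) (Fin (r + 1)) F) : Set (ℙ K (Fin (r + 1) → K)) :=
  {P | P ∉ Set.range (embed (F := F) K) ∧
    ∃ l, IsLineOfQuadric A l ∧ P.submodule ≤ extend K l}

/-- The points of `H(r, q²)` on the extended lines of `Σ` external to `Q(r, q)`. -/
def setE (A : Matrix (Fin (r + 1)) (Fin (r + 1)) F) : Set (ℙ K (Fin (r + 1) → K)) :=
  {P | P ∈ hermVariety K A ∧ ∃ l, IsExternalLine A l ∧ P.submodule ≤ extend K l}

/-- The points of `H(r, q²)`, not in `Q(r, q)`, on the extended lines of `Σ` secant to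
`Q(r, q)`. -/
def setS (A : Matrix (Fin (r + 1)) (Fin (r + 1)) F) : Set (ℙ K (Fin (r + 1) → K)) :=
  {P | P ∈ hermVariety K A ∧ P ∉ setQ K A ∧ ∃ l, IsSecantLine A l ∧ P.submodule ≤ extend K l}

end

end HermTight

end

/-!
Write `b` for the bilinear form of `A` over `K` and `h` for the Hermitian form, and choose `δ` in
`K` with `δ ^ q = -δ`. For a vector `Z = x + δ y` with `x`, `y` over `F`, the values `b(Z, Z)` and
`h(Z, Z)` determine the Gram matrix of `(x, y)`, so by Witt's extension theorem the isotropic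
vectors with a given value `b(Z, Z)` that are not multiples of vectors over `F` form one orbit of
the isometry group. If `b(Z, Z) ≠ 0`, rescaling leaves only one bit of information, whether
`2 δ b(Z, Z)` is a square, and this separates the lines that miss the quadric from the secants.

For tightness, call excess of a set at a point the difference between the size of its intersection
with the polar hyperplane and the required size. The excess of one orbit is constant on every
orbit. Two facts determine it:

* Over the points of a generator (a maximal totally isotropic subspace) the excess sums to zero.
  Some generators consist of points of `𝒬` and `𝒪` only; replacing one hyperbolic plane of a Witt
  decomposition yields generators whose points lie in `𝒬`, `𝒪` and just one of `ℰ` and `𝒮`. Hence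
  an excess that vanishes on `𝒬` vanishes everywhere.
* Counting orthogonal pairs in two ways gives `|X| ε_Y(X) = |Y| ε_X(Y)` for the excesses of two
  orbits `X` and `Y`.

A direct count shows that the excess of `𝒬` vanishes on `𝒬`, hence everywhere. By symmetry the
excess of each orbit then vanishes on `𝒬`, hence everywhere.
-/

noncomputable section

namespace HermTight

section Witt

variable {F V : Type*} [Field F] [AddCommGroup V] [Module F V] {B : LinearMap.BilinForm F V}

theorem exists_isOrthogonal_apply_eq_of_sub_nonsingular (hs : B.IsSymm) {a b : V}
    (hab : B a a = B b b) (hne : B (a - b) (a - b) ≠ 0) :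
    ∃ f : V →ₗ[F] V, B.IsOrthogonal f ∧ f a = b ∧ ∀ w, B w a = B w b → f w = w := by
  have hc : LinearMap.IsReflective B (a - b) :=
    ⟨.of_ne_zero hne, fun y => (IsUnit.mk0 _ hne).dvd⟩
  have hcoroot : ∀ w, LinearMap.IsReflective.coroot B hc w =
      2 * B (a - b) w / B (a - b) (a - b) := fun w => by
    rw [eq_div_iff hne, mul_comm, LinearMap.IsReflective.apply_self_mul_coroot_apply]
  refine ⟨(Module.reflection (LinearMap.IsReflective.coroot_apply_self B hc)).toLinearMap,
    LinearMap.IsReflective.isOrthogonal_reflection B hc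
      (LinearMap.BilinForm.isSymm_iff.1 hs), ?_, fun w hw => ?_⟩
  · have hone : 2 * B (a - b) a / B (a - b) (a - b) = 1 := by
      rw [div_eq_one_iff_eq hne]
      simp only [map_sub, LinearMap.sub_apply]
      linear_combination hab - hs.eq b a
    rw [LinearEquiv.coe_coe, Module.reflection_apply, hcoroot, hone]
    module
  · have hzero : B (a - b) w = 0 := by rw [hs.eq, map_sub, hw, sub_self]
    rw [LinearEquiv.coe_coe, Module.reflection_apply, hcoroot, hzero]
    simp

variable (B) in
/-- The Siegel transformation `x ↦ x + B(x, c) z - (B(x, z) + ½ B(z, z) B(x, c)) c`. It is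
orthogonal if `c` is singular and orthogonal to `z`, and it then moves every vector orthogonal to
`c` only along `c`. -/
def siegel (c z : V) : V →ₗ[F] V :=
  LinearMap.id + (B.flip c).smulRight z - (B.flip z + (B z z / 2) • B.flip c).smulRight c

theorem siegel_apply (c z x : V) :
    siegel B c z x = x + B x c • z - (B x z + B z z / 2 * B x c) • c := rfl

theorem isOrthogonal_siegel [NeZero (2 : F)] (hs : B.IsSymm) {c z : V} (hc : B c c = 0)
    (hcz : B c z = 0) : B.IsOrthogonal (siegel B c z) := by
  intro x y
  have hzc : B z c = 0 := by rw [hs.eq, hcz]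
  have h2 : (2 : F) ≠ 0 := two_ne_zero
  simp only [siegel_apply, map_add, map_sub, map_smul, LinearMap.add_apply, LinearMap.sub_apply,
    LinearMap.smul_apply, smul_eq_mul, hc, hcz, hzc, hs.eq c y, hs.eq z y]
  field_simp
  ring

section Nondegenerate

variable [FiniteDimensional F V]

theorem exists_orthogonal_apply_eq_one (hn : B.Nondegenerate) (hs : B.IsSymm)
    {W : Submodule F V} {a : V} (ha : a ∉ W) : ∃ z, (∀ w ∈ W, B w z = 0) ∧ B a z = 1 := by
  obtain ⟨φ, hφa, hφW⟩ := W.exists_le_ker_of_notMem ha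
  have hz : ∀ x, B x ((B.toDual hn).symm ((φ a)⁻¹ • φ)) = (φ a)⁻¹ * φ x := fun x => by
    rw [hs.eq, LinearMap.BilinForm.apply_toDual_symm_apply, LinearMap.smul_apply, smul_eq_mul]
  refine ⟨_, fun w hw => ?_, by rw [hz, inv_mul_cancel₀ hφa]⟩
  rw [hz, LinearMap.mem_ker.1 (hφW hw), mul_zero]

variable [NeZero (2 : F)]

theorem exists_orthogonal_apply_eq_one_norm_eq (hn : B.Nondegenerate) (hs : B.IsSymm)
    {W : Submodule F V} {c : V} (hcW : ∀ w ∈ W, B w c = 0) (hc : c ∉ W) (hcc : B c c = 0) (t : F) :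
    ∃ z, (∀ w ∈ W, B w z = 0) ∧ B c z = 1 ∧ B z z = t := by
  obtain ⟨y, hyW, hcy⟩ := exists_orthogonal_apply_eq_one hn hs hc
  have hyc : B y c = 1 := by rw [hs.eq, hcy]
  refine ⟨y + ((t - B y y) / 2) • c, fun w hw => ?_, ?_, ?_⟩
  · rw [map_add, map_smul, hyW w hw, hcW w hw, smul_zero, add_zero]
  · rw [map_add, map_smul, hcy, hcc, smul_zero, add_zero]
  · have h2 : (2 : F) ≠ 0 := two_ne_zero
    simp only [map_add, LinearMap.add_apply, map_smul, LinearMap.smul_apply, smul_eq_mul, hcc, hcy,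
      hyc]
    field_simp
    ring

omit [FiniteDimensional F V] in
theorem exists_isOrthogonal_apply_eq_of_sub_singular (hs : B.IsSymm) {a b z : V}
    (hab : B a a = B b b) (hsing : B (a - b) (a - b) = 0) (hz : B z z = 1)
    (hcz : B (a - b) z = 1) (haz : B a z ≠ 0) (hbz : B b z ≠ 0) :
    ∃ f : V →ₗ[F] V, B.IsOrthogonal f ∧ f a = b ∧
      ∀ w, B w a = B w b → B w z = 0 → f w = w := by
  -- The reflection in `z` sends `a` to `a'`, and then `a' - b` is nonsingular.
  obtain ⟨a', ha'⟩ : ∃ a', a' = a - (2 * B a z) • z := ⟨_, rfl⟩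
  have hza : B z a = B a z := hs.eq _ _
  have haa' : B a a = B a' a' := by
    simp only [ha', map_sub, LinearMap.sub_apply, map_smul, LinearMap.smul_apply, smul_eq_mul, hz,
      hza]
    ring
  have hne : B (a - a') (a - a') ≠ 0 := by simp [ha', hz, haz, two_ne_zero]
  have hne' : B (a' - b) (a' - b) ≠ 0 := by
    have hbz' : B b z = B a z - 1 := by rw [← hcz, LinearMap.map_sub₂, sub_sub_cancel]
    have hval : B (a' - b) (a' - b) = 2 * 2 * (B a z * B b z) := by
      obtain ⟨c, hc⟩ : ∃ c, c = a - b := ⟨_, rfl⟩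
      rw [← hc] at hsing hcz
      rw [show a' - b = c - (2 * B a z) • z by rw [ha', hc]; module]
      simp only [map_sub, LinearMap.sub_apply, map_smul, LinearMap.smul_apply, smul_eq_mul, hsing,
        hcz, hz, hs.eq z c, hbz']
      ring
    rw [hval]
    exact mul_ne_zero (mul_ne_zero two_ne_zero two_ne_zero) (mul_ne_zero haz hbz)
  obtain ⟨f, hf, hfa, hfw⟩ := exists_isOrthogonal_apply_eq_of_sub_nonsingular hs haa' hne
  obtain ⟨g, hg, hga, hgw⟩ :=
    exists_isOrthogonal_apply_eq_of_sub_nonsingular hs (haa'.symm.trans hab) hne'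
  refine ⟨g ∘ₗ f, fun x y => (hg _ _).trans (hf x y), by simp [hfa, hga], fun w hwab hwz => ?_⟩
  have hwa' : B w a = B w a' := by rw [ha', map_sub, map_smul, hwz, smul_zero, sub_zero]
  rw [LinearMap.comp_apply, hfw w hwa', hgw w (hwa'.symm.trans hwab)]

theorem exists_isOrthogonal_apply_eq_of_mem_sup (hn : B.Nondegenerate) (hs : B.IsSymm)
    {W : Submodule F V} {a b : V} (ha : a ∉ W) (hb : b ∉ W) (hab : B a a = B b b)
    (hW : ∀ w ∈ W, B w a = B w b) (hsing : B (a - b) (a - b) = 0)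
    (hmem : a ∈ W ⊔ Submodule.span F {a - b}) :
    ∃ f : V →ₗ[F] V, B.IsOrthogonal f ∧ f a = b ∧ ∀ w ∈ W, f w = w := by
  have hc : a - b ∉ W := fun h => ha (by
    rwa [sup_eq_left.2 ((Submodule.span_singleton_le_iff_mem _ _).2 h)] at hmem)
  have hcW : ∀ w ∈ W, B w (a - b) = 0 := fun w hw => by rw [map_sub, hW w hw, sub_self]
  obtain ⟨z, hzW, hcz, hzz⟩ := exists_orthogonal_apply_eq_one_norm_eq hn hs hcW hc hsing 1
  obtain ⟨w₀, hw₀, l, hl, hadd⟩ := Submodule.mem_sup.1 hmem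
  obtain ⟨k, rfl⟩ := Submodule.mem_span_singleton.1 hl
  have haz : B a z = k := by
    rw [← hadd, map_add, LinearMap.add_apply, hzW w₀ hw₀, map_smul, LinearMap.smul_apply, hcz]
    simp
  have hbz : B b z = k - 1 := by rw [← haz, ← hcz, LinearMap.map_sub₂, sub_sub_cancel]
  have hk0 : k ≠ 0 := by
    rintro rfl
    exact ha (by rwa [← hadd, zero_smul, add_zero])
  have hk1 : k ≠ 1 := by
    rintro rfl
    rw [one_smul] at hadd
    have hbw : b = w₀ := by simpa using (congrArg (· - (a - b)) hadd).symm
    exact hb (hbw ▸ hw₀)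
  obtain ⟨f, hf, hfa, hfw⟩ := exists_isOrthogonal_apply_eq_of_sub_singular hs hab hsing hzz hcz
    (haz ▸ hk0) (hbz ▸ sub_ne_zero.2 hk1)
  exact ⟨f, hf, hfa, fun w hw => hfw w (hW w hw) (hzW w hw)⟩

theorem exists_isOrthogonal_apply_eq_of_notMem_sup (hn : B.Nondegenerate) (hs : B.IsSymm)
    {W : Submodule F V} {a b : V} (hab : B a a = B b b) (hW : ∀ w ∈ W, B w a = B w b)
    (hsing : B (a - b) (a - b) = 0) (hmem : a ∉ W ⊔ Submodule.span F {a - b}) :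
    ∃ f : V →ₗ[F] V, B.IsOrthogonal f ∧ f a = b ∧ ∀ w ∈ W, f w = w := by
  obtain ⟨z, hz, haz⟩ := exists_orthogonal_apply_eq_one hn hs hmem
  have hcz : B (a - b) z = 0 :=
    hz _ (le_sup_right (a := W) (Submodule.mem_span_singleton_self (a - b)))
  have hac : B a (a - b) = 0 := by
    have h : 2 * B a (a - b) = B (a - b) (a - b) := by
      simp only [map_sub, LinearMap.sub_apply]
      linear_combination hab - hs.eq a b
    rw [hsing] at h
    exact (mul_eq_zero.1 h).resolve_left two_ne_zero
  refine ⟨siegel B (a - b) z, isOrthogonal_siegel hs hsing hcz, ?_, fun w hw => ?_⟩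
  · simp [siegel_apply, hac, haz]
  · simp only [siegel_apply, hz w (le_sup_left (a := W) hw), map_sub, hW w hw]
    simp

theorem exists_isOrthogonal_apply_eq (hn : B.Nondegenerate) (hs : B.IsSymm)
    {W : Submodule F V} {a b : V} (ha : a ∉ W) (hb : b ∉ W) (hab : B a a = B b b)
    (hW : ∀ w ∈ W, B w a = B w b) :
    ∃ f : V →ₗ[F] V, B.IsOrthogonal f ∧ f a = b ∧ ∀ w ∈ W, f w = w := by
  by_cases hsing : B (a - b) (a - b) = 0
  · by_cases hmem : a ∈ W ⊔ Submodule.span F {a - b}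
    · exact exists_isOrthogonal_apply_eq_of_mem_sup hn hs ha hb hab hW hsing hmem
    · exact exists_isOrthogonal_apply_eq_of_notMem_sup hn hs hab hW hsing hmem
  · obtain ⟨f, hf, hfa, hfW⟩ := exists_isOrthogonal_apply_eq_of_sub_nonsingular hs hab hsing
    exact ⟨f, hf, hfa, fun w hw => hfW w (hW w hw)⟩

omit [FiniteDimensional F V] [NeZero (2 : F)] in
theorem injective_of_isOrthogonal (hn : B.Nondegenerate) {f : V →ₗ[F] V}
    (hf : B.IsOrthogonal f) : Function.Injective f := by
  rw [injective_iff_map_eq_zero]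
  exact fun x hx => hn.1 x fun y => by rw [← hf, hx, map_zero, LinearMap.zero_apply]

theorem exists_isOrthogonal_of_gram_eq (hn : B.Nondegenerate) (hs : B.IsSymm) {k : ℕ}
    {u v : Fin k → V} (hu : LinearIndependent F u) (hv : LinearIndependent F v)
    (huv : ∀ i j, B (u i) (u j) = B (v i) (v j)) :
    ∃ f : V →ₗ[F] V, B.IsOrthogonal f ∧ ∀ i, f (u i) = v i := by
  induction k with
  | zero => exact ⟨LinearMap.id, fun _ _ => rfl, fun i => i.elim0⟩
  | succ k ih =>
    obtain ⟨f, hf, hfu⟩ := ih (hu.comp _ (Fin.castSucc_injective k))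
      (hv.comp _ (Fin.castSucc_injective k)) fun i j => huv _ _
    simp only [Function.comp_apply] at hfu
    have hfu' := hu.map' f (LinearMap.ker_eq_bot.2 (injective_of_isOrthogonal hn hf))
    rw [← Fin.snoc_init_self v, linearIndependent_finSnoc] at hv
    rw [← Fin.snoc_init_self (f ∘ u), linearIndependent_finSnoc] at hfu'
    have hinit : Fin.init (f ∘ u) = Fin.init v := funext hfu
    rw [hinit] at hfu'
    obtain ⟨g, hg, hga, hgW⟩ := exists_isOrthogonal_apply_eq hn hs hfu'.2 hv.2
      ((hf _ _).trans (huv _ _)) (W := Submodule.span F (Set.range (Fin.init v))) fun w hw => by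
        induction hw using Submodule.span_induction with
        | mem w hw =>
          obtain ⟨i, rfl⟩ := hw
          change B (v i.castSucc) (f (u (Fin.last k))) = B (v i.castSucc) (v (Fin.last k))
          rw [← hfu i, hf, huv, hfu]
        | zero => simp
        | add x y _ _ hx hy => simp only [map_add, LinearMap.add_apply, hx, hy]
        | smul c x _ hx => simp only [map_smul, LinearMap.smul_apply, hx]
    refine ⟨g ∘ₗ f, fun x y => (hg _ _).trans (hf x y), Fin.lastCases hga fun i => ?_⟩
    rw [LinearMap.comp_apply, hfu]
    exact hgW _ (Submodule.subset_span ⟨i, rfl⟩)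

end Nondegenerate

end Witt

section Frames

variable {F V : Type*} [Field F] [AddCommGroup V] [Module F V] {B : LinearMap.BilinForm F V}

/-- Vectors forming a Witt decomposition into hyperbolic planes `⟨e i, f i⟩` and an anisotropic
line `⟨g⟩`. -/
structure HypFrame {ι : Type*} [DecidableEq ι] (B : LinearMap.BilinForm F V) (e f : ι → V)
    (g : V) : Prop where
  ee : ∀ i j, B (e i) (e j) = 0
  ff : ∀ i j, B (f i) (f j) = 0
  ef : ∀ i j, B (e i) (f j) = if i = j then 1 else 0
  eg : ∀ i, B (e i) g = 0
  fg : ∀ i, B (f i) g = 0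
  gg : B g g ≠ 0

theorem HypFrame.cons (hs : B.IsSymm) {e₀ f₀ : V} (he : B e₀ e₀ = 0) (hf : B f₀ f₀ = 0)
    (hef : B e₀ f₀ = 1) {W : Submodule F V} (heW : ∀ w : W, B e₀ w = 0)
    (hfW : ∀ w : W, B f₀ w = 0) {m : ℕ} {e f : Fin m → W} {g : W}
    (H : HypFrame (B.restrict W) e f g) :
    HypFrame B (Fin.cons e₀ fun i => (e i : V) : Fin (m + 1) → V)
      (Fin.cons f₀ fun i => (f i : V)) g where
  ee := Fin.cases (Fin.cases he fun j => heW _) fun i =>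
    Fin.cases ((hs.eq _ _).trans (heW _)) fun j => H.ee i j
  ff := Fin.cases (Fin.cases hf fun j => hfW _) fun i =>
    Fin.cases ((hs.eq _ _).trans (hfW _)) fun j => H.ff i j
  ef := Fin.cases (Fin.cases hef fun j => heW _) fun i =>
    Fin.cases ((hs.eq _ _).trans (hfW _)) fun j => by simpa using H.ef i j
  eg := Fin.cases (heW _) H.eg
  fg := Fin.cases (hfW _) H.fg
  gg := H.gg

theorem nondegenerate_restrict_ker_prod (hn : B.Nondegenerate) (hs : B.IsSymm) {e f : V}
    (he : B e e = 0) (hf : B f f = 0) (hef : B e f = 1) :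
    (B.restrict (LinearMap.ker ((B e).prod (B f)))).Nondegenerate := by
  have hfe : B f e = 1 := by rw [hs.eq, hef]
  refine (LinearMap.IsRefl.nondegenerate_iff_separatingLeft fun x y h => ?_).2 ?_
  · exact (hs.eq _ _).trans h
  rintro ⟨x, hx⟩ hxW
  obtain ⟨hex, hfx⟩ : B e x = 0 ∧ B f x = 0 := by simpa using hx
  refine Subtype.ext (hn.1 x fun y => ?_)
  have hmem : y - B f y • e - B e y • f ∈ LinearMap.ker ((B e).prod (B f)) := by
    simp [he, hf, hef, hfe]
  have hproj : B x (y - B f y • e - B e y • f) = 0 := hxW ⟨_, hmem⟩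
  simpa only [map_sub, map_smul, hs.eq x e, hs.eq x f, hex, hfx, smul_zero, sub_zero] using hproj

theorem finrank_ker_prod_add_two [FiniteDimensional F V] (hs : B.IsSymm) {e f : V}
    (he : B e e = 0) (hf : B f f = 0) (hef : B e f = 1) :
    Module.finrank F (LinearMap.ker ((B e).prod (B f))) + 2 = Module.finrank F V := by
  have hfe : B f e = 1 := by rw [hs.eq, hef]
  have hsurj : Function.Surjective ((B e).prod (B f)) := fun ⟨a, b⟩ =>
    ⟨b • e + a • f, by simp [he, hf, hef, hfe]⟩
  have h := LinearMap.finrank_range_add_finrank_ker ((B e).prod (B f))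
  rwa [LinearMap.range_eq_top.2 hsurj, finrank_top, Module.finrank_prod, Module.finrank_self,
    add_comm] at h

section Finite

variable [Finite F] [NeZero (2 : F)]

omit [Finite F] in
theorem ringChar_ne_two : ringChar F ≠ 2 := fun h =>
  two_ne_zero (α := F) (by simpa [h] using CharP.cast_eq_zero F (ringChar F))

theorem odd_card : Odd (Nat.card F) := by
  have := Fintype.ofFinite F
  rw [Nat.card_eq_fintype_card, Nat.odd_iff]
  exact FiniteField.odd_card_of_char_ne_two ringChar_ne_two

theorem exists_mul_sq_add_mul_sq_add_eq_zero {a b : F} (ha : a ≠ 0) (hb : b ≠ 0) (c : F) :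
    ∃ x y, a * x ^ 2 + b * y ^ 2 + c = 0 := by
  have := Fintype.ofFinite F
  obtain ⟨x, y, hxy⟩ := FiniteField.exists_root_sum_quadratic
    (Polynomial.degree_quadratic (b := 0) (c := 0) ha)
    (Polynomial.degree_quadratic (b := 0) (c := c) hb)
    (FiniteField.odd_card_of_char_ne_two ringChar_ne_two)
  exact ⟨x, y, by simpa [add_assoc] using hxy⟩

variable [FiniteDimensional F V]

theorem exists_singular (hn : B.Nondegenerate) (hs : B.IsSymm)
    (h3 : 3 ≤ Module.finrank F V) : ∃ e, e ≠ 0 ∧ B e e = 0 := by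
  have : Invertible (2 : F) := invertibleOfNonzero two_ne_zero
  obtain ⟨v, hv⟩ := LinearMap.BilinForm.exists_orthogonal_basis
    (LinearMap.BilinForm.isSymm_iff.1 hs)
  have hv0 : ∀ i, B (v i) (v i) ≠ 0 :=
    LinearMap.BilinForm.iIsOrtho.not_isOrtho_basis_self_of_nondegenerate hv hn
  let ι : Fin 3 → Fin (Module.finrank F V) := Fin.castLE h3
  have hι : ∀ i j, i ≠ j → B (v (ι i)) (v (ι j)) = 0 := fun i j hij =>
    hv fun h => hij (Fin.castLE_injective h3 h)
  obtain ⟨a, b, hab⟩ := exists_mul_sq_add_mul_sq_add_eq_zero (hv0 (ι 0)) (hv0 (ι 1))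
    (B (v (ι 2)) (v (ι 2)))
  refine ⟨a • v (ι 0) + b • v (ι 1) + v (ι 2), fun h => ?_, ?_⟩
  · have h2 := congrArg (v.repr · (ι 2)) h
    have h02 : ι 2 ≠ ι 0 := by simp [ι, Fin.ext_iff]
    have h12 : ι 2 ≠ ι 1 := by simp [ι, Fin.ext_iff]
    simp [h02, h12] at h2
  · simp only [map_add, map_smul, LinearMap.add_apply, LinearMap.smul_apply, smul_eq_mul,
      hι 0 1 (by decide), hι 0 2 (by decide), hι 1 2 (by decide), hι 1 0 (by decide),
      hι 2 0 (by decide), hι 2 1 (by decide)]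
    linear_combination hab

theorem exists_hypFrame (hn : B.Nondegenerate) (hs : B.IsSymm) {m : ℕ}
    (hd : Module.finrank F V = 2 * m + 1) :
    ∃ (e f : Fin m → V) (g : V), HypFrame B e f g := by
  induction m generalizing V with
  | zero =>
    obtain ⟨g, hg, hgen⟩ := finrank_eq_one_iff'.1 hd
    refine ⟨Fin.elim0, Fin.elim0, g, fun i => i.elim0, fun i => i.elim0, fun i => i.elim0,
      fun i => i.elim0, fun i => i.elim0, fun h => hg (hn.1 g fun y => ?_)⟩
    obtain ⟨c, rfl⟩ := hgen y
    rw [map_smul, h, smul_zero]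
  | succ m ih =>
    obtain ⟨e₀, he₀, he⟩ := exists_singular hn hs (by omega)
    obtain ⟨f₀, -, hef, hf⟩ :=
      exists_orthogonal_apply_eq_one_norm_eq hn hs (W := ⊥) (by simp) (by simpa using he₀) he 0
    have hW : ∀ w : LinearMap.ker ((B e₀).prod (B f₀)), B e₀ w = 0 ∧ B f₀ w = 0 := fun w => by
      simpa using w.2
    have hdW := finrank_ker_prod_add_two hs he hf hef
    obtain ⟨e, f, g, H⟩ := ih (nondegenerate_restrict_ker_prod hn hs he hf hef)
      ⟨fun x y => hs.eq x y⟩ (by omega)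
    exact ⟨_, _, _, H.cons hs he hf hef (fun w => (hW w).1) fun w => (hW w).2⟩

end Finite
end Frames

section Frobenius

variable (F K : Type*) [Field F] [Field K] [Algebra F K] [Finite F]

/-- The Frobenius map `x ↦ x ^ |F|` of an algebra over the finite field `F`. -/
def frob : K →ₐ[F] K :=
  letI := Fintype.ofFinite F
  FiniteField.frobeniusAlgHom F K

variable {F K}

theorem frob_apply (x : K) : frob F K x = x ^ Nat.card F := by
  let := Fintype.ofFinite F
  rw [Nat.card_eq_fintype_card]
  rfl

theorem frob_frob [Finite K] (hK : Nat.card K = Nat.card F ^ 2) (x : K) :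
    frob F K (frob F K x) = x := by
  let := Fintype.ofFinite K
  rw [frob_apply, frob_apply, ← pow_mul, ← pow_two, ← hK, Nat.card_eq_fintype_card,
    FiniteField.pow_card]

variable (F K) in
/-- `K` is the quadratic extension of the finite field `F` and `δ` is an element of trace zero,
with square `d`, so that `K = F ⊕ δ F` and `x + δ y ↦ x - δ y` is the Frobenius map. -/
structure QuadExt (δ : K) (d : F) : Prop where
  card : Nat.card K = Nat.card F ^ 2
  sq : δ * δ = algebraMap F K d
  frob : frob F K δ = -δ
  d_ne : d ≠ 0

theorem two_ne_zero_of_odd_card (hodd : Odd (Nat.card F)) : (2 : F) ≠ 0 := by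
  let := Fintype.ofFinite F
  intro h
  have h2 : ringChar F = 2 := CharP.ringChar_of_prime_eq_zero Nat.prime_two (by exact_mod_cast h)
  have := FiniteField.even_card_of_char_two h2
  rw [Nat.card_eq_fintype_card, Nat.odd_iff] at hodd
  omega

section TwoNeZero

variable [NeZero (2 : F)]

theorem neZero_two_algebra (F K : Type*) [Field F] [Field K] [Algebra F K] [NeZero (2 : F)] :
    NeZero (2 : K) :=
  ⟨map_ofNat (algebraMap F K) 2 ▸ (map_ne_zero (algebraMap F K)).2 two_ne_zero⟩

theorem isSquare_algebraMap [Finite K] (hK : Nat.card K = Nat.card F ^ 2) (a : F) :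
    IsSquare (algebraMap F K a) := by
  let := Fintype.ofFinite F
  let := Fintype.ofFinite K
  have := neZero_two_algebra F K
  rcases eq_or_ne a 0 with rfl | ha
  · exact ⟨0, by simp⟩
  obtain ⟨k, hk⟩ := odd_card (F := F)
  rw [FiniteField.isSquare_iff ringChar_ne_two (by simpa using ha), ← map_pow,
    ← Nat.card_eq_fintype_card, hK]
  have hexp : Nat.card F ^ 2 / 2 = (Nat.card F - 1) * (k + 1) := by
    have : (2 * k + 1) ^ 2 = 2 * (2 * k * (k + 1)) + 1 := by ring
    rw [hk, this, Nat.add_sub_cancel]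
    omega
  rw [hexp, pow_mul, Nat.card_eq_fintype_card, FiniteField.pow_card_sub_one_eq_one a ha, one_pow,
    map_one]

theorem exists_quadExt [Finite K] (hK : Nat.card K = Nat.card F ^ 2) :
    ∃ (δ : K) (d : F), QuadExt F K δ d := by
  let := Fintype.ofFinite F
  obtain ⟨d, hd⟩ := FiniteField.exists_nonsquare (F := F) ringChar_ne_two
  have hd0 : d ≠ 0 := by rintro rfl; exact hd ⟨0, by simp⟩
  obtain ⟨δ, hδ⟩ := isSquare_algebraMap hK d
  have hδ0 : δ ≠ 0 := by rintro rfl; exact hd0 (by simpa using hδ)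
  refine ⟨δ, d, hK, hδ.symm, ?_, hd0⟩
  have hsq : frob F K δ * frob F K δ = δ * δ := by rw [← map_mul, ← hδ, AlgHom.commutes]
  refine (mul_self_eq_mul_self_iff.1 hsq).resolve_left fun hfix => hd ?_
  -- If `δ` were fixed, `d ^ ((q - 1) / 2) = δ ^ (q - 1) = 1` would make `d` a square in `F`.
  have hpow : δ ^ (Fintype.card F - 1) = 1 := by
    rw [frob_apply, Nat.card_eq_fintype_card] at hfix
    refine mul_right_cancel₀ hδ0 ?_
    rw [← pow_succ, Nat.sub_add_cancel Fintype.card_pos, hfix, one_mul]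
  have hodd : Fintype.card F % 2 = 1 := FiniteField.odd_card_of_char_ne_two ringChar_ne_two
  refine (FiniteField.isSquare_iff ringChar_ne_two hd0).2 ((algebraMap F K).injective ?_)
  rw [map_pow, hδ, map_one, ← hpow, ← pow_two, ← pow_mul]
  congr 1
  omega

end TwoNeZero

namespace QuadExt

variable {δ : K} {d : F} (Δ : QuadExt F K δ d)
include Δ

theorem ne_zero : δ ≠ 0 := by
  rintro rfl
  exact Δ.d_ne (by simpa using Δ.sq.symm)

variable [NeZero (2 : F)]

theorem eq_zero {a b : F} (h : algebraMap F K a + δ * algebraMap F K b = 0) : a = 0 ∧ b = 0 := by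
  have hconj := congrArg (HermTight.frob F K) h
  simp only [map_add, map_mul, AlgHom.commutes, Δ.frob, map_zero] at hconj
  have ha : algebraMap F K a = 0 := by
    have := neZero_two_algebra F K
    exact (mul_eq_zero.1 (by linear_combination h + hconj)).resolve_left (two_ne_zero (α := K))
  refine ⟨by simpa using ha, ?_⟩
  rw [ha, zero_add] at h
  simpa [Δ.ne_zero] using h

theorem ext {a b a' b' : F} (h : algebraMap F K a + δ * algebraMap F K b =
    algebraMap F K a' + δ * algebraMap F K b') : a = a' ∧ b = b' := by
  have := Δ.eq_zero (a := a - a') (b := b - b') (by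
    simp only [map_sub]; linear_combination h)
  exact ⟨sub_eq_zero.1 this.1, sub_eq_zero.1 this.2⟩

theorem bijective [Finite K] :
    Function.Bijective (fun p : F × F => algebraMap F K p.1 + δ * algebraMap F K p.2) := by
  let := Fintype.ofFinite F
  let := Fintype.ofFinite K
  rw [Fintype.bijective_iff_injective_and_card]
  refine ⟨fun p p' h => Prod.ext (Δ.ext h).1 (Δ.ext h).2, ?_⟩
  rw [Fintype.card_prod, ← Nat.card_eq_fintype_card (α := K), Δ.card, Nat.card_eq_fintype_card,
    pow_two]

theorem exists_eq [Finite K] (z : K) : ∃ a b : F, z = algebraMap F K a + δ * algebraMap F K b := by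
  obtain ⟨p, hp⟩ := Δ.bijective.2 z
  exact ⟨p.1, p.2, hp.symm⟩

end QuadExt

end Frobenius

section Forms

variable {F : Type*} (K : Type*) [Field F] [Field K] [Algebra F K] {r : ℕ}

/-- The symmetric bilinear form over `F` with Gram matrix `A`. -/
def formF (A : Matrix (Fin (r + 1)) (Fin (r + 1)) F) : LinearMap.BilinForm F (Fin (r + 1) → F) :=
  Matrix.toBilin' A

/-- The extension to `K` of the bilinear form over `F` with Gram matrix `A`. -/
def formK (A : Matrix (Fin (r + 1)) (Fin (r + 1)) F) : LinearMap.BilinForm K (Fin (r + 1) → K) :=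
  Matrix.toBilin' (A.map (algebraMap F K))

variable {A : Matrix (Fin (r + 1)) (Fin (r + 1)) F}

theorem formF_apply (x y : Fin (r + 1) → F) : formF A x y = x ⬝ᵥ A.mulVec y :=
  Matrix.toBilin'_apply' A x y

theorem formK_apply (x y : Fin (r + 1) → K) :
    formK K A x y = x ⬝ᵥ (A.map (algebraMap F K)).mulVec y := Matrix.toBilin'_apply' _ x y

theorem isSymm_formF (hA : A.IsSymm) : (formF A).IsSymm :=
  Matrix.isSymm_toBilin'_iff_isSymm.2 hA

theorem isSymm_formK (hA : A.IsSymm) : (formK K A).IsSymm :=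
  Matrix.isSymm_toBilin'_iff_isSymm.2 (hA.map _)

theorem nondegenerate_formF (hdet : A.det ≠ 0) : (formF A).Nondegenerate :=
  LinearMap.BilinForm.nondegenerate_toBilin'_iff_det_ne_zero.2 hdet

theorem formK_incl (x y : Fin (r + 1) → F) :
    formK K A (incl F K r x) (incl F K r y) = algebraMap F K (formF A x y) := by
  simp [formK_apply, formF_apply, dotProduct, Matrix.mulVec, incl]

theorem incl_ne_zero {x : Fin (r + 1) → F} (hx : x ≠ 0) : incl F K r x ≠ 0 :=
  (map_ne_zero_iff _ (incl_injective F K r)).2 hx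

variable {K} [Finite F]

variable (F) in
/-- The coordinatewise Frobenius map, which induces the involution `τ` of `PG(r, K)`. -/
def tau (X : Fin (r + 1) → K) : Fin (r + 1) → K := fun i => frob F K (X i)

theorem herm_eq (X Y : Fin (r + 1) → K) : herm K A X Y = formK K A X (tau F Y) := by
  have htau : tau F Y = fun j => Y j ^ Nat.card F := funext fun j => frob_apply (Y j)
  rw [formK_apply, herm, htau]

theorem tau_add (X Y : Fin (r + 1) → K) : tau F (X + Y) = tau F X + tau F Y := by
  funext i; simp [tau]

theorem tau_smul (c : K) (X : Fin (r + 1) → K) : tau F (c • X) = frob F K c • tau F X := by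
  funext i; simp [tau]

theorem tau_incl (x : Fin (r + 1) → F) : tau F (incl F K r x) = incl F K r x := by
  funext i; simp [tau, incl]

theorem formK_tau (X Y : Fin (r + 1) → K) :
    formK K A (tau F X) (tau F Y) = frob F K (formK K A X Y) := by
  simp [formK_apply, dotProduct, Matrix.mulVec, tau]

theorem herm_add_left (X Y Z : Fin (r + 1) → K) :
    herm K A (X + Y) Z = herm K A X Z + herm K A Y Z := by simp [herm_eq]

theorem herm_smul_left (c : K) (X Y : Fin (r + 1) → K) :
    herm K A (c • X) Y = c * herm K A X Y := by simp [herm_eq]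

theorem herm_add_right (X Y Z : Fin (r + 1) → K) :
    herm K A X (Y + Z) = herm K A X Y + herm K A X Z := by simp [herm_eq, tau_add]

theorem herm_smul_right (c : K) (X Y : Fin (r + 1) → K) :
    herm K A X (c • Y) = frob F K c * herm K A X Y := by simp [herm_eq, tau_smul]

theorem herm_smul_smul (c : K) (Z : Fin (r + 1) → K) :
    herm K A (c • Z) (c • Z) = c * frob F K c * herm K A Z Z := by
  rw [herm_smul_left, herm_smul_right, mul_assoc]

theorem herm_incl (x y : Fin (r + 1) → F) :
    herm K A (incl F K r x) (incl F K r y) = algebraMap F K (formF A x y) := by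
  rw [herm_eq, tau_incl, formK_incl]

theorem herm_swap [Finite K] (hK : Nat.card K = Nat.card F ^ 2) (hA : A.IsSymm)
    (X Y : Fin (r + 1) → K) : herm K A Y X = frob F K (herm K A X Y) := by
  have htau : tau F (tau F Y) = Y := funext fun i => frob_frob hK (Y i)
  rw [herm_eq, herm_eq, ← formK_tau, htau, (isSymm_formK K hA).eq]

theorem herm_comm [Finite K] (hK : Nat.card K = Nat.card F ^ 2) (hA : A.IsSymm)
    (X Y : Fin (r + 1) → K) : herm K A Y X = 0 ↔ herm K A X Y = 0 := by
  rw [herm_swap hK hA, map_eq_zero]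

variable {δ : K} {d : F} (Δ : QuadExt F K δ d)
include Δ

theorem herm_incl_add (hA : A.IsSymm) (x y : Fin (r + 1) → F) :
    herm K A (incl F K r x + δ • incl F K r y) (incl F K r x + δ • incl F K r y) =
      algebraMap F K (formF A x x - d * formF A y y) := by
  simp only [herm_add_left, herm_add_right, herm_smul_left, herm_smul_right, herm_incl, Δ.frob,
    map_sub, map_mul, (isSymm_formF hA).eq y x, ← Δ.sq]
  ring

theorem formK_incl_add (hA : A.IsSymm) (x y : Fin (r + 1) → F) :
    formK K A (incl F K r x + δ • incl F K r y) (incl F K r x + δ • incl F K r y) =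
      algebraMap F K (formF A x x + d * formF A y y) + δ * algebraMap F K (2 * formF A x y) := by
  simp only [map_add, map_smul, LinearMap.add_apply, LinearMap.smul_apply, smul_eq_mul, formK_incl,
    map_mul, (isSymm_formF hA).eq y x, ← Δ.sq, map_ofNat]
  ring

variable [NeZero (2 : F)]

theorem exists_incl_add [Finite K] (Z : Fin (r + 1) → K) :
    ∃ x y : Fin (r + 1) → F, Z = incl F K r x + δ • incl F K r y := by
  choose x y h using fun i => Δ.exists_eq (Z i)
  exact ⟨x, y, funext h⟩

theorem incl_add_ext {x y x' y' : Fin (r + 1) → F}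
    (h : incl F K r x + δ • incl F K r y = incl F K r x' + δ • incl F K r y') :
    x = x' ∧ y = y' :=
  ⟨funext fun i => (Δ.ext (congrFun h i)).1, funext fun i => (Δ.ext (congrFun h i)).2⟩

theorem formF_eq_of_formK_eq (hA : A.IsSymm) {x y : Fin (r + 1) → F} {a c : F}
    (hh : herm K A (incl F K r x + δ • incl F K r y) (incl F K r x + δ • incl F K r y) = 0)
    (hb : formK K A (incl F K r x + δ • incl F K r y) (incl F K r x + δ • incl F K r y) =
      algebraMap F K (2 * a) + δ * algebraMap F K (2 * c)) :
    formF A x x = a ∧ d * formF A y y = a ∧ formF A x y = c := by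
  rw [herm_incl_add Δ hA, map_eq_zero, sub_eq_zero] at hh
  rw [formK_incl_add Δ hA, ← hh, ← two_mul] at hb
  obtain ⟨hxx, hxy⟩ := Δ.ext hb
  have hxx := mul_left_cancel₀ two_ne_zero hxx
  exact ⟨hxx, hh ▸ hxx, mul_left_cancel₀ two_ne_zero hxy⟩

theorem formF_eq_zero_of_formK_eq_zero (hA : A.IsSymm) {x y : Fin (r + 1) → F}
    (hh : herm K A (incl F K r x + δ • incl F K r y) (incl F K r x + δ • incl F K r y) = 0)
    (hb : formK K A (incl F K r x + δ • incl F K r y) (incl F K r x + δ • incl F K r y) = 0) :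
    formF A x x = 0 ∧ formF A y y = 0 ∧ formF A x y = 0 := by
  simpa [Δ.d_ne] using formF_eq_of_formK_eq Δ hA (a := 0) (c := 0) hh (by rw [hb]; simp)

end Forms

section PointsOf

variable {L : Type*} [Field L] {r : ℕ}

/-- The set of points described by a predicate on vectors, which is tested on representatives. -/
def pointsOf (p : (Fin (r + 1) → L) → Prop) : Set (ℙ L (Fin (r + 1) → L)) := {P | p P.rep}

/-- A predicate on nonzero vectors that is invariant under nonzero scalars. -/
structure Homogeneous (p : (Fin (r + 1) → L) → Prop) : Prop where
  ne_zero : ∀ Z, p Z → Z ≠ 0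
  smul : ∀ (c : L) (Z), c ≠ 0 → p Z → p (c • Z)

variable {p : (Fin (r + 1) → L) → Prop}

theorem Homogeneous.smul_iff (hp : Homogeneous p) {c : L} (hc : c ≠ 0) (Z : Fin (r + 1) → L) :
    p (c • Z) ↔ p Z := by
  refine ⟨fun h => ?_, hp.smul c Z hc⟩
  simpa only [inv_smul_smul₀ hc] using hp.smul c⁻¹ _ (inv_ne_zero hc) h

theorem mk_mem_pointsOf (hp : Homogeneous p) (Z : Fin (r + 1) → L) (hZ : Z ≠ 0) :
    Projectivization.mk L Z hZ ∈ pointsOf p ↔ p Z := by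
  obtain ⟨a, ha⟩ := Projectivization.exists_smul_eq_mk_rep L Z hZ
  change p (Projectivization.mk L Z hZ).rep ↔ _
  rw [← ha]
  exact hp.smul_iff a.ne_zero Z

theorem submodule_le_iff_rep_mem (P : ℙ L (Fin (r + 1) → L))
    (l : Submodule L (Fin (r + 1) → L)) : P.submodule ≤ l ↔ P.rep ∈ l := by
  rw [Projectivization.submodule_eq, Submodule.span_singleton_le_iff_mem]

theorem finrank_span_pair {x y : Fin (r + 1) → L} (hi : LinearIndependent L ![x, y]) :
    Module.finrank L (Submodule.span L {x, y}) = 2 := by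
  rw [← Matrix.range_cons_cons_empty x y ![], finrank_span_eq_card hi, Fintype.card_fin]

theorem mk_eq_iff_exists_smul_rep {v : Fin (r + 1) → L} (hv : v ≠ 0)
    {P : ℙ L (Fin (r + 1) → L)} : Projectivization.mk L v hv = P ↔ ∃ a : L, a • P.rep = v := by
  conv_lhs => rw [← Projectivization.mk_rep P]
  exact Projectivization.mk_eq_mk_iff' _ _ _ _ _

end PointsOf

section Classes

variable {F K : Type*} [Field F] [Field K] [Algebra F K] {r : ℕ}

/-- The predicate on vectors over `K` satisfied by the nonzero multiples of the vectors over `F`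
that satisfy `p`. -/
def scalarExt (p : (Fin (r + 1) → F) → Prop) (Z : Fin (r + 1) → K) : Prop :=
  Z ≠ 0 ∧ ∃ (c : K) (x : Fin (r + 1) → F), Z = c • incl F K r x ∧ p x

theorem homogeneous_scalarExt (p : (Fin (r + 1) → F) → Prop) :
    Homogeneous (scalarExt (K := K) p) :=
  ⟨fun _ h => h.1, fun c _ hc ⟨h0, a, x, hZ, hx⟩ =>
    ⟨smul_ne_zero hc h0, c * a, x, by rw [hZ, smul_smul], hx⟩⟩

theorem embed_mk_eq_iff {x : Fin (r + 1) → F} (hx : x ≠ 0) {P : ℙ K (Fin (r + 1) → K)} :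
    embed K (Projectivization.mk F x hx) = P ↔ ∃ c : K, P.rep = c • incl F K r x := by
  conv_lhs => rw [← Projectivization.mk_rep P]
  rw [embed, Projectivization.map_mk, eq_comm, Projectivization.mk_eq_mk_iff']
  simp only [eq_comm]

theorem image_embed_pointsOf {p : (Fin (r + 1) → F) → Prop}
    (hp : ∀ (c : F) (x), c ≠ 0 → p x → p (c • x)) :
    embed K '' pointsOf p = pointsOf (scalarExt p) := by
  ext P
  constructor
  · rintro ⟨R, hR, rfl⟩
    obtain ⟨c, hc⟩ := (embed_mk_eq_iff R.rep_nonzero (P := embed K R)).1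
      (by rw [Projectivization.mk_rep])
    exact ⟨Projectivization.rep_nonzero _, c, R.rep, hc, hR⟩
  · rintro ⟨h0, c, x, hP, hx⟩
    have hx0 : x ≠ 0 := by rintro rfl; exact h0 (by rw [hP, map_zero, smul_zero])
    refine ⟨Projectivization.mk F x hx0, ?_, (embed_mk_eq_iff hx0).2 ⟨c, hP⟩⟩
    obtain ⟨a, ha⟩ := Projectivization.exists_smul_eq_mk_rep F x hx0
    change p (Projectivization.mk F x hx0).rep
    rw [← ha]
    exact hp a x a.ne_zero hx

variable (A : Matrix (Fin (r + 1)) (Fin (r + 1)) F)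

/-- Nonzero isotropic vectors of the Hermitian form. -/
def VecH (Z : Fin (r + 1) → K) : Prop := Z ≠ 0 ∧ herm K A Z Z = 0

/-- Representatives of the points of `Q(r, q)`. -/
def VecQ : (Fin (r + 1) → K) → Prop := scalarExt fun x => formF A x x = 0

/-- Representatives of the points of `𝒪`: vectors that are singular for both forms but not
multiples of vectors over `F`. -/
def VecO (Z : Fin (r + 1) → K) : Prop := VecH A Z ∧ formK K A Z Z = 0 ∧ ¬ VecQ A Z

variable (δ : K)

/-- Representatives of the points of `ℰ`. For an isotropic vector `Z = x + δ y`, the element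
`2 δ b(Z, Z)` of `K` is a nonzero square exactly if the plane `⟨x, y⟩` over `F` is hyperbolic. -/
def VecE (Z : Fin (r + 1) → K) : Prop :=
  VecH A Z ∧ formK K A Z Z ≠ 0 ∧ ¬ IsSquare (2 * δ * formK K A Z Z)

/-- Representatives of the points of `𝒮`. -/
def VecS (Z : Fin (r + 1) → K) : Prop :=
  VecH A Z ∧ formK K A Z Z ≠ 0 ∧ IsSquare (2 * δ * formK K A Z Z)

variable {A δ}

theorem formK_smul_smul (c : K) (Z : Fin (r + 1) → K) :
    formK K A (c • Z) (c • Z) = c * c * formK K A Z Z := by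
  simp [mul_assoc]

theorem isSquare_mul_mul_self_mul_iff {s : K} (hs : s ≠ 0) (a b : K) :
    IsSquare (a * (s * s * b)) ↔ IsSquare (a * b) := by
  constructor
  · rintro ⟨t, ht⟩
    exact ⟨t / s, by field_simp; linear_combination ht⟩
  · rintro ⟨t, ht⟩
    exact ⟨s * t, by linear_combination (s * s) * ht⟩

theorem hermVariety_eq : hermVariety K A = pointsOf (VecH A) :=
  Set.ext fun P => ⟨fun h => ⟨P.rep_nonzero, h⟩, fun h => h.2⟩

theorem mem_quadric (P : ℙ F (Fin (r + 1) → F)) : P ∈ quadric A ↔ formF A P.rep P.rep = 0 := by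
  rw [formF_apply]; rfl

theorem formF_smul_smul_eq_zero {c : F} {x : Fin (r + 1) → F} (hx : formF A x x = 0) :
    formF A (c • x) (c • x) = 0 := by simp [hx]

theorem setQ_eq : setQ K A = pointsOf (VecQ A) := by
  have hquad : quadric A = pointsOf fun x => formF A x x = 0 := Set.ext mem_quadric
  rw [setQ, hquad]
  exact image_embed_pointsOf (p := fun x => formF A x x = 0)
    fun _ _ _ hx => formF_smul_smul_eq_zero hx

theorem mem_range_embed (P : ℙ K (Fin (r + 1) → K)) :
    P ∈ Set.range (embed (F := F) K) ↔
      ∃ (c : K) (x : Fin (r + 1) → F), P.rep = c • incl F K r x := by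
  have himage := image_embed_pointsOf (K := K) (p := fun _ : Fin (r + 1) → F => True)
    fun _ _ _ _ => trivial
  have huniv : pointsOf (fun _ : Fin (r + 1) → F => True) = Set.univ := rfl
  rw [huniv, Set.image_univ] at himage
  simp [himage, pointsOf, scalarExt, Projectivization.rep_nonzero]

theorem mk_mem_quadricOn (x : Fin (r + 1) → F) (hx : x ≠ 0)
    (l : Submodule F (Fin (r + 1) → F)) :
    Projectivization.mk F x hx ∈ quadricOn A l ↔ formF A x x = 0 ∧ x ∈ l := by
  obtain ⟨a, ha⟩ := Projectivization.exists_smul_eq_mk_rep F x hx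
  have hrep : formF A (Projectivization.mk F x hx).rep (Projectivization.mk F x hx).rep = 0 ↔
      formF A x x = 0 := by rw [← ha, Units.smul_def]; simp
  rw [quadricOn, Set.mem_ofPred_eq, mem_quadric, hrep, Projectivization.submodule_mk,
    Submodule.span_singleton_le_iff_mem]

theorem isLineOfQuadric_iff {l : Submodule F (Fin (r + 1) → F)} :
    IsLineOfQuadric A l ↔ Module.finrank F l = 2 ∧ ∀ x ∈ l, formF A x x = 0 := by
  refine and_congr_right fun _ => ⟨fun h x hx => ?_, fun h P hP => ?_⟩
  · rcases eq_or_ne x 0 with rfl | hx0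
    · simp
    · refine ((mk_mem_quadricOn x hx0 l).1 ⟨h _ ?_, ?_⟩).1 <;>
        rwa [Projectivization.submodule_mk, Submodule.span_singleton_le_iff_mem]
  · exact (mem_quadric P).2 (h _ ((submodule_le_iff_rep_mem P l).1 hP))

theorem isExternalLine_iff {l : Submodule F (Fin (r + 1) → F)} :
    IsExternalLine A l ↔ Module.finrank F l = 2 ∧ ∀ x ∈ l, formF A x x = 0 → x = 0 := by
  refine and_congr_right fun _ => ⟨fun h x hx hxx => ?_, fun h => ?_⟩
  · by_contra hx0
    exact Set.eq_empty_iff_forall_notMem.1 h _ ((mk_mem_quadricOn x hx0 l).2 ⟨hxx, hx⟩)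
  · refine Set.eq_empty_iff_forall_notMem.2 fun P ⟨hP, hPl⟩ => P.rep_nonzero ?_
    exact h _ ((submodule_le_iff_rep_mem P l).1 hPl) ((mem_quadric P).1 hP)

theorem linearIndependent_of_hyperbolic (hA : A.IsSymm) {x y : Fin (r + 1) → F}
    (hx : formF A x x = 0) (hy : formF A y y = 0) (hxy : formF A x y = 1) :
    LinearIndependent F ![x, y] := by
  refine LinearIndependent.pair_iff.2 fun s t h => ⟨?_, ?_⟩
  · simpa [hx, hy, hxy] using congrArg (fun v => formF A v y) h
  · simpa [hx, hy, hxy, (isSymm_formF hA).eq y x] using congrArg (fun v => formF A v x) h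

section Secant

variable [NeZero (2 : F)]

theorem quadricOn_span_hyperbolic (hA : A.IsSymm) {x y : Fin (r + 1) → F} (hx : formF A x x = 0)
    (hy : formF A y y = 0) (hxy : formF A x y = 1) (hx0 : x ≠ 0) (hy0 : y ≠ 0) :
    quadricOn A (Submodule.span F {x, y}) =
      {Projectivization.mk F x hx0, Projectivization.mk F y hy0} := by
  ext R
  induction R using Projectivization.ind with
  | h v hv =>
    rw [mk_mem_quadricOn, Set.mem_insert_iff, Set.mem_singleton_iff,
      Projectivization.mk_eq_mk_iff', Projectivization.mk_eq_mk_iff']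
    constructor
    · rintro ⟨hvv, hvl⟩
      obtain ⟨a, b, rfl⟩ := Submodule.mem_span_pair.1 hvl
      have hab : 2 * (a * b) = 0 := by
        simp only [map_add, map_smul, LinearMap.add_apply, LinearMap.smul_apply, smul_eq_mul, hx,
          hy, hxy, (isSymm_formF hA).eq y x] at hvv
        linear_combination hvv
      rcases mul_eq_zero.1 ((mul_eq_zero.1 hab).resolve_left two_ne_zero) with rfl | rfl
      · exact Or.inr ⟨b, by simp⟩
      · exact Or.inl ⟨a, by simp⟩
    · rintro (⟨a, rfl⟩ | ⟨a, rfl⟩)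
      · exact ⟨formF_smul_smul_eq_zero hx,
          Submodule.smul_mem _ a (Submodule.mem_span_of_mem (by simp))⟩
      · exact ⟨formF_smul_smul_eq_zero hy,
          Submodule.smul_mem _ a (Submodule.mem_span_of_mem (by simp))⟩

theorem isSecantLine_span_of_hyperbolic (hA : A.IsSymm) {x y : Fin (r + 1) → F}
    (hx : formF A x x = 0) (hy : formF A y y = 0) (hxy : formF A x y = 1) :
    IsSecantLine A (Submodule.span F {x, y}) := by
  have hli := linearIndependent_of_hyperbolic hA hx hy hxy
  have hx0 : x ≠ 0 := hli.ne_zero 0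
  have hy0 : y ≠ 0 := hli.ne_zero 1
  refine ⟨finrank_span_pair hli, ?_⟩
  rw [quadricOn_span_hyperbolic hA hx hy hxy hx0 hy0, Set.ncard_pair fun h => ?_]
  obtain ⟨a, ha⟩ := (Projectivization.mk_eq_mk_iff' F _ _ hx0 hy0).1 h
  simp [← ha, hy] at hxy

end Secant

theorem IsSecantLine.exists_span_eq (hA : A.IsSymm) {l : Submodule F (Fin (r + 1) → F)}
    (hl : IsSecantLine A l) : ∃ x y, formF A x x = 0 ∧ formF A y y = 0 ∧ formF A x y ≠ 0 ∧
      l = Submodule.span F {x, y} := by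
  obtain ⟨hdim, hcard⟩ := hl
  obtain ⟨P, R, hPR, hset⟩ := Set.ncard_eq_two.1 hcard
  obtain ⟨hP, hPl⟩ : P ∈ quadricOn A l := by rw [hset]; simp
  obtain ⟨hR, hRl⟩ : R ∈ quadricOn A l := by rw [hset]; simp
  rw [mem_quadric] at hP hR
  rw [submodule_le_iff_rep_mem] at hPl hRl
  have hli : LinearIndependent F ![P.rep, R.rep] := by
    refine (LinearIndependent.pair_iff' P.rep_nonzero).2 fun a ha => hPR ?_
    rw [← Projectivization.mk_rep P, ← Projectivization.mk_rep R, eq_comm,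
      Projectivization.mk_eq_mk_iff']
    exact ⟨a, ha⟩
  refine ⟨P.rep, R.rep, hP, hR, fun hPR0 => ?_, ?_⟩
  · -- Otherwise the sum of the two vectors gives a third point of the quadric on the line.
    have hli' := LinearIndependent.pair_iff.1 hli
    have hsum : P.rep + R.rep ≠ 0 := fun h => by simpa using (hli' 1 1 (by simpa using h)).1
    have hmem := (mk_mem_quadricOn (A := A) _ hsum l).2
      ⟨by simp [hP, hR, hPR0, (isSymm_formF hA).eq R.rep], l.add_mem hPl hRl⟩
    rw [hset, Set.mem_insert_iff, Set.mem_singleton_iff, mk_eq_iff_exists_smul_rep,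
      mk_eq_iff_exists_smul_rep] at hmem
    rcases hmem with ⟨a, ha⟩ | ⟨a, ha⟩
    · simpa using (hli' (1 - a) 1 (by rw [sub_smul, ha]; module)).2
    · simpa using (hli' 1 (1 - a) (by rw [sub_smul, ha]; module)).1
  · refine (Submodule.eq_of_le_of_finrank_eq (Submodule.span_le.2 ?_) ?_).symm
    · rintro v (rfl | rfl) <;> assumption
    · rw [finrank_span_pair hli, hdim]

variable [Finite F]

theorem homogeneous_vecH : Homogeneous (VecH (K := K) A) :=
  ⟨fun _ h => h.1, fun c Z hc h => ⟨smul_ne_zero hc h.1, by rw [herm_smul_smul, h.2, mul_zero]⟩⟩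

theorem VecQ.vecH {Z : Fin (r + 1) → K} (h : VecQ A Z) : VecH A Z := by
  obtain ⟨h0, c, x, rfl, hx⟩ := h
  exact ⟨h0, by rw [herm_smul_smul, herm_incl, hx, map_zero, mul_zero]⟩

omit [Finite F] in
theorem VecQ.formK_eq_zero {Z : Fin (r + 1) → K} (h : VecQ A Z) : formK K A Z Z = 0 := by
  obtain ⟨-, c, x, rfl, hx⟩ := h
  rw [formK_smul_smul, formK_incl, hx, map_zero, mul_zero]

theorem vecQ_of_smul_incl {Z : Fin (r + 1) → K} (h : VecH A Z) {c : K} {x : Fin (r + 1) → F}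
    (hZ : Z = c • incl F K r x) : VecQ A Z := by
  have hc : c ≠ 0 := by rintro rfl; exact h.1 (by rw [hZ, zero_smul])
  have hx := h.2
  rw [hZ, herm_smul_smul, herm_incl] at hx
  exact ⟨h.1, c, x, hZ, by simpa [hc] using hx⟩

theorem linearIndependent_of_not_vecQ {x y : Fin (r + 1) → F}
    (h : VecH A (incl F K r x + δ • incl F K r y))
    (hQ : ¬ VecQ A (incl F K r x + δ • incl F K r y)) : LinearIndependent F ![x, y] := by
  rw [LinearIndependent.pair_symm_iff]
  by_cases hy : y = 0
  · exact absurd (vecQ_of_smul_incl h (c := 1) (x := x) (by simp [hy])) hQ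
  · refine (LinearIndependent.pair_iff' hy).2 fun a ha => hQ ?_
    exact vecQ_of_smul_incl h (c := algebraMap F K a + δ) (x := y) (by
      rw [← ha, map_smulₛₗ, add_smul])

end Classes

section OrbitDescriptions

variable {F K : Type*} [Field F] [Field K] [Algebra F K] [Finite F] {r : ℕ}
  {A : Matrix (Fin (r + 1)) (Fin (r + 1)) F} {δ : K} {d : F}

theorem homogeneous_vecO : Homogeneous (VecO (K := K) A) :=
  ⟨fun _ h => h.1.1, fun c Z hc ⟨hH, hb, hQ⟩ => ⟨homogeneous_vecH.smul c Z hc hH,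
    by rw [formK_smul_smul, hb, mul_zero],
    fun h => hQ (((homogeneous_scalarExt _).smul_iff hc Z).1 h)⟩⟩

theorem homogeneous_vecE : Homogeneous (VecE A δ) :=
  ⟨fun _ h => h.1.1, fun c Z hc ⟨hH, hb, hsq⟩ => ⟨homogeneous_vecH.smul c Z hc hH,
    by rw [formK_smul_smul]; exact mul_ne_zero (mul_ne_zero hc hc) hb,
    by rwa [formK_smul_smul, isSquare_mul_mul_self_mul_iff hc]⟩⟩

theorem homogeneous_vecS : Homogeneous (VecS A δ) :=
  ⟨fun _ h => h.1.1, fun c Z hc ⟨hH, hb, hsq⟩ => ⟨homogeneous_vecH.smul c Z hc hH,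
    by rw [formK_smul_smul]; exact mul_ne_zero (mul_ne_zero hc hc) hb,
    by rwa [formK_smul_smul, isSquare_mul_mul_self_mul_iff hc]⟩⟩

variable [NeZero (2 : F)] [Finite K] (Δ : QuadExt F K δ d)
include Δ

theorem mem_extend (l : Submodule F (Fin (r + 1) → F)) (Z : Fin (r + 1) → K) :
    Z ∈ extend K l ↔ ∃ x ∈ l, ∃ y ∈ l, Z = incl F K r x + δ • incl F K r y := by
  refine ⟨fun h => ?_, ?_⟩
  · induction h using Submodule.span_induction with
    | mem Z h =>
      obtain ⟨x, hx, rfl⟩ := h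
      exact ⟨x, hx, 0, l.zero_mem, by simp⟩
    | zero => exact ⟨0, l.zero_mem, 0, l.zero_mem, by simp⟩
    | add Z W _ _ hZ hW =>
      obtain ⟨x, hx, y, hy, rfl⟩ := hZ
      obtain ⟨x', hx', y', hy', rfl⟩ := hW
      exact ⟨x + x', l.add_mem hx hx', y + y', l.add_mem hy hy', by
        rw [map_add, map_add]; module⟩
    | smul c Z _ hZ =>
      obtain ⟨x, hx, y, hy, rfl⟩ := hZ
      obtain ⟨a, b, rfl⟩ := Δ.exists_eq c
      refine ⟨a • x + (d * b) • y, l.add_mem (l.smul_mem _ hx) (l.smul_mem _ hy), a • y + b • x,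
        l.add_mem (l.smul_mem _ hy) (l.smul_mem _ hx), ?_⟩
      simp only [map_add, map_smulₛₗ, map_mul, ← Δ.sq]
      module
  · rintro ⟨x, hx, y, hy, rfl⟩
    have hincl : ∀ v ∈ l, incl F K r v ∈ extend K l := fun v hv =>
      Submodule.subset_span ⟨v, hv, rfl⟩
    exact add_mem (hincl x hx) ((extend K l).smul_mem _ (hincl y hy))

theorem incl_add_mem_extend_span (x y : Fin (r + 1) → F) :
    incl F K r x + δ • incl F K r y ∈ extend K (Submodule.span F {x, y}) :=
  (mem_extend Δ _ _).2 ⟨x, Submodule.mem_span_of_mem (by simp), y,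
    Submodule.mem_span_of_mem (by simp), rfl⟩

omit [Finite K] in
theorem exists_smul_eq_incl_add {x y p : Fin (r + 1) → F} (hp : p ≠ 0)
    (hpl : p ∈ Submodule.span F {x, y}) : ∃ c : K, c ≠ 0 ∧ ∃ y' : Fin (r + 1) → F,
      c • (incl F K r x + δ • incl F K r y) = incl F K r p + δ • incl F K r y' := by
  obtain ⟨a, b, rfl⟩ := Submodule.mem_span_pair.1 hpl
  have hb : algebraMap F K b = δ * δ * algebraMap F K (b / d) := by
    rw [Δ.sq, ← map_mul, mul_div_cancel₀ _ Δ.d_ne]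
  refine ⟨algebraMap F K a + δ * algebraMap F K (b / d), fun hc => hp ?_, a • y + (b / d) • x, ?_⟩
  · obtain ⟨rfl, hbd⟩ := Δ.eq_zero hc
    obtain rfl : b = 0 := by simpa [Δ.d_ne] using hbd
    simp
  · simp only [map_add, map_smulₛₗ, hb]
    module

theorem vecS_of_singular_mem_span (hA : A.IsSymm) {x y p : Fin (r + 1) → F}
    (hH : VecH A (incl F K r x + δ • incl F K r y))
    (hb : formK K A (incl F K r x + δ • incl F K r y) (incl F K r x + δ • incl F K r y) ≠ 0)
    (hp : p ≠ 0) (hpp : formF A p p = 0) (hpl : p ∈ Submodule.span F {x, y}) :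
    VecS A δ (incl F K r x + δ • incl F K r y) := by
  obtain ⟨c, hc, y', hcy⟩ := exists_smul_eq_incl_add Δ hp hpl
  have hH' := homogeneous_vecH.smul c _ hc hH
  rw [hcy, VecH, herm_incl_add Δ hA, map_eq_zero, hpp, zero_sub, neg_eq_zero] at hH'
  refine ⟨hH, hb, ?_⟩
  rw [← isSquare_mul_mul_self_mul_iff hc, ← formK_smul_smul, hcy, formK_incl_add Δ hA, hpp, hH'.2]
  have hmem : 2 * δ * (algebraMap F K (0 + 0) + δ * algebraMap F K (2 * formF A p y')) =
      algebraMap F K (2 * d * (2 * formF A p y')) := by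
    rw [map_mul _ (2 * d), map_mul _ 2 d, ← Δ.sq, map_ofNat, add_zero, map_zero]; ring
  rw [hmem]
  exact isSquare_algebraMap Δ.card _

theorem VecS.exists_hyperbolic (hA : A.IsSymm) {Z : Fin (r + 1) → K}
    (h : VecS A δ Z) : ∃ (c : K) (x y : Fin (r + 1) → F), c ≠ 0 ∧
      c • Z = incl F K r x + δ • incl F K r y ∧
      formF A x x = 0 ∧ formF A y y = 0 ∧ formF A x y = 1 := by
  obtain ⟨hH, hb, s, hs⟩ := h
  have := neZero_two_algebra F K
  have hδ : 2 * δ ≠ 0 := mul_ne_zero two_ne_zero Δ.ne_zero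
  have hs0 : s ≠ 0 := by
    rintro rfl
    exact mul_ne_zero hδ hb (by rw [hs, mul_zero])
  have hc : 2 * δ / s ≠ 0 := div_ne_zero hδ hs0
  obtain ⟨x, y, hxy⟩ := exists_incl_add Δ ((2 * δ / s) • Z)
  have hcZ := (homogeneous_vecH.smul _ _ hc hH).2
  have hcb : formK K A ((2 * δ / s) • Z) ((2 * δ / s) • Z) =
      algebraMap F K (2 * 0) + δ * algebraMap F K (2 * 1) := by
    rw [formK_smul_smul, mul_zero, map_zero, zero_add, mul_one, map_ofNat, div_mul_div_comm,
      ← hs]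
    have := Δ.ne_zero
    field_simp
  rw [hxy] at hcZ hcb
  obtain ⟨hxx, hyy, hxy1⟩ := formF_eq_of_formK_eq Δ hA hcZ hcb
  exact ⟨2 * δ / s, x, y, hc, hxy, hxx, (mul_eq_zero.1 hyy).resolve_left Δ.d_ne, hxy1⟩

theorem setO_eq (hA : A.IsSymm) : setO K A = pointsOf (VecO A) := by
  ext P
  simp only [setO, Set.mem_ofPred_eq, mem_range_embed, isLineOfQuadric_iff,
    submodule_le_iff_rep_mem]
  constructor
  · rintro ⟨hP, l, ⟨-, hl⟩, hPl⟩
    obtain ⟨x, hx, y, hy, hZ⟩ := (mem_extend Δ l _).1 hPl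
    have hxy : 2 * formF A x y = 0 := by
      have hsum := hl _ (l.add_mem hx hy)
      simp only [map_add, LinearMap.add_apply, hl x hx, hl y hy, (isSymm_formF hA).eq y x] at hsum
      linear_combination hsum
    refine ⟨⟨P.rep_nonzero, ?_⟩, ?_, fun ⟨_, c, v, h, _⟩ => hP ⟨c, v, h⟩⟩
    · rw [hZ, herm_incl_add Δ hA, hl x hx, hl y hy]; simp
    · rw [hZ, formK_incl_add Δ hA, hl x hx, hl y hy, hxy]; simp
  · rintro ⟨hH, hb, hQ⟩
    refine ⟨fun ⟨c, v, h⟩ => hQ (vecQ_of_smul_incl hH h), ?_⟩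
    obtain ⟨x, y, hZ⟩ := exists_incl_add Δ P.rep
    rw [hZ] at hH hb hQ
    obtain ⟨hx, hy, hxy⟩ := formF_eq_zero_of_formK_eq_zero Δ hA hH.2 hb
    refine ⟨Submodule.span F {x, y}, ⟨finrank_span_pair (linearIndependent_of_not_vecQ hH hQ), ?_⟩,
      hZ ▸ incl_add_mem_extend_span Δ x y⟩
    intro v hv
    obtain ⟨a, b, rfl⟩ := Submodule.mem_span_pair.1 hv
    simp [hx, hy, hxy, (isSymm_formF hA).eq y x]

theorem setE_eq (hA : A.IsSymm) : setE K A = pointsOf (VecE A δ) := by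
  ext P
  simp only [setE, hermVariety_eq, Set.mem_ofPred_eq, isExternalLine_iff,
    submodule_le_iff_rep_mem]
  constructor
  · rintro ⟨hH, l, ⟨-, hl⟩, hPl⟩
    have hH : VecH A P.rep := hH
    have hb : formK K A P.rep P.rep ≠ 0 := fun hb => by
      obtain ⟨x, hx, y, hy, hZ⟩ := (mem_extend Δ l _).1 hPl
      have hh := hH.2
      rw [hZ] at hb hh
      obtain ⟨hxx, hyy, -⟩ := formF_eq_zero_of_formK_eq_zero Δ hA hh hb
      exact P.rep_nonzero (by rw [hZ, hl x hx hxx, hl y hy hyy]; simp)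
    refine ⟨hH, hb, fun hsq => ?_⟩
    obtain ⟨c, p, p', -, hcZ, hp, -, hpp⟩ := VecS.exists_hyperbolic Δ hA ⟨hH, hb, hsq⟩
    obtain ⟨u, hu, v, -, huv⟩ := (mem_extend Δ l _).1 ((extend K l).smul_mem c hPl)
    have hpu : p = u := (incl_add_ext Δ (hcZ.symm.trans huv)).1
    simp [hl p (hpu ▸ hu) hp] at hpp
  · rintro ⟨hH, hb, hsq⟩
    refine ⟨hH, ?_⟩
    obtain ⟨x, y, hZ⟩ := exists_incl_add Δ P.rep
    rw [hZ] at hH hb hsq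
    have hi := linearIndependent_of_not_vecQ hH fun hQ => hb hQ.formK_eq_zero
    refine ⟨Submodule.span F {x, y}, ⟨finrank_span_pair hi, fun v hv hvv => ?_⟩,
      hZ ▸ incl_add_mem_extend_span Δ x y⟩
    by_contra hv0
    exact hsq (vecS_of_singular_mem_span Δ hA hH hb hv0 hvv hv).2.2

theorem vecS_of_mem_extend_secant (hA : A.IsSymm) {l : Submodule F (Fin (r + 1) → F)}
    (hl : IsSecantLine A l) {Z : Fin (r + 1) → K} (hZ : Z ∈ extend K l) (hH : VecH A Z)
    (hQ : ¬ VecQ A Z) : VecS A δ Z := by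
  obtain ⟨p, p', hp, hp', hpp, hspan⟩ := hl.exists_span_eq hA
  obtain ⟨x, hx, y, hy, rfl⟩ := (mem_extend Δ l Z).1 hZ
  have hxyl : Submodule.span F {x, y} = l := by
    refine Submodule.eq_of_le_of_finrank_eq (Submodule.span_le.2 ?_) ?_
    · rintro v (rfl | rfl) <;> assumption
    · rw [hl.1, finrank_span_pair (linearIndependent_of_not_vecQ hH hQ)]
  have hp0 : p ≠ 0 := by rintro rfl; simp at hpp
  refine vecS_of_singular_mem_span Δ hA hH (fun hb => hpp ?_) hp0 hp
    (hxyl ▸ hspan ▸ Submodule.mem_span_of_mem (by simp))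
  -- If `b(Z, Z) = 0`, then the plane `l = ⟨x, y⟩` is totally singular.
  obtain ⟨hxx, hyy, hxy⟩ := formF_eq_zero_of_formK_eq_zero Δ hA hH.2 hb
  have hpl : p ∈ Submodule.span F {x, y} := hxyl ▸ hspan ▸ Submodule.mem_span_of_mem (by simp)
  have hpl' : p' ∈ Submodule.span F {x, y} := hxyl ▸ hspan ▸ Submodule.mem_span_of_mem (by simp)
  obtain ⟨a, b, rfl⟩ := Submodule.mem_span_pair.1 hpl
  obtain ⟨a', b', rfl⟩ := Submodule.mem_span_pair.1 hpl'
  simp [hxx, hyy, hxy, (isSymm_formF hA).eq y x]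

theorem setS_eq (hA : A.IsSymm) : setS K A = pointsOf (VecS A δ) := by
  ext P
  simp only [setS, hermVariety_eq, setQ_eq, Set.mem_ofPred_eq, submodule_le_iff_rep_mem]
  constructor
  · rintro ⟨hH, hQ, l, hl, hPl⟩
    exact vecS_of_mem_extend_secant Δ hA hl hPl hH hQ
  · intro h
    have h : VecS A δ P.rep := h
    obtain ⟨c, p, p', hc, hcZ, hp, hp', hpp⟩ := h.exists_hyperbolic Δ hA
    refine ⟨h.1, fun hQ => h.2.1 (VecQ.formK_eq_zero hQ), Submodule.span F {p, p'},
      isSecantLine_span_of_hyperbolic hA hp hp' hpp, ?_⟩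
    rw [← inv_smul_smul₀ hc P.rep, hcZ]
    exact Submodule.smul_mem _ _ (incl_add_mem_extend_span Δ p p')

end OrbitDescriptions

section Group

variable {F : Type*} (K : Type*) [Field F] [Field K] [Algebra F K] {r : ℕ}

/-- The action on `K ^ (r + 1)` of an invertible matrix over `F`. -/
def actK (g : GL (Fin (r + 1)) F) : (Fin (r + 1) → K) ≃ₗ[K] (Fin (r + 1) → K) :=
  LinearMap.GeneralLinearGroup.generalLinearEquiv K _
    (Matrix.GeneralLinearGroup.toLin (Matrix.GeneralLinearGroup.map (algebraMap F K) g))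

variable {K}

theorem actK_apply (g : GL (Fin (r + 1)) F) (Z : Fin (r + 1) → K) :
    actK K g Z = (g.val.map (algebraMap F K)).mulVec Z := rfl

theorem actK_incl (g : GL (Fin (r + 1)) F) (x : Fin (r + 1) → F) :
    actK K g (incl F K r x) = incl F K r (g.val.mulVec x) := by
  funext i
  simp [actK_apply, incl, Matrix.mulVec, dotProduct]

theorem actK_inv_actK (g : GL (Fin (r + 1)) F) (Z : Fin (r + 1) → K) :
    actK K g⁻¹ (actK K g Z) = Z := by
  simp only [actK, map_inv]
  exact LinearEquiv.symm_apply_apply _ Z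

variable {A : Matrix (Fin (r + 1)) (Fin (r + 1)) F} {g : GL (Fin (r + 1)) F} {c : F}

theorem formF_mulVec (h : g.val.transpose * A * g.val = c • A) (x y : Fin (r + 1) → F) :
    formF A (g.val.mulVec x) (g.val.mulVec y) = c * formF A x y := by
  change (formF A).comp g.val.toLin' g.val.toLin' x y = _
  rw [formF, Matrix.toBilin'_comp, h, map_smul]
  rfl

theorem formK_actK (h : g.val.transpose * A * g.val = c • A) (Z W : Fin (r + 1) → K) :
    formK K A (actK K g Z) (actK K g W) = algebraMap F K c * formK K A Z W := by
  have hK : (g.val.map (algebraMap F K)).transpose * A.map (algebraMap F K) *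
      g.val.map (algebraMap F K) = algebraMap F K c • A.map (algebraMap F K) := by
    rw [← Matrix.transpose_map, ← Matrix.map_mul, ← Matrix.map_mul, h]
    ext i j
    simp
  change (formK K A).comp (g.val.map (algebraMap F K)).toLin'
    (g.val.map (algebraMap F K)).toLin' Z W = _
  rw [formK, Matrix.toBilin'_comp, hK, map_smul]
  rfl

theorem herm_actK [Finite F] (h : g.val.transpose * A * g.val = c • A)
    (Z W : Fin (r + 1) → K) :
    herm K A (actK K g Z) (actK K g W) = algebraMap F K c * herm K A Z W := by
  have htau : tau F (actK K g W) = actK K g (tau F W) := by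
    funext i
    simp [tau, actK_apply, Matrix.mulVec, dotProduct]
  rw [herm_eq, herm_eq, htau, formK_actK h]

end Group

section Invariance

variable {F K : Type*} [Field F] [Field K] [Algebra F K] {r : ℕ}
  {A : Matrix (Fin (r + 1)) (Fin (r + 1)) F}

/-- A predicate on vectors over `K` that is preserved by the action of the similitudes. -/
def Invariant (A : Matrix (Fin (r + 1)) (Fin (r + 1)) F) (p : (Fin (r + 1) → K) → Prop) : Prop :=
  ∀ g ∈ similitudes A, ∀ Z, p Z → p (actK K g Z)

theorem Invariant.iff {p : (Fin (r + 1) → K) → Prop} (hp : Invariant A p)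
    {g : GL (Fin (r + 1)) F} (hg : g ∈ similitudes A) (Z : Fin (r + 1) → K) :
    p (actK K g Z) ↔ p Z := by
  refine ⟨fun h => ?_, hp g hg Z⟩
  simpa only [actK_inv_actK] using hp g⁻¹ ((similitudes A).inv_mem hg) _ h

theorem invariant_vecQ : Invariant (K := K) A (VecQ A) := by
  rintro g ⟨c, -, hg⟩ Z ⟨h0, a, x, rfl, hx⟩
  exact ⟨(actK K g).map_ne_zero_iff.2 h0, a, g.val.mulVec x, by rw [map_smul, actK_incl],
    (formF_mulVec hg x x).trans (by rw [hx, mul_zero])⟩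

variable [Finite F]

theorem invariant_vecH : Invariant (K := K) A (VecH A) := fun g ⟨c, _, hg⟩ _ ⟨h0, hh⟩ =>
  ⟨(actK K g).map_ne_zero_iff.2 h0, by rw [herm_actK hg, hh, mul_zero]⟩

theorem invariant_vecO : Invariant (K := K) A (VecO A) := by
  intro g hg Z ⟨hH, hb, hQ⟩
  refine ⟨invariant_vecH g hg Z hH, ?_, mt (invariant_vecQ.iff hg Z).1 hQ⟩
  obtain ⟨c, -, hg⟩ := hg
  rw [formK_actK hg, hb, mul_zero]

variable [NeZero (2 : F)] [Finite K] (hK : Nat.card K = Nat.card F ^ 2)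
include hK

theorem isSquare_formK_actK_iff {g : GL (Fin (r + 1)) F} (hg : g ∈ similitudes A) (a : K)
    (Z : Fin (r + 1) → K) : IsSquare (a * formK K A (actK K g Z) (actK K g Z)) ↔
      IsSquare (a * formK K A Z Z) := by
  obtain ⟨c, hc, hg⟩ := hg
  obtain ⟨s, hs⟩ := isSquare_algebraMap (K := K) hK c
  have hs0 : s ≠ 0 := by
    rintro rfl
    exact hc (by simpa using hs)
  rw [formK_actK hg, hs, isSquare_mul_mul_self_mul_iff hs0]

omit [NeZero (2 : F)] [Finite F] [Finite K] hK in
theorem formK_actK_ne_zero {g : GL (Fin (r + 1)) F} (hg : g ∈ similitudes A)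
    {Z : Fin (r + 1) → K} (hZ : formK K A Z Z ≠ 0) :
    formK K A (actK K g Z) (actK K g Z) ≠ 0 := by
  obtain ⟨c, hc, hg⟩ := hg
  rw [formK_actK hg]
  exact mul_ne_zero (by simpa using hc) hZ

theorem invariant_vecS (δ : K) : Invariant (K := K) A (VecS A δ) := fun g hg Z ⟨hH, hb, hsq⟩ =>
  ⟨invariant_vecH g hg Z hH, formK_actK_ne_zero hg hb, (isSquare_formK_actK_iff hK hg _ Z).2 hsq⟩

theorem invariant_vecE (δ : K) : Invariant (K := K) A (VecE A δ) := fun g hg Z ⟨hH, hb, hsq⟩ =>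
  ⟨invariant_vecH g hg Z hH, formK_actK_ne_zero hg hb,
    mt (isSquare_formK_actK_iff hK hg _ Z).1 hsq⟩

end Invariance

section Transitivity

variable {F K : Type*} [Field F] [Field K] [Algebra F K] {r : ℕ}
  {A : Matrix (Fin (r + 1)) (Fin (r + 1)) F}

theorem exists_similitude_of_isOrthogonal (hdet : A.det ≠ 0)
    {f : (Fin (r + 1) → F) →ₗ[F] (Fin (r + 1) → F)} (hf : (formF A).IsOrthogonal f) :
    ∃ g ∈ similitudes A, ∀ x, g.val.mulVec x = f x := by
  have hgram : f.toMatrix'.transpose * A * f.toMatrix' = A := by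
    refine Matrix.toBilin'.injective ?_
    rw [← Matrix.toBilin'_comp, Matrix.toLin'_toMatrix']
    exact LinearMap.ext₂ hf
  have hf0 : f.toMatrix'.det ≠ 0 := fun h0 => hdet (by
    rw [← hgram, Matrix.det_mul, h0, mul_zero])
  exact ⟨Matrix.GeneralLinearGroup.mkOfDetNeZero f.toMatrix' hf0,
    ⟨1, one_ne_zero, hgram.trans (one_smul F A).symm⟩, LinearMap.toMatrix'_mulVec f⟩

/-- The similitudes act transitively on the points described by a predicate on vectors. -/
def Transitive (A : Matrix (Fin (r + 1)) (Fin (r + 1)) F) (p : (Fin (r + 1) → K) → Prop) : Prop :=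
  ∀ Z W, p Z → p W → ∃ g ∈ similitudes A, ∃ c : K, c ≠ 0 ∧ actK K g Z = c • W

theorem orbit_eq_pointsOf {p : (Fin (r + 1) → K) → Prop} (hp : Homogeneous p)
    (hinv : Invariant A p) (htr : Transitive A p) {P : ℙ K (Fin (r + 1) → K)}
    (hP : P ∈ pointsOf p) : MulAction.orbit (groupG K A) P = pointsOf p := by
  have hP : p P.rep := hP
  have hmk (g : GL (Fin (r + 1)) F) :
      Matrix.ProjGenLinGroup.mk (Matrix.GeneralLinearGroup.map (algebraMap F K) g) • P =
        Projectivization.mk K (actK K g P.rep)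
          ((actK K g).map_ne_zero_iff.2 P.rep_nonzero) := by
    conv_lhs => rw [← Projectivization.mk_rep P]
    rfl
  ext R
  constructor
  · rintro ⟨⟨_, g, hg, rfl⟩, rfl⟩
    have hmem := (mk_mem_pointsOf hp _ ((actK K g).map_ne_zero_iff.2 P.rep_nonzero)).2
      (hinv g hg _ hP)
    rwa [← hmk] at hmem
  · intro hR
    obtain ⟨g, hg, c, -, hc⟩ := htr P.rep R.rep hP hR
    exact ⟨⟨_, g, hg, rfl⟩, (hmk g).trans ((mk_eq_iff_exists_smul_rep _).2 ⟨c, hc.symm⟩)⟩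

variable [NeZero (2 : F)] (hA : A.IsSymm) (hdet : A.det ≠ 0)
include hA hdet

theorem exists_similitude_of_gram_eq {k : ℕ} {u v : Fin k → Fin (r + 1) → F}
    (hu : LinearIndependent F u) (hv : LinearIndependent F v)
    (huv : ∀ i j, formF A (u i) (u j) = formF A (v i) (v j)) :
    ∃ g ∈ similitudes A, ∀ i, g.val.mulVec (u i) = v i := by
  obtain ⟨f, hf, hfu⟩ := exists_isOrthogonal_of_gram_eq (nondegenerate_formF hdet)
    (isSymm_formF hA) hu hv huv
  obtain ⟨g, hg, hgf⟩ := exists_similitude_of_isOrthogonal hdet hf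
  exact ⟨g, hg, fun i => (hgf _).trans (hfu i)⟩

theorem transitive_vecQ : Transitive (K := K) A (VecQ A) := by
  rintro Z W ⟨hZ, a, x, rfl, hx⟩ ⟨hW, b, y, rfl, hy⟩
  have hx0 : x ≠ 0 := by rintro rfl; simp at hZ
  have hy0 : y ≠ 0 := by rintro rfl; simp at hW
  have ha : a ≠ 0 := left_ne_zero_of_smul hZ
  have hb : b ≠ 0 := left_ne_zero_of_smul hW
  obtain ⟨g, hg, hgx⟩ := exists_similitude_of_gram_eq hA hdet (u := fun _ : Fin 1 => x)
    (v := fun _ => y) (LinearIndependent.of_subsingleton 0 hx0)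
    (LinearIndependent.of_subsingleton 0 hy0) (fun _ _ => by rw [hx, hy])
  refine ⟨g, hg, a / b, div_ne_zero ha hb, ?_⟩
  rw [map_smul, actK_incl, hgx 0, smul_smul, div_mul_cancel₀ _ hb]

variable [Finite F] [Finite K] {δ : K} {d : F} (Δ : QuadExt F K δ d)
include Δ

theorem exists_similitude_of_formK_eq {Z W : Fin (r + 1) → K} (hZ : VecH A Z) (hW : VecH A W)
    (hZQ : ¬ VecQ A Z) (hWQ : ¬ VecQ A W) (h : formK K A Z Z = formK K A W W) :
    ∃ g ∈ similitudes A, actK K g Z = W := by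
  obtain ⟨x, y, rfl⟩ := exists_incl_add Δ Z
  obtain ⟨x', y', rfl⟩ := exists_incl_add Δ W
  have hxy' : formF A x' x' = d * formF A y' y' := by
    simpa only [herm_incl_add Δ hA, map_eq_zero, sub_eq_zero] using hW.2
  rw [formK_incl_add Δ hA x' y', ← hxy', ← two_mul] at h
  obtain ⟨hxx, hyy, hxy⟩ := formF_eq_of_formK_eq Δ hA hZ.2 h
  have hyy : formF A y y = formF A y' y' := mul_left_cancel₀ Δ.d_ne (hyy.trans hxy')
  obtain ⟨g, hg, hgu⟩ := exists_similitude_of_gram_eq hA hdet (u := ![x, y]) (v := ![x', y'])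
    (linearIndependent_of_not_vecQ hZ hZQ) (linearIndependent_of_not_vecQ hW hWQ)
    (by simp [Fin.forall_fin_two, hxx, hyy, hxy, (isSymm_formF hA).eq y x,
      (isSymm_formF hA).eq y' x'])
  have hgx : g.val.mulVec x = x' := hgu 0
  have hgy : g.val.mulVec y = y' := hgu 1
  exact ⟨g, hg, by rw [map_add, map_smul, actK_incl, actK_incl, hgx, hgy]⟩

theorem transitive_vecO : Transitive (K := K) A (VecO A) := fun Z W hZ hW => by
  obtain ⟨g, hg, hgZ⟩ := exists_similitude_of_formK_eq hA hdet Δ hZ.1 hW.1 hZ.2.2 hW.2.2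
    (hZ.2.1.trans hW.2.1.symm)
  exact ⟨g, hg, 1, one_ne_zero, by rw [hgZ, one_smul]⟩

theorem exists_similitude_of_isSquare {Z W : Fin (r + 1) → K} (hZ : VecH A Z) (hW : VecH A W)
    (hZ0 : formK K A Z Z ≠ 0) (hW0 : formK K A W W ≠ 0)
    (h : IsSquare ((2 * δ * formK K A Z Z) * (2 * δ * formK K A W W))) :
    ∃ g ∈ similitudes A, ∃ c : K, c ≠ 0 ∧ actK K g Z = c • W := by
  obtain ⟨s, hs⟩ := h
  have := neZero_two_algebra F K
  have hδ : 2 * δ ≠ 0 := mul_ne_zero two_ne_zero Δ.ne_zero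
  have hs0 : s ≠ 0 := by
    rintro rfl
    simp [hδ, hZ0, hW0] at hs
  have hc : s / (2 * δ * formK K A W W) ≠ 0 := div_ne_zero hs0 (mul_ne_zero hδ hW0)
  have hcW : formK K A Z Z = formK K A ((s / (2 * δ * formK K A W W)) • W)
      ((s / (2 * δ * formK K A W W)) • W) := by
    have := Δ.ne_zero
    rw [formK_smul_smul, div_mul_div_comm, ← hs]
    field_simp
  obtain ⟨g, hg, hgZ⟩ := exists_similitude_of_formK_eq hA hdet Δ hZ
    (homogeneous_vecH.smul _ _ hc hW) (fun hQ => hZ0 hQ.formK_eq_zero)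
    (fun hQ => hZ0 (hcW.trans hQ.formK_eq_zero)) hcW
  exact ⟨g, hg, _, hc, hgZ⟩

theorem transitive_vecS : Transitive (K := K) A (VecS A δ) := fun _ _ hZ hW =>
  exists_similitude_of_isSquare hA hdet Δ hZ.1 hW.1 hZ.2.1 hW.2.1 (hZ.2.2.mul hW.2.2)

theorem transitive_vecE : Transitive (K := K) A (VecE A δ) := by
  classical
  intro Z W hZ hW
  let := Fintype.ofFinite K
  have := neZero_two_algebra F K
  refine exists_similitude_of_isSquare hA hdet Δ hZ.1 hW.1 hZ.2.1 hW.2.1 ?_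
  have hδ : 2 * δ ≠ 0 := mul_ne_zero two_ne_zero Δ.ne_zero
  refine (quadraticChar_one_iff_isSquare
    (mul_ne_zero (mul_ne_zero hδ hZ.2.1) (mul_ne_zero hδ hW.2.1))).1 ?_
  rw [map_mul, quadraticChar_neg_one_iff_not_isSquare.2 hZ.2.2,
    quadraticChar_neg_one_iff_not_isSquare.2 hW.2.2, neg_one_mul, neg_neg]

end Transitivity

section Counting

theorem card_prod_subtype {α β : Type*} [Fintype α] [Finite β] (P : α → β → Prop) :
    Nat.card {p : α × β // P p.1 p.2} = ∑ a, Nat.card {b // P a b} := by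
  rw [Nat.card_congr (Equiv.subtypeProdEquivSigmaSubtype P), Nat.card_sigma]

theorem card_prod_subtype_of_fiber {α β : Type*} [Finite α] [Finite β] (Q : α → Prop)
    (P : α → β → Prop) {n : ℕ} (h : ∀ a, Q a → Nat.card {b // P a b} = n) :
    Nat.card {p : α × β // Q p.1 ∧ P p.1 p.2} = Nat.card {a // Q a} * n := by
  let e : {p : α × β // Q p.1 ∧ P p.1 p.2} ≃ Σ a : {a // Q a}, {b // P a b} :=
    { toFun := fun p => ⟨⟨p.1.1, p.2.1⟩, ⟨p.1.2, p.2.2⟩⟩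
      invFun := fun s => ⟨(s.1.1, s.2.1), s.1.2, s.2.2⟩
      left_inv := fun _ => rfl
      right_inv := fun _ => rfl }
  have := Fintype.ofFinite {a // Q a}
  rw [Nat.card_congr e, Nat.card_sigma, Finset.sum_congr rfl fun a _ => h a.1 a.2, Finset.sum_const,
    Finset.card_univ, smul_eq_mul, Nat.card_eq_fintype_card]

theorem card_eq_card_ne_zero_add_one {V : Type*} [Zero V] [Finite V] (p : V → Prop) (h : p 0) :
    Nat.card {x // p x} = Nat.card {x // x ≠ 0 ∧ p x} + 1 := by
  have hunion : {x | p x} = insert 0 {x | x ≠ 0 ∧ p x} := by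
    ext x
    by_cases hx : x = 0 <;> simp [hx, h]
  change Nat.card {x | p x} = Nat.card {x | x ≠ 0 ∧ p x} + 1
  rw [Nat.card_coe_set_eq, Nat.card_coe_set_eq, hunion, Set.ncard_insert_of_notMem (by simp)]

theorem card_or {α : Type*} [Finite α] {p q : α → Prop} (h : ∀ x, p x → ¬ q x) :
    Nat.card {x // p x ∨ q x} = Nat.card {x // p x} + Nat.card {x // q x} := by
  change Nat.card ({x | p x} ∪ {x | q x} : Set α) = Nat.card {x | p x} + Nat.card {x | q x}
  simp only [Nat.card_coe_set_eq]
  exact Set.ncard_union_eq (Set.disjoint_left.2 h)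

theorem card_fiber {G H : Type*} [AddGroup G] [AddGroup H] {φ : G →+ H}
    (hφ : Function.Surjective φ) (c : H) :
    Nat.card {x // φ x = c} * Nat.card H = Nat.card G := by
  have hindex := AddSubgroup.card_mul_index φ.ker
  rwa [AddSubgroup.index_ker, AddMonoidHom.range_eq_top.2 hφ, AddSubgroup.card_top,
    ← Nat.card_congr (φ.fiberEquivKerOfSurjective hφ c)] at hindex

theorem card_add_eq_zero {G H T : Type*} [AddGroup G] [AddGroup H] [Finite G] [Finite T]
    {φ : G →+ H} (hφ : Function.Surjective φ) (n : T → H) :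
    Nat.card {p : T × G // φ p.2 + n p.1 = 0} * Nat.card H = Nat.card T * Nat.card G := by
  have := Fintype.ofFinite T
  rw [card_prod_subtype (fun t x => φ x + n t = 0), Finset.sum_mul]
  simp only [add_eq_zero_iff_eq_neg, card_fiber hφ, Finset.sum_const, Finset.card_univ,
    smul_eq_mul, Nat.card_eq_fintype_card]

variable {K : Type*} [Field K] {r : ℕ}

theorem card_homogeneous {p : (Fin (r + 1) → K) → Prop} (hp : Homogeneous p) :
    Nat.card {Z // p Z} = (Nat.card K - 1) * (pointsOf p).ncard := by
  let scale : pointsOf p × Kˣ → {Z // p Z} := fun x =>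
    ⟨x.2 • x.1.1.rep, hp.smul _ _ x.2.ne_zero x.1.2⟩
  have hscale : Function.Bijective scale := by
    constructor
    · rintro ⟨⟨P, hP⟩, a⟩ ⟨⟨R, hR⟩, b⟩ hab
      replace hab : a • P.rep = b • R.rep := congrArg Subtype.val hab
      obtain rfl : P = R := by
        rw [← P.mk_rep, ← R.mk_rep, Projectivization.mk_eq_mk_iff]
        exact ⟨a⁻¹ * b, by rw [mul_smul, ← hab, inv_smul_smul]⟩
      obtain rfl : a = b := Units.ext (smul_left_injective K P.rep_nonzero hab)
      rfl
    · rintro ⟨Z, hZ⟩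
      obtain ⟨a, ha⟩ := Projectivization.exists_smul_eq_mk_rep K Z (hp.ne_zero Z hZ)
      exact ⟨(⟨_, (mk_mem_pointsOf hp Z (hp.ne_zero Z hZ)).2 hZ⟩, a⁻¹),
        Subtype.ext (by simp only [scale, ← ha, inv_smul_smul])⟩
  rw [← Nat.card_congr (Equiv.ofBijective scale hscale), Nat.card_prod, Nat.card_coe_set_eq,
    Nat.card_units, mul_comm]

variable {F : Type*} [Field F] [Algebra F K]

theorem embed_injective : Function.Injective (embed (F := F) (r := r) K) := by
  intro P R h
  obtain ⟨i, hi⟩ := Function.ne_iff.1 R.rep_nonzero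
  rw [← P.mk_rep, ← R.mk_rep, embed, Projectivization.map_mk, Projectivization.map_mk,
    Projectivization.mk_eq_mk_iff'] at h
  obtain ⟨a, ha⟩ := h
  have hai : a * algebraMap F K (R.rep i) = algebraMap F K (P.rep i) := congrFun ha i
  have ha' : a = algebraMap F K (P.rep i / R.rep i) := by
    rw [map_div₀, eq_div_iff ((map_ne_zero _).2 hi), hai]
  rw [← P.mk_rep, ← R.mk_rep, Projectivization.mk_eq_mk_iff']
  exact ⟨P.rep i / R.rep i, incl_injective F K r (by rw [map_smulₛₗ, ← ha', ha])⟩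

theorem card_scalarExt [Finite F] [Finite K] (hK : Nat.card K = Nat.card F ^ 2)
    {p : (Fin (r + 1) → F) → Prop} (hp : ∀ (c : F) (x), c ≠ 0 → p x → p (c • x)) (hp0 : p 0) :
    (Nat.card {Z : Fin (r + 1) → K // scalarExt p Z} : ℤ) =
      (Nat.card F + 1) * (Nat.card {x // p x} - 1) := by
  have hne : Homogeneous fun x => x ≠ 0 ∧ p x :=
    ⟨fun _ hx => hx.1, fun c x hc hx => ⟨smul_ne_zero hc hx.1, hp c x hc hx.2⟩⟩
  have hpoints : pointsOf p = pointsOf fun x => x ≠ 0 ∧ p x :=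
    Set.ext fun P => (and_iff_right P.rep_nonzero).symm
  have hunits : Nat.card K - 1 = (Nat.card F + 1) * (Nat.card F - 1) := by
    rw [hK, ← Nat.sq_sub_sq, one_pow]
  rw [card_homogeneous (homogeneous_scalarExt p), ← image_embed_pointsOf hp, hpoints,
    Set.ncard_image_of_injective _ embed_injective, hunits, mul_assoc, ← card_homogeneous hne,
    card_eq_card_ne_zero_add_one p hp0]
  push_cast
  ring

end Counting

section FrameCoordinates

variable {L V : Type*} [Field L] [AddCommGroup V] [Module L V] {ι : Type*} [Fintype ι]

/-- The vector with given coordinates on the vectors `e i`, `g` and `f i` of a frame. -/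
def frameMap (e f : ι → V) (g : V) : ((ι → L) × L × (ι → L)) →ₗ[L] V :=
  (Fintype.linearCombination L e).coprod
    ((LinearMap.toSpanSingleton L V g).coprod (Fintype.linearCombination L f))

theorem frameMap_apply (e f : ι → V) (g : V) (p : (ι → L) × L × (ι → L)) :
    frameMap e f g p = ∑ i, p.1 i • e i + (p.2.1 • g + ∑ i, p.2.2 i • f i) := by
  simp [frameMap, Fintype.linearCombination_apply]

variable [DecidableEq ι] {B : LinearMap.BilinForm L V} {e f : ι → V} {g : V}

theorem HypFrame.form_frameMap (H : HypFrame B e f g) (hs : B.IsSymm)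
    (p p' : (ι → L) × L × (ι → L)) :
    B (frameMap e f g p) (frameMap e f g p') =
      p.1 ⬝ᵥ p'.2.2 + p.2.2 ⬝ᵥ p'.1 + p.2.1 * p'.2.1 * B g g := by
  have fe : ∀ i j, B (f i) (e j) = if j = i then 1 else 0 := fun i j => by rw [hs.eq, H.ef]
  have ge : ∀ i, B g (e i) = 0 := fun i => by rw [hs.eq, H.eg]
  have gf : ∀ i, B g (f i) = 0 := fun i => by rw [hs.eq, H.fg]
  simp only [frameMap_apply, map_add, map_sum, map_smul, LinearMap.add_apply, LinearMap.sum_apply,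
    LinearMap.smul_apply, smul_eq_mul, H.ee, H.ff, H.ef, H.eg, H.fg, fe, ge, gf, mul_zero,
    Finset.sum_const_zero, mul_ite, mul_one, Finset.sum_ite_eq, Finset.sum_ite_eq',
    Finset.mem_univ, if_true, add_zero, zero_add, dotProduct, mul_comm (p'.1 _),
    mul_comm (p'.2.2 _)]
  ring

theorem HypFrame.form_f_frameMap (H : HypFrame B e f g) (hs : B.IsSymm) (i : ι)
    (p : (ι → L) × L × (ι → L)) : B (f i) (frameMap e f g p) = p.1 i := by
  have hf : f i = frameMap e f g ((0, 0, Pi.single i 1) : (ι → L) × L × (ι → L)) := by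
    simp [frameMap_apply, Pi.single_apply]
  rw [hf, H.form_frameMap hs]
  simp

theorem HypFrame.bijective_frameMap [FiniteDimensional L V] (H : HypFrame B e f g)
    (hs : B.IsSymm) (hd : Module.finrank L V = 2 * Fintype.card ι + 1) :
    Function.Bijective (frameMap (L := L) e f g) := by
  have hinj : Function.Injective (frameMap (L := L) e f g) := by
    rw [injective_iff_map_eq_zero]
    intro p hp
    have hform : ∀ p' : (ι → L) × L × (ι → L),
        p.1 ⬝ᵥ p'.2.2 + p.2.2 ⬝ᵥ p'.1 + p.2.1 * p'.2.1 * B g g = 0 := fun p' => by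
      rw [← H.form_frameMap hs, hp, map_zero, LinearMap.zero_apply]
    refine Prod.ext (funext fun i => ?_) (Prod.ext ?_ (funext fun i => ?_))
    · simpa using hform (0, 0, Pi.single i 1)
    · simpa [H.gg] using hform (0, 1, 0)
    · simpa using hform (Pi.single i 1, 0, 0)
  refine ⟨hinj, (LinearMap.injective_iff_surjective_of_finrank_eq_finrank ?_).1 hinj⟩
  rw [hd, Module.finrank_prod, Module.finrank_prod, Module.finrank_self,
    Module.finrank_fintype_fun_eq_card]
  ring

end FrameCoordinates

section SingularVectors

variable {L : Type*} [Field L] [Finite L] {ι : Type*} [Fintype ι]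

omit [Finite L] in
theorem exists_dotProduct_eq {Y : ι → L} (hY : Y ≠ 0) (c : L) : ∃ X, X ⬝ᵥ Y = c := by
  classical
  obtain ⟨i, hi⟩ := Function.ne_iff.1 hY
  exact ⟨Pi.single i (c / Y i), by rw [single_dotProduct, div_mul_cancel₀ _ hi]⟩

theorem card_two_dotProduct_add_mul_sq_eq_zero [NeZero (2 : L)] (X : ι → L) {a : L}
    (ha : a ≠ 0) :
    Nat.card {p : L × (ι → L) // X ⬝ᵥ p.2 + p.2 ⬝ᵥ X + p.1 * p.1 * a = 0} =
      Nat.card L ^ Fintype.card ι := by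
  by_cases hX : X = 0
  · have hzero : ∀ p : L × (ι → L), X ⬝ᵥ p.2 + p.2 ⬝ᵥ X + p.1 * p.1 * a = 0 ↔ p.1 = 0 :=
      fun p => by simp [hX, ha]
    rw [Nat.card_congr (Equiv.subtypeEquivRight hzero)]
    have hfiber := card_fiber (φ := AddMonoidHom.fst L (ι → L)) Prod.fst_surjective 0
    rw [Nat.card_prod, mul_comm, Nat.card_fun, Nat.card_eq_fintype_card (α := ι)] at hfiber
    exact Nat.eq_of_mul_eq_mul_left Nat.card_pos hfiber
  · let φ : (ι → L) →+ L := AddMonoidHom.mk' (fun Y => X ⬝ᵥ Y + Y ⬝ᵥ X) fun Y Y' => by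
      rw [dotProduct_add, add_dotProduct, add_add_add_comm]
    have hφ : Function.Surjective φ := fun c => by
      obtain ⟨Y, hY⟩ := exists_dotProduct_eq hX (c / 2)
      exact ⟨Y, by change X ⬝ᵥ Y + Y ⬝ᵥ X = c; rw [dotProduct_comm X, hY, add_halves]⟩
    have hcard := card_add_eq_zero hφ fun t => t * t * a
    rw [mul_comm, Nat.card_fun, Nat.card_eq_fintype_card (α := ι)] at hcard
    exact Nat.eq_of_mul_eq_mul_left Nat.card_pos hcard

variable {V : Type*} [AddCommGroup V] [Module L V] [FiniteDimensional L V] [NeZero (2 : L)]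
  {B : LinearMap.BilinForm L V}

theorem HypFrame.card_singular [DecidableEq ι] {e f : ι → V} {g : V} (H : HypFrame B e f g)
    (hs : B.IsSymm) (hd : Module.finrank L V = 2 * Fintype.card ι + 1) (Q : (ι → L) → Prop) :
    Nat.card {x // Q (fun i => B (f i) x) ∧ B x x = 0} =
      Nat.card {X // Q X} * Nat.card L ^ Fintype.card ι := by
  let coord := Equiv.ofBijective _ (H.bijective_frameMap hs hd)
  have hcoord : ∀ p, (Q p.1 ∧ p.1 ⬝ᵥ p.2.2 + p.2.2 ⬝ᵥ p.1 + p.2.1 * p.2.1 * B g g = 0) ↔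
      Q (fun i => B (f i) (coord p)) ∧ B (coord p) (coord p) = 0 := fun p => by
    simp only [coord, Equiv.ofBijective_apply, H.form_f_frameMap hs, H.form_frameMap hs]
  rw [← Nat.card_congr (coord.subtypeEquiv hcoord), card_prod_subtype_of_fiber Q
    fun X (p : L × (ι → L)) => X ⬝ᵥ p.2 + p.2 ⬝ᵥ X + p.1 * p.1 * B g g = 0]
  exact fun X _ => card_two_dotProduct_add_mul_sq_eq_zero X H.gg

theorem card_singular (hn : B.Nondegenerate) (hs : B.IsSymm) {m : ℕ}
    (hd : Module.finrank L V = 2 * m + 1) :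
    Nat.card {x // B x x = 0} = Nat.card L ^ (2 * m) := by
  obtain ⟨e, f, g, H⟩ := exists_hypFrame hn hs hd
  have hcard := H.card_singular hs (by simpa using hd) fun _ => True
  simp only [true_and] at hcard
  rw [hcard, Nat.card_congr (Equiv.subtypeUnivEquiv fun _ => trivial), Nat.card_fun,
    Nat.card_eq_fintype_card (α := Fin m), Fintype.card_fin, ← pow_add, two_mul]

theorem card_singular_apply_eq (hn : B.Nondegenerate) (hs : B.IsSymm) {m : ℕ} (hm : 0 < m)
    (hd : Module.finrank L V = 2 * m + 1) {x : V} (hx0 : x ≠ 0) (hx : B x x = 0) (c : L) :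
    Nat.card {y // B x y = c ∧ B y y = 0} = Nat.card L ^ (2 * m - 1) := by
  refine Nat.eq_of_mul_eq_mul_right (Nat.card_pos (α := L)) ?_
  obtain ⟨e, f, g, H⟩ := exists_hypFrame hn hs hd
  let i : Fin m := ⟨0, hm⟩
  have hfi : f i ≠ 0 := fun h => by simpa [h] using H.ef i i
  obtain ⟨s, hB, hsx⟩ := exists_isOrthogonal_of_gram_eq hn hs (k := 1) (u := fun _ => x)
    (v := fun _ => f i) (.of_subsingleton (i := 0) hx0) (.of_subsingleton (i := 0) hfi)
    (fun _ _ => by rw [hx, H.ff])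
  have := Module.finite_of_finite L (M := V)
  let S := Equiv.ofBijective s (Finite.injective_iff_bijective.1 (injective_of_isOrthogonal hn hB))
  have hS : ∀ y, (B x y = c ∧ B y y = 0) ↔ (B (f i) (S y) = c ∧ B (S y) (S y) = 0) := fun y => by
    rw [← hsx 0, Equiv.ofBijective_apply, hB, hB]
  have hcoord := card_fiber (φ := Pi.evalAddMonoidHom (fun _ : Fin m => L) i)
    (Function.surjective_eval i) c
  rw [Nat.card_fun, Nat.card_eq_fintype_card (α := Fin m), Fintype.card_fin] at hcoord
  rw [Nat.card_congr (S.subtypeEquiv (q := fun y => B (f i) y = c ∧ B y y = 0) hS),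
    H.card_singular hs (by simpa using hd) fun X => X i = c, mul_right_comm, Fintype.card_fin,
    pow_sub_one_mul (by lia), two_mul, pow_add]
  exact congrArg (· * _) hcoord

end SingularVectors

section IsotropicVectors

variable {F K : Type*} [Field F] [Field K] [Algebra F K] {r : ℕ}
  {A : Matrix (Fin (r + 1)) (Fin (r + 1)) F}
  {ι : Type*} [DecidableEq ι] {e f : ι → Fin (r + 1) → F} {g : Fin (r + 1) → F}

theorem HypFrame.incl (H : HypFrame (formF A) e f g) :
    HypFrame (formK K A) (fun i => incl F K r (e i)) (fun i => incl F K r (f i))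
      (incl F K r g) where
  ee i j := by rw [formK_incl, H.ee, map_zero]
  ff i j := by rw [formK_incl, H.ff, map_zero]
  ef i j := by rw [formK_incl, H.ef, apply_ite (algebraMap F K), map_one, map_zero]
  eg i := by rw [formK_incl, H.eg, map_zero]
  fg i := by rw [formK_incl, H.fg, map_zero]
  gg := by rw [formK_incl]; exact (map_ne_zero _).2 H.gg

variable [Fintype ι]

/-- The vector over `K` with given coordinates with respect to a frame over `F`. -/
def frameK (K : Type*) [Field K] [Algebra F K] (e f : ι → Fin (r + 1) → F) (g : Fin (r + 1) → F) :
    ((ι → K) × K × (ι → K)) →ₗ[K] (Fin (r + 1) → K) :=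
  frameMap (fun i => incl F K r (e i)) (fun i => incl F K r (f i))
    (incl F K r g)

theorem formK_frameK (hA : A.IsSymm) (H : HypFrame (formF A) e f g)
    (p p' : (ι → K) × K × (ι → K)) :
    formK K A (frameK K e f g p) (frameK K e f g p') =
      p.1 ⬝ᵥ p'.2.2 + p.2.2 ⬝ᵥ p'.1 + p.2.1 * p'.2.1 * algebraMap F K (formF A g g) := by
  rw [← formK_incl]
  exact H.incl.form_frameMap (isSymm_formK K hA) p p'

theorem bijective_frameK (hA : A.IsSymm) (H : HypFrame (formF A) e f g)
    (hr : r = 2 * Fintype.card ι) : Function.Bijective (frameK K e f g) :=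
  H.incl.bijective_frameMap (isSymm_formK K hA) (by simp [hr])

variable [Finite F]

omit [DecidableEq ι] in
theorem tau_frameK (p : (ι → K) × K × (ι → K)) :
    tau F (frameK K e f g p) = frameK K e f g
      (fun i => frob F K (p.1 i), frob F K p.2.1, fun i => frob F K (p.2.2 i)) := by
  have hsum : ∀ (X : ι → K) (v : ι → Fin (r + 1) → F),
      tau F (∑ i, X i • incl F K r (v i)) =
        ∑ i, frob F K (X i) • incl F K r (v i) := fun X v => by
    funext j
    simp [tau, HermTight.incl, Finset.sum_apply]
  simp only [frameK, frameMap_apply, tau_add, hsum, tau_smul, tau_incl]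

theorem herm_frameK (hA : A.IsSymm) (H : HypFrame (formF A) e f g)
    (p p' : (ι → K) × K × (ι → K)) :
    herm K A (frameK K e f g p) (frameK K e f g p') =
      p.1 ⬝ᵥ (fun i => frob F K (p'.2.2 i)) + p.2.2 ⬝ᵥ (fun i => frob F K (p'.1 i)) +
        p.2.1 * frob F K p'.2.1 * algebraMap F K (formF A g g) := by
  rw [herm_eq, tau_frameK, formK_frameK hA H]

variable [Finite K] (hK : Nat.card K = Nat.card F ^ 2)

include hK in
theorem finrank_eq_two_of_card_eq_sq : Module.finrank F K = 2 :=
  Nat.pow_right_injective Finite.one_lt_card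
    ((Module.natCard_eq_pow_finrank (K := F) (V := K)).symm.trans hK)

include hK in
theorem algebraMap_trace_eq (t : K) :
    algebraMap F K (Algebra.trace F K t) = t + frob F K t := by
  rw [FiniteField.algebraMap_trace_eq_sum_pow, finrank_eq_two_of_card_eq_sq hK]
  simp [Finset.sum_range_succ, frob_apply]

include hK in
theorem algebraMap_norm_eq (t : K) :
    algebraMap F K (Algebra.norm F t) = t * frob F K t := by
  rw [FiniteField.algebraMap_norm_eq_prod_pow, finrank_eq_two_of_card_eq_sq hK]
  simp [Finset.prod_range_succ, frob_apply]

omit [DecidableEq ι] in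
include hK in
theorem dotProduct_frob_eq (X Y : ι → K) :
    X ⬝ᵥ (fun i => frob F K (Y i)) = frob F K (Y ⬝ᵥ fun i => frob F K (X i)) := by
  simp only [dotProduct, map_sum, map_mul, frob_frob hK, mul_comm]

/-- The diagonal of the Hermitian form in frame coordinates, as an element of `F`. -/
def hermFrame (F : Type*) [Field F] [Algebra F K] [Finite F] (a : F) (p : (ι → K) × K × (ι → K)) :
    F :=
  Algebra.trace F K (p.2.2 ⬝ᵥ fun i => frob F K (p.1 i)) + Algebra.norm F p.2.1 * a

include hK in
theorem herm_frameK_self (hA : A.IsSymm) (H : HypFrame (formF A) e f g)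
    (p : (ι → K) × K × (ι → K)) :
    herm K A (frameK K e f g p) (frameK K e f g p) =
      algebraMap F K (hermFrame F (formF A g g) p) := by
  rw [herm_frameK hA H, hermFrame, map_add, map_mul, algebraMap_trace_eq hK,
    algebraMap_norm_eq hK, dotProduct_frob_eq hK p.1, add_comm (frob F K _)]

omit [DecidableEq ι] in
theorem exists_trace_dotProduct_frob_eq {X : ι → K} (hX : X ≠ 0) (c : F) :
    ∃ Y : ι → K, Algebra.trace F K (Y ⬝ᵥ fun i => frob F K (X i)) = c := by
  obtain ⟨t, rfl⟩ := Algebra.trace_surjective F K c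
  have hX' : (fun i => frob F K (X i)) ≠ 0 := fun h =>
    hX (funext fun i => (map_eq_zero (frob F K)).1 (congrFun h i))
  obtain ⟨Y, hY⟩ := exists_dotProduct_eq hX' t
  exact ⟨Y, congrArg _ hY⟩

omit [DecidableEq ι] in
theorem card_hermFrame_eq_zero_of_ne_zero {X : ι → K} (hX : X ≠ 0) (a : F) :
    Nat.card {p : K × (ι → K) // hermFrame F a (X, p) = 0} * Nat.card F =
      Nat.card K ^ (Fintype.card ι + 1) := by
  let φ : (ι → K) →+ F :=
    AddMonoidHom.mk' (fun Y => Algebra.trace F K (Y ⬝ᵥ fun i => frob F K (X i)))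
      fun Y Y' => by rw [add_dotProduct, map_add]
  have hφ : Function.Surjective φ := exists_trace_dotProduct_frob_eq hX
  have hcard := card_add_eq_zero hφ fun t : K => Algebra.norm F t * a
  rwa [Nat.card_fun, Nat.card_eq_fintype_card (α := ι), ← pow_succ'] at hcard

omit [DecidableEq ι] in
theorem card_hermFrame_zero_eq_zero {a : F} (ha : a ≠ 0) :
    Nat.card {p : K × (ι → K) // hermFrame F a (0, p) = 0} = Nat.card K ^ Fintype.card ι := by
  have hzero : ∀ p : K × (ι → K), hermFrame F a (0, p) = 0 ↔ p.1 = 0 := fun p => by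
    simp [hermFrame, ha, Algebra.norm_eq_zero_iff, dotProduct]
  rw [Nat.card_congr (Equiv.subtypeEquivRight hzero)]
  have hfiber := card_fiber (φ := AddMonoidHom.fst K (ι → K)) Prod.fst_surjective 0
  rw [Nat.card_prod, mul_comm, Nat.card_fun, Nat.card_eq_fintype_card (α := ι)] at hfiber
  exact Nat.eq_of_mul_eq_mul_left Nat.card_pos hfiber

include hK in
theorem card_isotropic [NeZero (2 : F)] (hA : A.IsSymm) (hdet : A.det ≠ 0) {m : ℕ}
    (hr : r = 2 * m) :
    (Nat.card {Z : Fin (r + 1) → K // herm K A Z Z = 0} : ℤ) =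
      (Nat.card F : ℤ) ^ r + ((Nat.card F : ℤ) ^ r - 1) * (Nat.card F : ℤ) ^ (r + 1) := by
  classical
  have := Fintype.ofFinite K
  obtain ⟨e, f, g, H⟩ := exists_hypFrame (nondegenerate_formF hdet) (isSymm_formF hA) (m := m)
    (by simp [hr])
  let coord := Equiv.ofBijective _ (bijective_frameK (K := K) hA H (by simpa using hr))
  have hcoord : ∀ p, hermFrame F (formF A g g) p = 0 ↔ herm K A (coord p) (coord p) = 0 :=
    fun p => by simp [coord, herm_frameK_self hK hA H]
  have hfiber : ∀ X ∈ ({0}ᶜ : Finset (Fin m → K)),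
      Nat.card {p : K × (Fin m → K) // hermFrame F (formF A g g) (X, p) = 0} =
        Nat.card F ^ (r + 1) := fun X hX => by
    have hcard := card_hermFrame_eq_zero_of_ne_zero (by simpa using hX) (formF A g g)
    refine Nat.eq_of_mul_eq_mul_right Nat.card_pos (hcard.trans ?_)
    rw [hK, Fintype.card_fin, hr]
    ring
  have hqr : Nat.card K ^ m = Nat.card F ^ r := by rw [hK, hr, pow_mul]
  have hvec : Fintype.card (Fin m → K) = Nat.card F ^ r := by
    rw [Fintype.card_fun, ← Nat.card_eq_fintype_card, Fintype.card_fin, hqr]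
  rw [← Nat.card_congr (coord.subtypeEquiv hcoord),
    card_prod_subtype fun (X : Fin m → K) (p : K × (Fin m → K)) =>
      hermFrame F (formF A g g) (X, p) = 0,
    Fintype.sum_eq_add_sum_compl 0, Finset.sum_congr rfl hfiber,
    card_hermFrame_zero_eq_zero H.gg, Finset.sum_const, Finset.card_compl,
    Finset.card_singleton, hvec, Fintype.card_fin, hqr, smul_eq_mul, Nat.cast_add,
    Nat.cast_mul, Nat.cast_sub (Nat.one_le_pow _ _ Nat.card_pos)]
  push_cast
  ring

end IsotropicVectors

section SingularPairs

variable {L V : Type*} [Field L] [Finite L] [NeZero (2 : L)] [AddCommGroup V] [Module L V]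
  [FiniteDimensional L V] {B : LinearMap.BilinForm L V} {m : ℕ}

theorem card_singular_pairs (hn : B.Nondegenerate) (hs : B.IsSymm) (hm : 0 < m)
    (hd : Module.finrank L V = 2 * m + 1) (c : L) :
    Nat.card {p : V × V // (p.1 ≠ 0 ∧ B p.1 p.1 = 0) ∧ B p.1 p.2 = c ∧ B p.2 p.2 = 0} =
      (Nat.card L ^ (2 * m) - 1) * Nat.card L ^ (2 * m - 1) := by
  have := Module.finite_of_finite L (M := V)
  have hcard := card_eq_card_ne_zero_add_one (fun x => B x x = 0) (by simp)
  rw [card_singular hn hs hd] at hcard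
  rw [card_prod_subtype_of_fiber (fun x => x ≠ 0 ∧ B x x = 0) (fun x y => B x y = c ∧ B y y = 0)
    fun x hx => card_singular_apply_eq hn hs hm hd hx.1 hx.2 c, hcard, Nat.add_sub_cancel]

theorem card_hyperbolic_pairs (hn : B.Nondegenerate) (hs : B.IsSymm) (hm : 0 < m)
    (hd : Module.finrank L V = 2 * m + 1) {c : L} (hc : c ≠ 0) :
    Nat.card {p : V × V // B p.1 p.1 = 0 ∧ B p.1 p.2 = c ∧ B p.2 p.2 = 0} =
      (Nat.card L ^ (2 * m) - 1) * Nat.card L ^ (2 * m - 1) := by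
  rw [← card_singular_pairs hn hs hm hd c]
  refine Nat.card_congr (Equiv.subtypeEquivRight fun p => ⟨fun ⟨hx, hxy, hy⟩ => ?_, ?_⟩)
  · exact ⟨⟨fun h => hc (by rw [← hxy, h, LinearMap.map_zero₂]), hx⟩, hxy, hy⟩
  · exact fun ⟨hx, h⟩ => ⟨hx.2, h⟩

theorem card_totally_singular_pairs (hn : B.Nondegenerate) (hs : B.IsSymm) (hm : 0 < m)
    (hd : Module.finrank L V = 2 * m + 1) :
    Nat.card {p : V × V // B p.1 p.1 = 0 ∧ B p.1 p.2 = 0 ∧ B p.2 p.2 = 0} =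
      Nat.card L ^ (2 * m) + (Nat.card L ^ (2 * m) - 1) * Nat.card L ^ (2 * m - 1) := by
  have := Module.finite_of_finite L (M := V)
  have hzero := card_prod_subtype_of_fiber (fun x : V => x = 0) (fun _ y => B y y = 0)
    fun _ _ => card_singular hn hs hd
  rw [Nat.card_unique (α := {x : V // x = 0}), one_mul] at hzero
  rw [← card_singular_pairs hn hs hm hd 0, ← hzero, ← card_or fun p hp hp' => hp'.1.1 hp.1]
  refine Nat.card_congr (Equiv.subtypeEquivRight fun p => ?_)
  rcases eq_or_ne p.1 0 with h | h <;> simp [h]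

end SingularPairs

section ClassSizes

theorem card_mul_self_mul_eq {K : Type*} [Field K] (h2 : (2 : K) ≠ 0) {b u : K} (hb : b ≠ 0)
    (hu : u ≠ 0) (h : IsSquare (u * b)) : Nat.card {c : K // c * c * b = u} = 2 := by
  obtain ⟨s, hs⟩ := h
  have hs0 : s ≠ 0 := by
    rintro rfl
    simp [hb, hu] at hs
  have hroots : {c : K | c * c * b = u} = {s / b, -(s / b)} := by
    ext c
    have hu' : u = s / b * (s / b) * b := by field_simp; linear_combination hs
    rw [Set.mem_ofPred_eq, hu', mul_left_inj' hb, mul_self_eq_mul_self_iff]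
    rfl
  change Nat.card {c : K | c * c * b = u} = 2
  rw [hroots, Nat.card_coe_set_eq, Set.ncard_pair fun h => ?_]
  refine mul_ne_zero h2 (div_ne_zero hs0 hb) ?_
  linear_combination h

variable {F K : Type*} [Field F] [Field K] [Algebra F K] [Finite F] [Finite K] {r m : ℕ}
  {A : Matrix (Fin (r + 1)) (Fin (r + 1)) F} [NeZero (2 : F)]

theorem card_vecQ (hK : Nat.card K = Nat.card F ^ 2) (hA : A.IsSymm) (hdet : A.det ≠ 0)
    (hr : r = 2 * m) :
    (Nat.card {Z : Fin (r + 1) → K // VecQ A Z} : ℤ) =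
      (Nat.card F + 1) * (Nat.card F ^ r - 1) := by
  have hcard := card_scalarExt hK (p := fun x => formF A x x = 0)
    (fun _ _ _ hx => formF_smul_smul_eq_zero hx) (by simp)
  rw [card_singular (nondegenerate_formF hdet) (isSymm_formF hA) (m := m) (by simp [hr]),
    ← hr] at hcard
  exact_mod_cast hcard

theorem card_vecQ_perp (hK : Nat.card K = Nat.card F ^ 2) (hA : A.IsSymm) (hdet : A.det ≠ 0)
    (hr : r = 2 * m) (hm : 0 < m) {x : Fin (r + 1) → F} (hx0 : x ≠ 0) (hx : formF A x x = 0) :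
    (Nat.card {Z : Fin (r + 1) → K // VecQ A Z ∧ herm K A Z (incl F K r x) = 0} : ℤ) =
      (Nat.card F + 1) * (Nat.card F ^ (r - 1) - 1) := by
  have hperp (Z : Fin (r + 1) → K) : VecQ A Z ∧ herm K A Z (incl F K r x) = 0 ↔
      scalarExt (fun y => formF A x y = 0 ∧ formF A y y = 0) Z := by
    refine ⟨?_, ?_⟩
    · rintro ⟨⟨hZ, c, y, rfl, hy⟩, hxy⟩
      rw [herm_smul_left, herm_incl, (isSymm_formF hA).eq] at hxy
      refine ⟨hZ, c, y, rfl, ?_, hy⟩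
      simpa [left_ne_zero_of_smul hZ] using hxy
    · rintro ⟨hZ, c, y, rfl, hxy, hy⟩
      refine ⟨⟨hZ, c, y, rfl, hy⟩, ?_⟩
      rw [herm_smul_left, herm_incl, (isSymm_formF hA).eq, hxy, map_zero, mul_zero]
  have hcard := card_scalarExt hK (p := fun y => formF A x y = 0 ∧ formF A y y = 0)
    (fun c y _ hy => ⟨by rw [map_smul, hy.1, smul_zero], formF_smul_smul_eq_zero hy.2⟩) (by simp)
  rw [card_singular_apply_eq (nondegenerate_formF hdet) (isSymm_formF hA) hm (by simp [hr]) hx0 hx,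
    ← hr, ← Nat.card_congr (Equiv.subtypeEquivRight hperp)] at hcard
  exact_mod_cast hcard

variable {δ : K} {d : F} (Δ : QuadExt F K δ d)

include Δ

theorem bijective_incl_add : Function.Bijective
    fun p : (Fin (r + 1) → F) × (Fin (r + 1) → F) => incl F K r p.1 + δ • incl F K r p.2 := by
  refine ⟨fun _ _ h => Prod.ext (incl_add_ext Δ h).1 (incl_add_ext Δ h).2, fun Z => ?_⟩
  obtain ⟨x, y, rfl⟩ := exists_incl_add Δ Z
  exact ⟨(x, y), rfl⟩

theorem card_herm_formK_eq (hA : A.IsSymm) (c : F) :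
    Nat.card {Z : Fin (r + 1) → K //
      herm K A Z Z = 0 ∧ formK K A Z Z = δ * algebraMap F K (2 * c)} =
    Nat.card {p : (Fin (r + 1) → F) × (Fin (r + 1) → F) //
      formF A p.1 p.1 = 0 ∧ formF A p.1 p.2 = c ∧ formF A p.2 p.2 = 0} := by
  let coord := Equiv.ofBijective _ (bijective_incl_add Δ (r := r))
  refine (Nat.card_congr (coord.subtypeEquiv fun p => ⟨?_, ?_⟩)).symm
  · rintro ⟨hx, hxy, hy⟩
    rw [Equiv.ofBijective_apply, herm_incl_add Δ hA, formK_incl_add Δ hA, hx, hxy, hy]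
    simp
  · rintro ⟨hherm, hform⟩
    obtain ⟨hx, hy, hxy⟩ := formF_eq_of_formK_eq Δ hA (a := 0) (c := c) hherm
      (by rw [mul_zero, map_zero, zero_add]; exact hform)
    exact ⟨hx, hxy, (mul_eq_zero.1 hy).resolve_left Δ.d_ne⟩

theorem card_vecQ_add_card_vecO (hA : A.IsSymm) (hdet : A.det ≠ 0) (hr : r = 2 * m)
    (hm : 0 < m) :
    (Nat.card {Z : Fin (r + 1) → K // VecQ A Z} : ℤ) +
      Nat.card {Z : Fin (r + 1) → K // VecO A Z} =
      ((Nat.card F : ℤ) ^ r - 1) * ((Nat.card F : ℤ) ^ (r - 1) + 1) := by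
  have hcard := card_herm_formK_eq Δ (r := r) hA 0
  have hiff (Z : Fin (r + 1) → K) : (Z ≠ 0 ∧ herm K A Z Z = 0 ∧ formK K A Z Z = 0) ↔
      VecQ A Z ∨ VecO A Z := by
    refine ⟨fun ⟨h0, hherm, hform⟩ => ?_, ?_⟩
    · exact (em (VecQ A Z)).imp_right fun hQ => ⟨⟨h0, hherm⟩, hform, hQ⟩
    · rintro (h | h)
      exacts [⟨h.vecH.1, h.vecH.2, h.formK_eq_zero⟩, ⟨h.1.1, h.1.2, h.2.1⟩]
  rw [card_totally_singular_pairs (nondegenerate_formF hdet) (isSymm_formF hA) hm (by simp [hr]),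
    ← hr, mul_zero, map_zero, mul_zero, card_eq_card_ne_zero_add_one _ (by simp [herm_eq]),
    Nat.card_congr (Equiv.subtypeEquivRight hiff), card_or fun _ hQ hO => hO.2.2 hQ] at hcard
  zify [Nat.one_le_pow r _ Nat.card_pos] at hcard
  linear_combination hcard

omit Δ [Finite K] [NeZero (2 : F)] in
theorem vecS_and_formK_eq_iff (hδ : 2 * δ ≠ 0) {c : K} {Z : Fin (r + 1) → K} :
    VecS A δ Z ∧ c * c * formK K A Z Z = 2 * δ ↔
      c ≠ 0 ∧ herm K A (c • Z) (c • Z) = 0 ∧ formK K A (c • Z) (c • Z) = 2 * δ := by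
  refine ⟨fun ⟨hS, hc⟩ => ?_, fun ⟨hc, hherm, hform⟩ => ?_⟩
  · refine ⟨?_, by rw [herm_smul_smul, hS.1.2, mul_zero], by rw [formK_smul_smul, hc]⟩
    rintro rfl
    exact hδ (by rw [← hc, mul_zero, zero_mul])
  · have hform' := hform
    rw [formK_smul_smul] at hform'
    refine ⟨(homogeneous_vecS.smul_iff hc Z).1 ⟨⟨?_, hherm⟩, ?_, ?_⟩, hform'⟩
    · rintro h
      exact hδ (by rw [← hform, h, map_zero])
    · rwa [hform]
    · exact ⟨2 * δ, by rw [hform]⟩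

theorem card_vecS (hA : A.IsSymm) (hdet : A.det ≠ 0) (hr : r = 2 * m) (hm : 0 < m) :
    2 * (Nat.card {Z : Fin (r + 1) → K // VecS A δ Z} : ℤ) =
      (Nat.card F ^ 2 - 1) * ((Nat.card F ^ r - 1) * Nat.card F ^ (r - 1)) := by
  have := neZero_two_algebra F K
  have hδ : 2 * δ ≠ 0 := mul_ne_zero two_ne_zero Δ.ne_zero
  -- Each vector of `𝒮` has exactly two multiples `W` with `b(W, W) = 2 δ`, and these `W` correspond
  -- to the hyperbolic pairs over `F`.
  have hvec := card_prod_subtype_of_fiber (VecS A δ) (fun Z c => c * c * formK K A Z Z = 2 * δ)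
    fun Z hZ => card_mul_self_mul_eq two_ne_zero hZ.2.1 hδ hZ.2.2
  have hscalar := card_prod_subtype_of_fiber (fun c : K => c ≠ 0)
    (fun c Z => herm K A (c • Z) (c • Z) = 0 ∧ formK K A (c • Z) (c • Z) = 2 * δ)
    fun c hc => Nat.card_congr ((MulAction.toPerm (Units.mk0 c hc)).subtypeEquiv
      (q := fun Z => herm K A Z Z = 0 ∧ formK K A Z Z = 2 * δ) fun Z => Iff.rfl)
  have hpairs := card_herm_formK_eq Δ (r := r) hA 1
  rw [card_hyperbolic_pairs (nondegenerate_formF hdet) (isSymm_formF hA) hm (by simp [hr])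
    one_ne_zero, ← hr, mul_one, map_ofNat, mul_comm δ 2] at hpairs
  have hswap := Nat.card_congr ((Equiv.prodComm (Fin (r + 1) → K) K).subtypeEquiv
    (q := fun p => p.1 ≠ 0 ∧ herm K A (p.1 • p.2) (p.1 • p.2) = 0 ∧
      formK K A (p.1 • p.2) (p.1 • p.2) = 2 * δ)
    fun p => vecS_and_formK_eq_iff (A := A) hδ (c := p.2) (Z := p.1))
  have hunits : Nat.card {c : K // c ≠ 0} = Nat.card F ^ 2 - 1 := by
    rw [← Nat.card_congr unitsEquivNeZero, Nat.card_units, Δ.card]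
  replace hswap := hvec.symm.trans (hswap.trans hscalar)
  rw [hpairs, hunits] at hswap
  zify [Nat.one_le_pow r _ (Nat.card_pos (α := F)), Nat.one_le_pow 2 _ (Nat.card_pos (α := F))]
    at hswap
  linear_combination hswap

end ClassSizes

section Excess

variable {F K : Type*} [Field F] [Field K] [Algebra F K] {r m : ℕ}

/-- The number of vectors that satisfy `p` and are orthogonal to `Z`. -/
def perpCount (A : Matrix (Fin (r + 1)) (Fin (r + 1)) F) (p : (Fin (r + 1) → K) → Prop)
    (Z : Fin (r + 1) → K) : ℕ := Nat.card {R // p R ∧ herm K A R Z = 0}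

open Classical in
/-- The difference between `perpCount A p Z` and the value that the definition of an `n`-tight set
prescribes at the point `⟨Z⟩`. Vectors are counted instead of points, which multiplies the
prescribed value by `|K| - 1`; the rank `m` of the polar space is `r / 2`. -/
def excess (A : Matrix (Fin (r + 1)) (Fin (r + 1)) F) (m : ℕ) (p : (Fin (r + 1) → K) → Prop)
    (n : ℕ) (Z : Fin (r + 1) → K) : ℤ :=
  perpCount A p Z - n * ((Nat.card K : ℤ) ^ (m - 1) - 1) -
    if p Z then ((Nat.card K : ℤ) - 1) * (Nat.card K : ℤ) ^ (m - 1) else 0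

/-- An invariant set of isotropic points, given by a predicate on vectors, that has as many points
as an `n`-tight set. -/
structure HasTightSize (A : Matrix (Fin (r + 1)) (Fin (r + 1)) F) (m : ℕ)
    (p : (Fin (r + 1) → K) → Prop) (n : ℕ) : Prop where
  homogeneous : Homogeneous p
  invariant : Invariant A p
  vecH : ∀ Z, p Z → VecH A Z
  card : (Nat.card {Z // p Z} : ℤ) = n * ((Nat.card K : ℤ) ^ m - 1)

variable {A : Matrix (Fin (r + 1)) (Fin (r + 1)) F} {p p' : (Fin (r + 1) → K) → Prop} {n n' : ℕ}

theorem perpCount_zero [Finite F] : perpCount A p 0 = Nat.card {Z // p Z} := by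
  have hzero : ∀ R, herm K A R 0 = 0 := fun R => by simpa using herm_smul_right (0 : K) R 0
  simp only [perpCount, hzero, and_true]

theorem perpCount_actK [Finite F] (hinv : Invariant A p) {g : GL (Fin (r + 1)) F}
    (hg : g ∈ similitudes A) (Z : Fin (r + 1) → K) :
    perpCount A p (actK K g Z) = perpCount A p Z := by
  refine (Nat.card_congr ((actK K g).toEquiv.subtypeEquiv fun R => ?_)).symm
  obtain ⟨c, hc, hgA⟩ := id hg
  simp [hinv.iff hg, herm_actK hgA, hc]

theorem perpCount_smul [Finite F] {c : K} (hc : c ≠ 0) (Z : Fin (r + 1) → K) :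
    perpCount A p (c • Z) = perpCount A p Z := by
  simp [perpCount, herm_smul_right, hc]

theorem perpCount_eq [Finite F] (hinv : Invariant A p) (htr : Transitive A p')
    {Z W : Fin (r + 1) → K} (hZ : p' Z) (hW : p' W) : perpCount A p Z = perpCount A p W := by
  obtain ⟨g, hg, c, hc, h⟩ := htr Z W hZ hW
  rw [← perpCount_actK hinv hg, h, perpCount_smul hc]

theorem HasTightSize.excess_eq [Finite F] (hp : HasTightSize A m p n) (htr : Transitive A p')
    {Z W : Fin (r + 1) → K} (hZ : p' Z) (hW : p' W) :
    excess A m p n Z = excess A m p n W := by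
  have hiff : p Z ↔ p W := by
    obtain ⟨g, hg, c, hc, h⟩ := htr Z W hZ hW
    rw [← hp.invariant.iff hg, h, hp.homogeneous.smul_iff hc]
  rw [excess, excess, perpCount_eq hp.invariant htr hZ hW, propext hiff]

theorem card_mul_perpCount [Finite F] [Finite K] (hK : Nat.card K = Nat.card F ^ 2)
    (hA : A.IsSymm) (hinv : Invariant A p) (hinv' : Invariant A p') (htr : Transitive A p)
    (htr' : Transitive A p') {Z W : Fin (r + 1) → K} (hZ : p Z) (hW : p' W) :
    Nat.card {Z // p Z} * perpCount A p' Z = Nat.card {Z // p' Z} * perpCount A p W := by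
  rw [← card_prod_subtype_of_fiber p (fun Y R => p' R ∧ herm K A R Y = 0)
      fun Y hY => perpCount_eq hinv' htr hY hZ,
    ← card_prod_subtype_of_fiber p' (fun Y R => p R ∧ herm K A R Y = 0)
      fun Y hY => perpCount_eq hinv htr' hY hW]
  refine Nat.card_congr ((Equiv.prodComm _ _).subtypeEquiv fun ⟨X, Y⟩ => ?_)
  simp only [Equiv.prodComm_apply, Prod.swap, herm_comm hK hA X Y]
  exact and_left_comm

theorem HasTightSize.card_mul_excess [Finite F] [Finite K] (hK : Nat.card K = Nat.card F ^ 2)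
    (hA : A.IsSymm) (hp : HasTightSize A m p n) (hp' : HasTightSize A m p' n')
    (htr : Transitive A p) (htr' : Transitive A p') (hdisj : ∀ Z, p Z → ¬ p' Z)
    {Z W : Fin (r + 1) → K} (hZ : p Z) (hW : p' W) :
    (Nat.card {Z // p Z} : ℤ) * excess A m p' n' Z =
      Nat.card {Z // p' Z} * excess A m p n W := by
  have h := card_mul_perpCount hK hA hp.invariant hp'.invariant htr htr' hZ hW
  zify at h
  rw [excess, excess, if_neg (hdisj Z hZ), if_neg fun hWp => hdisj W hWp hW]
  rw [hp.card, hp'.card] at h ⊢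
  linear_combination h

theorem theta_mul (q : ℕ) (hm : 2 ≤ m) :
    (theta ((2 * m - 4) / 2) q : ℤ) * ((q : ℤ) - 1) = (q : ℤ) ^ (m - 1) - 1 := by
  have h : (2 * m - 4) / 2 + 1 = m - 1 := by omega
  rw [theta, h]
  push_cast
  exact geom_sum_mul (q : ℤ) (m - 1)

theorem HasTightSize.perpCount_eq_mul_ncard [Finite F] [Finite K] (hp : HasTightSize A m p n)
    (P : ℙ K (Fin (r + 1) → K)) :
    (perpCount A p P.rep : ℤ) =
      ((Nat.card K : ℤ) - 1) * (hermPerp K A P ∩ pointsOf p).ncard := by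
  have hperp : Homogeneous fun R : Fin (r + 1) → K => p R ∧ herm K A R P.rep = 0 :=
    ⟨fun Z h => hp.homogeneous.ne_zero Z h.1, fun c Z hc h =>
      ⟨hp.homogeneous.smul c Z hc h.1, by rw [herm_smul_left, h.2, mul_zero]⟩⟩
  have hset : hermPerp K A P ∩ pointsOf p =
      pointsOf fun R : Fin (r + 1) → K => p R ∧ herm K A R P.rep = 0 :=
    Set.ext fun R => and_comm
  rw [hset, perpCount, card_homogeneous hperp, Nat.cast_mul, Nat.cast_sub Nat.card_pos,
    Nat.cast_one]

theorem HasTightSize.isTight [Finite F] [Finite K] (hK : Nat.card K = Nat.card F ^ 2)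
    (hr : r = 2 * m) (hm : 2 ≤ m) (hp : HasTightSize A m p n)
    (h : ∀ Z, VecH A Z → excess A m p n Z = 0) : IsTight K A n (pointsOf p) := by
  rw [IsTight, hermVariety_eq]
  refine ⟨fun P hP => hp.vecH P.rep hP, fun P hP => ?_⟩
  have hexcess := h P.rep hP
  have hne : (Nat.card K : ℤ) - 1 ≠ 0 := by
    have := Finite.one_lt_card (α := K)
    omega
  have hpow : Nat.card F ^ (r - 2) = Nat.card K ^ (m - 1) := by
    rw [hK, ← pow_mul, hr, Nat.mul_sub_one]
  have htheta := theta_mul (Nat.card K) hm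
  rw [← hr] at htheta
  rw [excess, hp.perpCount_eq_mul_ncard] at hexcess
  rw [hpow, ← hK]
  constructor <;> intro hP
  · rw [if_pos (show p P.rep from hP)] at hexcess
    zify
    exact mul_left_cancel₀ hne (by linear_combination hexcess - (n : ℤ) * htheta)
  · rw [if_neg (show ¬ p P.rep from hP)] at hexcess
    zify
    exact mul_left_cancel₀ hne (by linear_combination hexcess - (n : ℤ) * htheta)

end Excess

section Generators

variable {F K : Type*} [Field F] [Field K] [Algebra F K] {r m : ℕ}
  {A : Matrix (Fin (r + 1)) (Fin (r + 1)) F}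

/-- A parametrization of a maximal totally isotropic subspace of the Hermitian space: a generator
of `H(r, q²)`. -/
structure IsGenerator (A : Matrix (Fin (r + 1)) (Fin (r + 1)) F)
    (ψ : (Fin m → K) →ₗ[K] (Fin (r + 1) → K)) : Prop where
  inj : Function.Injective ψ
  isotropic : ∀ X Y, herm K A (ψ X) (ψ Y) = 0
  maximal : ∀ Z, herm K A Z Z = 0 → (∀ X, herm K A (ψ X) Z = 0) → Z ∈ Set.range ψ

variable [Finite F] [Finite K] {ψ : (Fin m → K) →ₗ[K] (Fin (r + 1) → K)}
  {p p' : (Fin (r + 1) → K) → Prop} {n : ℕ}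

omit [Finite F] [Finite K] in
theorem IsGenerator.card_perp_of_mem (hψ : IsGenerator A ψ) {R : Fin (r + 1) → K}
    (hR : R ∈ Set.range ψ) : Nat.card {X // herm K A R (ψ X) = 0} = Nat.card K ^ m := by
  obtain ⟨Y, rfl⟩ := hR
  simp [hψ.isotropic, Nat.card_fun]

theorem IsGenerator.card_perp_of_notMem (hK : Nat.card K = Nat.card F ^ 2) (hA : A.IsSymm)
    (hm : 0 < m) (hψ : IsGenerator A ψ) {R : Fin (r + 1) → K} (hRR : herm K A R R = 0)
    (hR : R ∉ Set.range ψ) : Nat.card {X // herm K A R (ψ X) = 0} = Nat.card K ^ (m - 1) := by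
  let φ : (Fin m → K) →ₗ[K] K :=
    { toFun := fun X => herm K A (ψ X) R
      map_add' := fun X Y => by rw [map_add, herm_add_left]
      map_smul' := fun c X => by rw [map_smul, herm_smul_left, RingHom.id_apply, smul_eq_mul] }
  have hφ : Function.Surjective φ := LinearMap.surjective fun h =>
    hR (hψ.maximal R hRR fun X => LinearMap.congr_fun h X)
  have hcard := card_fiber (φ := φ.toAddMonoidHom) hφ 0
  refine Nat.eq_of_mul_eq_mul_right (Nat.card_pos (α := K)) ?_
  rw [pow_sub_one_mul hm.ne']
  simpa [φ, Nat.card_fun, herm_comm hK hA] using hcard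

omit [Finite F] [Finite K] in
theorem IsGenerator.card_mem_range (hψ : IsGenerator A ψ) (p : (Fin (r + 1) → K) → Prop) :
    Nat.card {R // p R ∧ R ∈ Set.range ψ} = Nat.card {X // p (ψ X)} := by
  refine (Nat.card_eq_of_bijective
    (fun X : {X // p (ψ X)} => (⟨ψ X, X.2, X, rfl⟩ : {R // p R ∧ R ∈ Set.range ψ})) ⟨?_, ?_⟩).symm
  · exact fun X Y h => Subtype.ext (hψ.inj (congrArg Subtype.val h))
  · rintro ⟨_, hp, X, rfl⟩
    exact ⟨⟨X, hp⟩, rfl⟩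

theorem IsGenerator.sum_perpCount (hK : Nat.card K = Nat.card F ^ 2) (hA : A.IsSymm)
    (hm : 0 < m) (hψ : IsGenerator A ψ) (hp : ∀ Z, p Z → VecH A Z) [Fintype (Fin m → K)] :
    ((∑ X, perpCount A p (ψ X) : ℕ) : ℤ) =
      Nat.card {Z // p Z} * (Nat.card K : ℤ) ^ (m - 1) +
      Nat.card {X // p (ψ X)} * (((Nat.card K : ℤ) - 1) * (Nat.card K : ℤ) ^ (m - 1)) := by
  have hpairs : ∑ X, perpCount A p (ψ X) =
      Nat.card {x : (Fin (r + 1) → K) × (Fin m → K) // p x.1 ∧ herm K A x.1 (ψ x.2) = 0} :=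
    (card_prod_subtype _).symm.trans
      (Nat.card_congr ((Equiv.prodComm _ _).subtypeEquiv fun _ => Iff.rfl))
  have hmem := card_prod_subtype_of_fiber (fun R => p R ∧ R ∈ Set.range ψ)
    (fun R X => herm K A R (ψ X) = 0) fun R hR => hψ.card_perp_of_mem hR.2
  have hnotMem := card_prod_subtype_of_fiber (fun R => p R ∧ R ∉ Set.range ψ)
    (fun R X => herm K A R (ψ X) = 0)
    fun R hR => hψ.card_perp_of_notMem hK hA hm (hp R hR.1).2 hR.2
  have hsplit := card_or (p := fun R => p R ∧ R ∈ Set.range ψ)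
    (q := fun R => p R ∧ R ∉ Set.range ψ) fun R h h' => h'.2 h.2
  have hsplit' := card_or
    (p := fun x : (Fin (r + 1) → K) × (Fin m → K) =>
      (p x.1 ∧ x.1 ∈ Set.range ψ) ∧ herm K A x.1 (ψ x.2) = 0)
    (q := fun x => (p x.1 ∧ x.1 ∉ Set.range ψ) ∧ herm K A x.1 (ψ x.2) = 0)
    fun x h h' => h'.1.2 h.1.2
  simp only [← or_and_right, ← and_or_left, em, and_true] at hsplit hsplit'
  rw [hmem, hnotMem] at hsplit'
  rw [hpairs, hsplit', hsplit, hψ.card_mem_range, ← pow_sub_one_mul hm.ne' (Nat.card K)]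
  push_cast
  ring

theorem HasTightSize.sum_excess (hK : Nat.card K = Nat.card F ^ 2) (hA : A.IsSymm)
    (hm : 0 < m) (hp : HasTightSize A m p n) (hψ : IsGenerator A ψ) [Fintype (Fin m → K)] :
    ∑ X, excess A m p n (ψ X) = excess A m p n 0 := by
  classical
  have hcount := hψ.sum_perpCount hK hA hm hp.vecH
  have hzero : ¬ p 0 := fun h => hp.homogeneous.ne_zero 0 h rfl
  have hind (a : ℤ) : (∑ X, if p (ψ X) then a else 0) = Nat.card {X // p (ψ X)} * a := by
    rw [← Finset.sum_filter, Finset.sum_const, nsmul_eq_mul, Nat.card_eq_fintype_card,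
      Fintype.card_subtype]
  push_cast at hcount
  simp only [excess, Finset.sum_sub_distrib, Finset.sum_const, Finset.card_univ,
    ← Nat.card_eq_fintype_card, Nat.card_fun, Nat.card_fin, nsmul_eq_mul]
  rw [hcount, hind, perpCount_zero, if_neg hzero, hp.card]
  push_cast
  ring

theorem HasTightSize.excess_eq_zero_of_generator (hK : Nat.card K = Nat.card F ^ 2)
    (hA : A.IsSymm) (hm : 0 < m) (hp : HasTightSize A m p n) (htr : Transitive A p')
    (hψ : IsGenerator A ψ) (hne : ∃ X, ψ X ≠ 0 ∧ p' (ψ X))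
    (hrest : ∀ X, ψ X ≠ 0 → ¬ p' (ψ X) → excess A m p n (ψ X) = 0)
    {Z : Fin (r + 1) → K} (hZ : p' Z) : excess A m p n Z = 0 := by
  classical
  let := Fintype.ofFinite (Fin m → K)
  have hsum := hp.sum_excess hK hA hm hψ
  rw [← Finset.add_sum_erase _ _ (Finset.mem_univ 0), map_zero, add_eq_left] at hsum
  have hterm : ∀ X ∈ Finset.univ.erase (0 : Fin m → K),
      excess A m p n (ψ X) = if p' (ψ X) then excess A m p n Z else 0 := fun X hX => by
    have hX0 : ψ X ≠ 0 := (map_ne_zero_iff ψ hψ.inj).2 (Finset.ne_of_mem_erase hX)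
    split_ifs with h
    · exact hp.excess_eq htr h hZ
    · exact hrest X hX0 h
  rw [Finset.sum_congr rfl hterm, ← Finset.sum_filter, Finset.sum_const, smul_eq_zero] at hsum
  refine hsum.resolve_left (Finset.card_ne_zero.2 ?_)
  obtain ⟨X, hX0, hX⟩ := hne
  exact ⟨X, by simpa [hX] using fun h => hX0 (by rw [h, map_zero])⟩

end Generators

section IsotropicSubspaces

variable {F K : Type*} [Field F] [Field K] [Algebra F K] [Finite F] [Finite K] {r : ℕ}
  {A : Matrix (Fin (r + 1)) (Fin (r + 1)) F}

omit [Finite F] [Finite K] in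
theorem nondegenerate_formK (hdet : A.det ≠ 0) : (formK K A).Nondegenerate := by
  refine LinearMap.BilinForm.nondegenerate_toBilin'_iff_det_ne_zero.2 ?_
  rw [← RingHom.mapMatrix_apply, ← RingHom.map_det]
  exact (map_ne_zero _).2 hdet

theorem linearIndependent_tau (hK : Nat.card K = Nat.card F ^ 2) {ι : Type*}
    {v : ι → Fin (r + 1) → K} (hv : LinearIndependent K v) :
    LinearIndependent K fun i => tau F (v i) := by
  let τ : (Fin (r + 1) → K) →+ (Fin (r + 1) → K) :=
    ⟨⟨tau F, funext fun _ => map_zero (frob F K)⟩, tau_add⟩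
  exact hv.map_of_surjective_injective (frob F K) τ (fun c => ⟨frob F K c, frob_frob hK c⟩)
    (fun X h => funext fun j => (map_eq_zero (frob F K)).1 (congrFun h j)) tau_smul

theorem two_mul_card_le_of_isotropic (hK : Nat.card K = Nat.card F ^ 2) (hdet : A.det ≠ 0)
    {ι : Type*} [Fintype ι] {v : ι → Fin (r + 1) → K} (hv : LinearIndependent K v)
    (hiso : ∀ i j, herm K A (v i) (v j) = 0) : 2 * Fintype.card ι ≤ r + 1 := by
  have hle : Submodule.span K (Set.range fun i => tau F (v i)) ≤
      (formK K A).orthogonal (Submodule.span K (Set.range v)) := by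
    rw [Submodule.span_le]
    rintro _ ⟨j, rfl⟩
    intro X hX
    induction hX using Submodule.span_induction with
    | mem _ h =>
      obtain ⟨i, rfl⟩ := h
      exact (herm_eq _ _).symm.trans (hiso i j)
    | zero => exact LinearMap.map_zero₂ _ _
    | add X Y _ _ hX hY => exact (LinearMap.map_add₂ _ _ _ _).trans (by rw [hX, hY, add_zero])
    | smul c X _ hX => exact (LinearMap.map_smul₂ _ _ _ _).trans (by rw [hX, smul_zero])
  have h := Submodule.finrank_mono hle
  rw [LinearMap.BilinForm.finrank_orthogonal (nondegenerate_formK hdet), finrank_span_eq_card hv,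
    finrank_span_eq_card (linearIndependent_tau hK hv), Module.finrank_fin_fun] at h
  have hcard := hv.fintype_card_le_finrank
  rw [Module.finrank_fin_fun] at hcard
  omega

theorem isGenerator_of_isotropic (hK : Nat.card K = Nat.card F ^ 2) (hA : A.IsSymm)
    (hdet : A.det ≠ 0) {m : ℕ} (hr : r = 2 * m) {ψ : (Fin m → K) →ₗ[K] (Fin (r + 1) → K)}
    (hinj : Function.Injective ψ) (hiso : ∀ X Y, herm K A (ψ X) (ψ Y) = 0) :
    IsGenerator A ψ where
  inj := hinj
  isotropic := hiso
  maximal Z hZ hψZ := by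
    by_contra hmem
    let v : Fin m → Fin (r + 1) → K := ψ ∘ Pi.basisFun K (Fin m)
    have hspan : Submodule.span K (Set.range v) = LinearMap.range ψ := by
      rw [Set.range_comp, ← Submodule.map_span, Module.Basis.span_eq, LinearMap.range_eq_map]
    have hv : LinearIndependent K (Fin.cons Z v : Fin (m + 1) → Fin (r + 1) → K) :=
      linearIndependent_finCons.2 ⟨(Pi.basisFun K (Fin m)).linearIndependent.map'
        ψ (LinearMap.ker_eq_bot.2 hinj), by rwa [hspan]⟩
    have hcard := two_mul_card_le_of_isotropic (A := A) hK hdet hv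
      (Fin.cases (Fin.cases hZ fun j => (herm_comm hK hA _ _).1 (hψZ _)) fun i =>
        Fin.cases (hψZ _) fun j => hiso _ _)
    rw [Fintype.card_fin] at hcard
    omega

end IsotropicSubspaces

section ExtendedGenerators

variable {F K : Type*} [Field F] [Field K] [Algebra F K] [Finite F] {r m : ℕ}
  {A : Matrix (Fin (r + 1)) (Fin (r + 1)) F}
  {e f : Fin m → Fin (r + 1) → F} {g : Fin (r + 1) → F}

/-- The extension over `K` of the totally singular subspace `⟨e₁, …, eₘ⟩`. -/
def extendedGenerator (K : Type*) [Field K] [Algebra F K] (e f : Fin m → Fin (r + 1) → F)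
    (g : Fin (r + 1) → F) : (Fin m → K) →ₗ[K] (Fin (r + 1) → K) :=
  frameK K e f g ∘ₗ LinearMap.inl K (Fin m → K) (K × (Fin m → K))

omit [Finite F] in
theorem extendedGenerator_apply (X : Fin m → K) :
    extendedGenerator K e f g X = frameK K e f g (X, 0, 0) := rfl

theorem isGenerator_extendedGenerator [Finite K] (hK : Nat.card K = Nat.card F ^ 2)
    (hA : A.IsSymm) (hdet : A.det ≠ 0) (hr : r = 2 * m) (H : HypFrame (formF A) e f g) :
    IsGenerator A (extendedGenerator K e f g) := by
  refine isGenerator_of_isotropic hK hA hdet hr ?_ fun X Y => ?_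
  · exact (bijective_frameK hA H (by simpa using hr)).1.comp LinearMap.inl_injective
  · simp [extendedGenerator_apply, herm_frameK hA H, dotProduct]

omit [Finite F] in
theorem formK_extendedGenerator (hA : A.IsSymm) (H : HypFrame (formF A) e f g) (X : Fin m → K) :
    formK K A (extendedGenerator K e f g X) (extendedGenerator K e f g X) = 0 := by
  simp [extendedGenerator_apply, formK_frameK hA H]

variable [NeZero (2 : F)] {δ : K} {d : F} (Δ : QuadExt F K δ d)

omit [NeZero (2 : F)] in
theorem VecQ.exists_tau_eq_smul {Z : Fin (r + 1) → K} (h : VecQ A Z) :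
    ∃ c : K, tau F Z = c • Z := by
  obtain ⟨hZ, b, x, rfl, -⟩ := h
  have hb : b ≠ 0 := (smul_ne_zero_iff.1 hZ).1
  exact ⟨frob F K b / b, by rw [tau_smul, tau_incl, smul_smul, div_mul_cancel₀ _ hb]⟩

include Δ in
theorem QuadExt.not_vecQ_frameK (hA : A.IsSymm) (hr : r = 2 * m) (H : HypFrame (formF A) e f g)
    {i j : Fin m} (hij : i ≠ j) :
    ¬ VecQ A (frameK K e f g (Pi.single i 1 + Pi.single j δ, 0, 0)) := fun h => by
  obtain ⟨c, hc⟩ := h.exists_tau_eq_smul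
  rw [tau_frameK, ← map_smul] at hc
  have hfst := congrArg Prod.fst ((bijective_frameK hA H (by simpa using hr)).1 hc)
  have hi : 1 = c := by simpa [hij] using congrFun hfst i
  have hj : -δ = c * δ := by simpa [hij.symm, Δ.frob] using congrFun hfst j
  have := neZero_two_algebra F K
  rw [← hi, one_mul] at hj
  have h2 : 2 * δ = 0 := by linear_combination -hj
  exact mul_ne_zero two_ne_zero Δ.ne_zero h2

include Δ in
theorem exists_generator_vecO [Finite K] (hA : A.IsSymm) (hdet : A.det ≠ 0) (hr : r = 2 * m)
    (hm : 2 ≤ m) : ∃ ψ : (Fin m → K) →ₗ[K] (Fin (r + 1) → K), IsGenerator A ψ ∧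
      (∃ X, VecO A (ψ X)) ∧ ∀ X, formK K A (ψ X) (ψ X) = 0 := by
  obtain ⟨e, f, g, H⟩ := exists_hypFrame (nondegenerate_formF hdet) (isSymm_formF hA)
    (m := m) (by simp [hr])
  have hψ := isGenerator_extendedGenerator Δ.card hA hdet hr H
  have hij : (⟨0, by omega⟩ : Fin m) ≠ ⟨1, by omega⟩ := by simp
  let X : Fin m → K := Pi.single ⟨0, by omega⟩ 1 + Pi.single ⟨1, by omega⟩ δ
  have hX : X ≠ 0 := fun h => by simpa [X, hij] using congrFun h ⟨0, by omega⟩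
  have hψX : extendedGenerator K e f g X ≠ 0 := (map_ne_zero_iff _ hψ.inj).2 hX
  exact ⟨_, hψ, ⟨X, ⟨hψX, hψ.isotropic X X⟩, formK_extendedGenerator hA H X,
    Δ.not_vecQ_frameK hA hr H hij⟩, formK_extendedGenerator hA H⟩

end ExtendedGenerators

section MixedGenerators

variable {F K : Type*} [Field F] [Field K] [Algebra F K] [Finite F] {r m : ℕ}
  {A : Matrix (Fin (r + 1)) (Fin (r + 1)) F} {δ : K} {d : F} (Δ : QuadExt F K δ d)
  {e f : Fin m → Fin (r + 1) → F} {g : Fin (r + 1) → F}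

/-- The subspace spanned by the vectors `e i`, `i ≠ i₀`, and the vector
`s • e i₀ + δ • g + f i₀` of the orthogonal space `⟨e i₀, g, f i₀⟩`. -/
def mixedGenerator (e f : Fin m → Fin (r + 1) → F) (g : Fin (r + 1) → F) (i₀ : Fin m) (s δ : K) :
    (Fin m → K) →ₗ[K] (Fin (r + 1) → K) :=
  frameK K e f g ∘ₗ (LinearMap.inl K (Fin m → K) (K × (Fin m → K)) +
    (LinearMap.proj i₀).smulRight (Pi.single i₀ (s - 1), δ, Pi.single i₀ 1))

omit [Finite F] in
theorem mixedGenerator_apply (i₀ : Fin m) (s : K) (X : Fin m → K) :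
    mixedGenerator e f g i₀ s δ X = frameK K e f g
      (X + Pi.single i₀ (X i₀ * (s - 1)), X i₀ * δ, Pi.single i₀ (X i₀)) := by
  simp [mixedGenerator, ← Pi.single_smul]

omit [Finite F] in
theorem injective_mixedGenerator (hA : A.IsSymm) (H : HypFrame (formF A) e f g)
    (hr : r = 2 * m) (i₀ : Fin m) (s : K) :
    Function.Injective (mixedGenerator e f g i₀ s δ) := fun X Y h => by
  rw [mixedGenerator_apply, mixedGenerator_apply] at h
  have hXY := (bijective_frameK hA H (by simpa using hr)).1 h
  have hi₀ : X i₀ = Y i₀ := Pi.single_injective i₀ (congrArg (fun p => p.2.2) hXY)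
  have hfst := congrArg Prod.fst hXY
  rw [hi₀] at hfst
  exact add_right_cancel hfst

include Δ in
theorem isGenerator_mixedGenerator [Finite K] (hA : A.IsSymm) (hdet : A.det ≠ 0) (hr : r = 2 * m)
    (H : HypFrame (formF A) e f g) (i₀ : Fin m) (s : K)
    (hs : s + frob F K s = algebraMap F K (formF A g g) * algebraMap F K d) :
    IsGenerator A (mixedGenerator e f g i₀ s δ) := by
  refine isGenerator_of_isotropic Δ.card hA hdet hr (injective_mixedGenerator hA H hr i₀ s)
    fun X Y => ?_
  have hfrob : (fun i => frob F K ((Pi.single i₀ (Y i₀) : Fin m → K) i)) =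
      Pi.single i₀ (frob F K (Y i₀)) :=
    funext fun i => Pi.apply_single (fun _ => frob F K) (fun _ => map_zero _) i₀ _ i
  rw [mixedGenerator_apply, mixedGenerator_apply, herm_frameK hA H]
  simp only [hfrob, dotProduct_single, single_dotProduct, Pi.add_apply, Pi.single_eq_same,
    map_add, map_sub, map_mul, map_one, Δ.frob]
  rw [← Δ.sq] at hs
  linear_combination (X i₀ * frob F K (Y i₀)) * hs

omit [Finite F] in
theorem formK_mixedGenerator (hA : A.IsSymm) (H : HypFrame (formF A) e f g) (i₀ : Fin m) (c : F)
    {s : K} (hs : 2 * s = algebraMap F K (formF A g g) * (δ * δ) + 2 * δ * algebraMap F K c)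
    (X : Fin m → K) :
    formK K A (mixedGenerator e f g i₀ s δ X) (mixedGenerator e f g i₀ s δ X) =
      2 * δ * (X i₀ * X i₀) * (algebraMap F K c + δ * algebraMap F K (formF A g g)) := by
  rw [mixedGenerator_apply, formK_frameK hA H]
  simp only [dotProduct_single, single_dotProduct, Pi.add_apply, Pi.single_eq_same]
  linear_combination (X i₀ * X i₀) * hs

include Δ
variable [Finite K] [NeZero (2 : F)]

theorem QuadExt.exists_isSquare_iff {a v : F} (ha : a ≠ 0) (hv : v ≠ 0) (u : F) :
    ∃ c : F, IsSquare (algebraMap F K c + δ * algebraMap F K a) ↔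
      IsSquare (algebraMap F K u + δ * algebraMap F K v) := by
  obtain ⟨t, ht⟩ := isSquare_algebraMap (K := K) Δ.card (a / v)
  have hav : algebraMap F K (a / v) ≠ 0 := by simp [ha, hv]
  have ht0 : t ≠ 0 := fun h => hav (by rw [ht, h, mul_zero])
  refine ⟨a / v * u, ?_⟩
  have h : algebraMap F K (a / v * u) + δ * algebraMap F K a =
      1 * (t * t * (algebraMap F K u + δ * algebraMap F K v)) := by
    rw [← ht, one_mul, mul_add, map_mul, mul_left_comm, ← map_mul _ (a / v) v,
      div_mul_cancel₀ a hv]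
  rw [h, isSquare_mul_mul_self_mul_iff ht0, one_mul]

theorem exists_generator_isSquare_iff (hA : A.IsSymm) (hdet : A.det ≠ 0) (hr : r = 2 * m)
    (hm : 0 < m) {v : F} (hv : v ≠ 0) (u : F) :
    ∃ ψ : (Fin m → K) →ₗ[K] (Fin (r + 1) → K), IsGenerator A ψ ∧
      (∃ X, formK K A (ψ X) (ψ X) ≠ 0) ∧
      ∀ X, formK K A (ψ X) (ψ X) ≠ 0 →
        (IsSquare (2 * δ * formK K A (ψ X) (ψ X)) ↔
          IsSquare (algebraMap F K u + δ * algebraMap F K v)) := by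
  obtain ⟨e, f, g, H⟩ := exists_hypFrame (nondegenerate_formF hdet) (isSymm_formF hA)
    (m := m) (by simp [hr])
  obtain ⟨c, hc⟩ := Δ.exists_isSquare_iff H.gg hv u
  have := neZero_two_algebra F K
  let i₀ : Fin m := ⟨0, hm⟩
  let s : K := algebraMap F K (formF A g g * d / 2) + δ * algebraMap F K c
  have hhalf : (2 : K) * algebraMap F K (formF A g g * d / 2) =
      algebraMap F K (formF A g g) * algebraMap F K d := by
    rw [← map_mul, ← map_ofNat (algebraMap F K) 2, ← map_mul, mul_div_cancel₀ _ two_ne_zero]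
  have htrace : s + frob F K s = algebraMap F K (formF A g g) * algebraMap F K d := by
    simp only [s, map_add, map_mul, AlgHom.commutes, Δ.frob]
    linear_combination hhalf
  have hform := formK_mixedGenerator (δ := δ) hA H i₀ c (s := s) <| by
    simp only [s]
    linear_combination hhalf - algebraMap F K (formF A g g) * Δ.sq
  have hη : algebraMap F K c + δ * algebraMap F K (formF A g g) ≠ 0 := fun h =>
    H.gg (Δ.eq_zero h).2
  obtain ⟨t, ht⟩ := isSquare_algebraMap (K := K) Δ.card d
  have ht0 : t ≠ 0 := fun h => Δ.d_ne (by simpa [h] using ht)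
  refine ⟨_, isGenerator_mixedGenerator Δ hA hdet hr H i₀ s htrace, ⟨1, ?_⟩, fun X hX => ?_⟩
  · simp [hform, hη, Δ.ne_zero, two_ne_zero]
  · rw [hform] at hX ⊢
    have hXi₀ : X i₀ ≠ 0 := fun h => hX (by simp [h])
    have h : 2 * δ * (2 * δ * (X i₀ * X i₀) *
        (algebraMap F K c + δ * algebraMap F K (formF A g g))) =
        1 * (2 * t * X i₀ * (2 * t * X i₀) *
          (algebraMap F K c + δ * algebraMap F K (formF A g g))) := by
      linear_combination (4 * X i₀ * X i₀ * (algebraMap F K c + δ *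
        algebraMap F K (formF A g g))) * (Δ.sq.trans ht)
    rw [h, isSquare_mul_mul_self_mul_iff (by simp [ht0, hXi₀, two_ne_zero]), one_mul, hc]

theorem exists_generator_vecE (hA : A.IsSymm) (hdet : A.det ≠ 0) (hr : r = 2 * m) (hm : 0 < m) :
    ∃ ψ : (Fin m → K) →ₗ[K] (Fin (r + 1) → K), IsGenerator A ψ ∧
      (∃ X, VecE A δ (ψ X)) ∧
      ∀ X, formK K A (ψ X) (ψ X) = 0 ∨ VecE A δ (ψ X) := by
  have := neZero_two_algebra F K
  obtain ⟨η, hη⟩ := FiniteField.exists_nonsquare (ringChar_ne_two (F := K))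
  obtain ⟨u, v, rfl⟩ := Δ.exists_eq η
  have hv : v ≠ 0 := fun h => hη (by simpa [h] using isSquare_algebraMap Δ.card u)
  obtain ⟨ψ, hψ, ⟨X, hX⟩, hsq⟩ :=
    exists_generator_isSquare_iff Δ hA hdet hr hm hv u
  have hE : ∀ X, formK K A (ψ X) (ψ X) ≠ 0 → VecE A δ (ψ X) := fun X hX =>
    ⟨⟨fun h => hX (by simp [h]), hψ.isotropic X X⟩, hX, by rwa [hsq X hX]⟩
  exact ⟨ψ, hψ, ⟨X, hE X hX⟩, fun X => or_iff_not_imp_left.2 (hE X)⟩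

theorem exists_generator_vecS (hA : A.IsSymm) (hdet : A.det ≠ 0) (hr : r = 2 * m) (hm : 0 < m) :
    ∃ ψ : (Fin m → K) →ₗ[K] (Fin (r + 1) → K), IsGenerator A ψ ∧
      (∃ X, VecS A δ (ψ X)) ∧
      ∀ X, formK K A (ψ X) (ψ X) = 0 ∨ VecS A δ (ψ X) := by
  have hη : IsSquare (algebraMap F K (1 + d) + δ * algebraMap F K 2) :=
    ⟨1 + δ, by rw [map_add, map_one, map_ofNat]; linear_combination -Δ.sq⟩
  obtain ⟨ψ, hψ, ⟨X, hX⟩, hsq⟩ :=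
    exists_generator_isSquare_iff Δ hA hdet hr hm two_ne_zero (1 + d)
  have hS : ∀ X, formK K A (ψ X) (ψ X) ≠ 0 → VecS A δ (ψ X) := fun X hX =>
    ⟨⟨fun h => hX (by simp [h]), hψ.isotropic X X⟩, hX, (hsq X hX).2 hη⟩
  exact ⟨ψ, hψ, ⟨X, hS X hX⟩, fun X => or_iff_not_imp_left.2 (hS X)⟩

end MixedGenerators

section Classes

variable {F K : Type*} [Field F] [Field K] [Algebra F K] {r : ℕ}

/-- The four classes of isotropic vectors, in the order in which the theorem lists the orbits. -/
def vecClass (A : Matrix (Fin (r + 1)) (Fin (r + 1)) F) (δ : K) :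
    Fin 4 → (Fin (r + 1) → K) → Prop :=
  ![VecQ A, VecO A, VecE A δ, VecS A δ]

variable [Finite F] {m : ℕ} {A : Matrix (Fin (r + 1)) (Fin (r + 1)) F} {δ : K} {d : F}

theorem homogeneous_vecClass (j : Fin 4) : Homogeneous (vecClass A δ j) := by
  fin_cases j
  exacts [homogeneous_scalarExt _, homogeneous_vecO, homogeneous_vecE, homogeneous_vecS]

theorem invariant_vecClass [Finite K] [NeZero (2 : F)] (hK : Nat.card K = Nat.card F ^ 2)
    (j : Fin 4) : Invariant A (vecClass A δ j) := by
  fin_cases j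
  exacts [invariant_vecQ, invariant_vecO, invariant_vecE hK δ, invariant_vecS hK δ]

omit [Finite F] in
theorem exists_vecClass_iff {Z : Fin (r + 1) → K} (h : VecH A Z) :
    ∃ i, ∀ j, vecClass A δ j Z ↔ i = j := by
  by_cases hQ : VecQ A Z
  · exact ⟨0, fun j => by fin_cases j <;> simp [vecClass, VecO, VecE, VecS, hQ, hQ.formK_eq_zero]⟩
  by_cases h0 : formK K A Z Z = 0
  · exact ⟨1, fun j => by fin_cases j <;> simp [vecClass, VecO, VecE, VecS, h, hQ, h0]⟩
  by_cases hsq : IsSquare (2 * δ * formK K A Z Z)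
  · exact ⟨3, fun j => by fin_cases j <;> simp [vecClass, VecO, VecE, VecS, h, hQ, h0, hsq]⟩
  · exact ⟨2, fun j => by fin_cases j <;> simp [vecClass, VecO, VecE, VecS, h, hQ, h0, hsq]⟩

theorem vecH_of_vecClass {j : Fin 4} {Z : Fin (r + 1) → K} (h : vecClass A δ j Z) : VecH A Z := by
  fin_cases j
  exacts [VecQ.vecH h, h.1, h.1, h.1]

theorem vecClass_iff_eq {i : Fin 4} {Z : Fin (r + 1) → K} (h : vecClass A δ i Z) (j : Fin 4) :
    vecClass A δ j Z ↔ i = j := by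
  obtain ⟨k, hk⟩ := exists_vecClass_iff (δ := δ) (vecH_of_vecClass h)
  rw [hk j, (hk i).1 h]

variable [Finite K] [NeZero (2 : F)] (Δ : QuadExt F K δ d)
include Δ

theorem transitive_vecClass (hA : A.IsSymm) (hdet : A.det ≠ 0) (j : Fin 4) :
    Transitive A (vecClass A δ j) := by
  fin_cases j
  exacts [transitive_vecQ hA hdet, transitive_vecO hA hdet Δ, transitive_vecE hA hdet Δ,
    transitive_vecS hA hdet Δ]

theorem range_pointsOf_vecClass (hA : A.IsSymm) :
    (Set.range fun j => pointsOf (vecClass A δ j)) =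
      {setQ K A, setO K A, setE K A, setS K A} := by
  rw [setQ_eq, setO_eq Δ hA, setE_eq Δ hA, setS_eq Δ hA]
  ext X
  simp [Fin.exists_fin_succ, vecClass, eq_comm (a := X)]

omit Δ in
theorem exists_isotropic (hA : A.IsSymm) (hdet : A.det ≠ 0) (hr : r = 2 * m) (hm : 0 < m) :
    ∃ x : Fin (r + 1) → F, x ≠ 0 ∧ formF A x x = 0 := by
  obtain ⟨e, f, g, H⟩ := exists_hypFrame (nondegenerate_formF hdet) (isSymm_formF hA) (m := m)
    (by simp [hr])
  refine ⟨e ⟨0, hm⟩, fun he => ?_, H.ee _ _⟩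
  simpa [he] using H.ef ⟨0, hm⟩ ⟨0, hm⟩

theorem exists_vecClass (hA : A.IsSymm) (hdet : A.det ≠ 0) (hr : r = 2 * m) (hm : 2 ≤ m)
    (j : Fin 4) : ∃ Z, vecClass A δ j Z := by
  have hm0 : 0 < m := by omega
  fin_cases j
  · obtain ⟨x, hx0, hx⟩ := exists_isotropic hA hdet hr hm0
    exact ⟨incl F K r x, incl_ne_zero K hx0, 1, x, (one_smul _ _).symm, hx⟩
  · obtain ⟨ψ, -, ⟨X, hX⟩, -⟩ := exists_generator_vecO Δ hA hdet hr hm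
    exact ⟨_, hX⟩
  · obtain ⟨ψ, -, ⟨X, hX⟩, -⟩ := exists_generator_vecE Δ hA hdet hr hm0
    exact ⟨_, hX⟩
  · obtain ⟨ψ, -, ⟨X, hX⟩, -⟩ := exists_generator_vecS Δ hA hdet hr hm0
    exact ⟨_, hX⟩

theorem exists_mem_pointsOf (hA : A.IsSymm) (hdet : A.det ≠ 0) (hr : r = 2 * m) (hm : 2 ≤ m)
    (j : Fin 4) : ∃ P, P ∈ pointsOf (vecClass A δ j) := by
  obtain ⟨Z, hZ⟩ := exists_vecClass Δ hA hdet hr hm j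
  exact ⟨_, (mk_mem_pointsOf (homogeneous_vecClass j) Z
    ((homogeneous_vecClass j).ne_zero Z hZ)).2 hZ⟩

theorem orbits_eq_range (hA : A.IsSymm) (hdet : A.det ≠ 0) (hr : r = 2 * m) (hm : 2 ≤ m) :
    (fun P => MulAction.orbit (groupG K A) P) '' hermVariety K A =
      Set.range fun j => pointsOf (vecClass A δ j) := by
  have horbit (j : Fin 4) {P : ℙ K (Fin (r + 1) → K)} (hP : P ∈ pointsOf (vecClass A δ j)) :=
    orbit_eq_pointsOf (homogeneous_vecClass j) (invariant_vecClass Δ.card j)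
      (transitive_vecClass Δ hA hdet j) hP
  rw [hermVariety_eq]
  ext X
  constructor
  · rintro ⟨P, hP, rfl⟩
    obtain ⟨j, hj⟩ := exists_vecClass_iff (δ := δ) (Z := P.rep) hP
    exact ⟨j, (horbit j ((hj j).2 rfl)).symm⟩
  · rintro ⟨j, rfl⟩
    obtain ⟨P, hP⟩ := exists_mem_pointsOf Δ hA hdet hr hm j
    exact ⟨P, vecH_of_vecClass hP, horbit j hP⟩

theorem ncard_range_pointsOf (hA : A.IsSymm) (hdet : A.det ≠ 0) (hr : r = 2 * m) (hm : 2 ≤ m) :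
    (Set.range fun j => pointsOf (vecClass A δ j)).ncard = 4 := by
  have hinj : Function.Injective fun j => pointsOf (vecClass A δ j) := fun i j hij => by
    obtain ⟨P, hP⟩ := exists_mem_pointsOf Δ hA hdet hr hm i
    have hPj : P ∈ pointsOf (vecClass A δ j) := hij.subset hP
    exact (vecClass_iff_eq (Z := P.rep) hP j).1 hPj
  rw [Set.ncard_range_of_injective hinj, Nat.card_fin]

end Classes

section Tightness

/-- The parameters of the four tight sets, in the order of `vecClass`. -/
def tightParam (q r : ℕ) : Fin 4 → ℕ :=
  ![q + 1, q ^ (r - 1) - q, (q ^ (r + 1) - q ^ (r - 1)) / 2, (q ^ (r + 1) - q ^ (r - 1)) / 2]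

theorem cast_tightParam_one {q r : ℕ} (hr : 2 ≤ r) :
    (tightParam q r 1 : ℤ) = (q : ℤ) ^ (r - 1) - q := by
  simp [tightParam, Nat.cast_sub (Nat.le_self_pow (show r - 1 ≠ 0 by omega) q)]

theorem two_mul_tightParam_three {q r : ℕ} (hq : Odd q) (hr : 0 < r) :
    2 * (tightParam q r 3 : ℤ) = (q : ℤ) ^ (r - 1) * ((q : ℤ) ^ 2 - 1) := by
  have hle : q ^ (r - 1) ≤ q ^ (r + 1) := Nat.pow_le_pow_right hq.pos (by omega)
  have hdvd : 2 * tightParam q r 3 = q ^ (r + 1) - q ^ (r - 1) :=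
    Nat.mul_div_cancel' (Nat.Odd.sub_odd hq.pow hq.pow).two_dvd
  zify [hle] at hdvd
  rw [hdvd, mul_sub_one, ← pow_add]
  congr 2
  omega

variable {F K : Type*} [Field F] [Field K] [Algebra F K] [Finite F] [Finite K] {r m : ℕ}
  {A : Matrix (Fin (r + 1)) (Fin (r + 1)) F} {δ : K}

theorem card_vecH_eq_sum :
    Nat.card {Z : Fin (r + 1) → K // VecH A Z} =
      ∑ j, Nat.card {Z // vecClass A δ j Z} := by
  rw [← Nat.card_sigma]
  refine (Nat.card_eq_of_bijective (fun x : Σ j, {Z // vecClass A δ j Z} =>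
    (⟨x.2.1, vecH_of_vecClass x.2.2⟩ : {Z // VecH A Z})) ⟨?_, ?_⟩).symm
  · rintro ⟨i, Z, hZ⟩ ⟨j, W, hW⟩ h
    obtain rfl : Z = W := congrArg Subtype.val h
    obtain rfl := (vecClass_iff_eq hZ j).1 hW
    rfl
  · rintro ⟨Z, hZ⟩
    obtain ⟨i, hi⟩ := exists_vecClass_iff (δ := δ) hZ
    exact ⟨⟨i, Z, (hi i).2 rfl⟩, rfl⟩

variable {d : F} [NeZero (2 : F)] (Δ : QuadExt F K δ d)

theorem card_vecH (hK : Nat.card K = Nat.card F ^ 2) (hA : A.IsSymm) (hdet : A.det ≠ 0)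
    (hr : r = 2 * m) :
    (Nat.card {Z : Fin (r + 1) → K // VecH A Z} : ℤ) =
      ((Nat.card F : ℤ) ^ r - 1) * ((Nat.card F : ℤ) ^ (r + 1) + 1) := by
  have hcard := card_isotropic hK hA hdet hr
  rw [card_eq_card_ne_zero_add_one _ (by simpa using herm_smul_left (0 : K) 0 0)] at hcard
  change ((Nat.card {Z : Fin (r + 1) → K // VecH A Z} + 1 : ℕ) : ℤ) = _ at hcard
  push_cast at hcard
  linear_combination hcard

include Δ

theorem card_vecClass (hA : A.IsSymm) (hdet : A.det ≠ 0) (hr : r = 2 * m) (hm : 0 < m)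
    (j : Fin 4) :
    (Nat.card {Z // vecClass A δ j Z} : ℤ) =
      tightParam (Nat.card F) r j * ((Nat.card F : ℤ) ^ r - 1) := by
  have hodd := odd_card (F := F)
  have hQ : (Nat.card {Z // vecClass A δ 0 Z} : ℤ) = _ := card_vecQ Δ.card hA hdet hr
  have hO : (Nat.card {Z // vecClass A δ 0 Z} + Nat.card {Z // vecClass A δ 1 Z} : ℤ) = _ :=
    card_vecQ_add_card_vecO Δ hA hdet hr hm
  have hS : 2 * (Nat.card {Z // vecClass A δ 3 Z} : ℤ) = _ := card_vecS Δ hA hdet hr hm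
  have hsum := congrArg (Nat.cast (R := ℤ)) (card_vecH_eq_sum (A := A) (δ := δ))
  rw [card_vecH Δ.card hA hdet hr, Fin.sum_univ_four] at hsum
  push_cast at hsum
  have hone := cast_tightParam_one (q := Nat.card F) (r := r) (by omega)
  have hthree := two_mul_tightParam_three (r := r) hodd (by omega)
  have hpow : (Nat.card F : ℤ) ^ (r + 1) = (Nat.card F : ℤ) ^ (r - 1) * (Nat.card F : ℤ) ^ 2 := by
    rw [← pow_add]
    congr 1
    omega
  rw [hpow] at hsum
  have hS' : (Nat.card {Z // vecClass A δ 3 Z} : ℤ) =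
      tightParam (Nat.card F) r 3 * ((Nat.card F : ℤ) ^ r - 1) :=
    mul_left_cancel₀ two_ne_zero
      (by linear_combination hS - ((Nat.card F : ℤ) ^ r - 1) * hthree)
  fin_cases j
  · simpa [tightParam] using hQ
  · change (Nat.card {Z // vecClass A δ 1 Z} : ℤ) = (tightParam (Nat.card F) r 1 : ℤ) * _
    linear_combination hO - hQ - ((Nat.card F : ℤ) ^ r - 1) * hone
  · change (Nat.card {Z // vecClass A δ 2 Z} : ℤ) = (tightParam (Nat.card F) r 3 : ℤ) * _
    linear_combination hS' - hsum - hO - hS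
  · exact hS'

theorem hasTightSize_vecClass (hA : A.IsSymm) (hdet : A.det ≠ 0) (hr : r = 2 * m) (hm : 0 < m)
    (j : Fin 4) : HasTightSize A m (vecClass A δ j) (tightParam (Nat.card F) r j) where
  homogeneous := homogeneous_vecClass j
  invariant := invariant_vecClass Δ.card j
  vecH _ := vecH_of_vecClass
  card := by rw [card_vecClass Δ hA hdet hr hm, Δ.card, hr, Nat.cast_pow, ← pow_mul]

omit Δ in
theorem excess_vecQ (hK : Nat.card K = Nat.card F ^ 2) (hA : A.IsSymm) (hdet : A.det ≠ 0)
    (hr : r = 2 * m) (hm : 0 < m) {Z : Fin (r + 1) → K} (hZ : VecQ A Z) :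
    excess A m (VecQ A) (Nat.card F + 1) Z = 0 := by
  obtain ⟨hZ0, c, x, rfl, hx⟩ := id hZ
  obtain ⟨hc, hincl⟩ := smul_ne_zero_iff.1 hZ0
  have hx0 : x ≠ 0 := fun h => hincl (by simp [h])
  have hcount := card_vecQ_perp hK hA hdet hr hm hx0 hx
  have hpow : (Nat.card F : ℤ) ^ (r - 1) = (Nat.card F : ℤ) ^ (2 * (m - 1)) * Nat.card F := by
    rw [← pow_succ]
    congr 1
    omega
  rw [excess, if_pos hZ, perpCount_smul hc, perpCount, hcount, hpow, hK]
  push_cast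
  ring

theorem HasTightSize.excess_eq_zero_of_vecQ {p : (Fin (r + 1) → K) → Prop} {n : ℕ}
    (hp : HasTightSize A m p n) (hA : A.IsSymm) (hdet : A.det ≠ 0) (hr : r = 2 * m) (hm : 2 ≤ m)
    (hQ : ∀ Z, VecQ A Z → excess A m p n Z = 0) {Z : Fin (r + 1) → K} (hZ : VecH A Z) :
    excess A m p n Z = 0 := by
  have hm0 : 0 < m := by omega
  have hO (Z : Fin (r + 1) → K) (hZ : VecO A Z) : excess A m p n Z = 0 := by
    obtain ⟨ψ, hψ, ⟨X, hX⟩, hsing⟩ := exists_generator_vecO Δ hA hdet hr hm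
    refine hp.excess_eq_zero_of_generator Δ.card hA hm0 (transitive_vecO hA hdet Δ) hψ
      ⟨X, hX.1.1, hX⟩ (fun Y hY0 hY => hQ _ ?_) hZ
    by_contra hYQ
    exact hY ⟨⟨hY0, hψ.isotropic Y Y⟩, hsing Y, hYQ⟩
  have hsingular (Z : Fin (r + 1) → K) (hZ : VecH A Z) (h : formK K A Z Z = 0) :
      excess A m p n Z = 0 := by
    by_cases hZQ : VecQ A Z
    · exact hQ Z hZQ
    · exact hO Z ⟨hZ, h, hZQ⟩
  obtain ⟨i, hi⟩ := exists_vecClass_iff (δ := δ) hZ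
  have hi := (hi i).2 rfl
  fin_cases i
  · exact hQ Z hi
  · exact hO Z hi
  · obtain ⟨ψ, hψ, ⟨X, hX⟩, hrest⟩ := exists_generator_vecE Δ hA hdet hr hm0
    exact hp.excess_eq_zero_of_generator Δ.card hA hm0 (transitive_vecE hA hdet Δ) hψ
      ⟨X, hX.1.1, hX⟩ (fun Y hY0 hY => hsingular _ ⟨hY0, hψ.isotropic Y Y⟩
        ((hrest Y).resolve_right hY)) hi
  · obtain ⟨ψ, hψ, ⟨X, hX⟩, hrest⟩ := exists_generator_vecS Δ hA hdet hr hm0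
    exact hp.excess_eq_zero_of_generator Δ.card hA hm0 (transitive_vecS hA hdet Δ) hψ
      ⟨X, hX.1.1, hX⟩ (fun Y hY0 hY => hsingular _ ⟨hY0, hψ.isotropic Y Y⟩
        ((hrest Y).resolve_right hY)) hi

theorem excess_vecClass (hA : A.IsSymm) (hdet : A.det ≠ 0) (hr : r = 2 * m) (hm : 2 ≤ m)
    (j : Fin 4) {Z : Fin (r + 1) → K} (hZ : VecH A Z) :
    excess A m (vecClass A δ j) (tightParam (Nat.card F) r j) Z = 0 := by
  have hm0 : 0 < m := by omega
  have hsize := hasTightSize_vecClass Δ hA hdet hr hm0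
  have hQ {W : Fin (r + 1) → K} (hW : VecH A W) :
      excess A m (vecClass A δ 0) (tightParam (Nat.card F) r 0) W = 0 :=
    (hsize 0).excess_eq_zero_of_vecQ Δ hA hdet hr hm
      (fun _ => excess_vecQ Δ.card hA hdet hr hm0) hW
  obtain rfl | hj := eq_or_ne j 0
  · exact hQ hZ
  refine (hsize j).excess_eq_zero_of_vecQ Δ hA hdet hr hm (fun Y hY => ?_) hZ
  obtain ⟨W, hW⟩ := exists_vecClass Δ hA hdet hr hm j
  have hsymm := (hsize 0).card_mul_excess Δ.card hA (hsize j) (transitive_vecClass Δ hA hdet 0)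
    (transitive_vecClass Δ hA hdet j)
    (fun Z h h' => hj ((vecClass_iff_eq h j).1 h').symm) hY hW
  rw [hQ (vecH_of_vecClass hW), mul_zero] at hsymm
  have : Nonempty {Z // vecClass A δ 0 Z} := ⟨⟨Y, hY⟩⟩
  exact (mul_eq_zero.1 hsymm).resolve_left (Nat.cast_ne_zero.2 Nat.card_pos.ne')

theorem isTight_vecClass (hA : A.IsSymm) (hdet : A.det ≠ 0) (hr : r = 2 * m) (hm : 2 ≤ m)
    (j : Fin 4) : IsTight K A (tightParam (Nat.card F) r j) (pointsOf (vecClass A δ j)) :=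
  (hasTightSize_vecClass Δ hA hdet hr (by omega) j).isTight Δ.card hr hm
    fun _ => excess_vecClass Δ hA hdet hr hm j

end Tightness

end HermTight

end

theorem mainTheorem9 (q r : ℕ) (hq : Odd q) (hr4 : 4 ≤ r) (hr : Even r)
    (F K : Type*) [Field F] [Field K] [Algebra F K]
    (hF : Nat.card F = q) (hK : Nat.card K = q ^ 2)
    (A : Matrix (Fin (r + 1)) (Fin (r + 1)) F) (hA : A.IsSymm) (hdet : A.det ≠ 0) :
    ((fun P => MulAction.orbit (HermTight.groupG K A) P) '' HermTight.hermVariety K A =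
        {HermTight.setQ K A, HermTight.setO K A, HermTight.setE K A, HermTight.setS K A} ∧
      ({HermTight.setQ K A, HermTight.setO K A, HermTight.setE K A, HermTight.setS K A} :
        Set (Set (ℙ K (Fin (r + 1) → K)))).ncard = 4) ∧
    HermTight.IsTight K A (q + 1) (HermTight.setQ K A) ∧
    HermTight.IsTight K A (q ^ (r - 1) - q) (HermTight.setO K A) ∧
    HermTight.IsTight K A ((q ^ (r + 1) - q ^ (r - 1)) / 2) (HermTight.setE K A) ∧
    HermTight.IsTight K A ((q ^ (r + 1) - q ^ (r - 1)) / 2) (HermTight.setS K A) := by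
  have : Finite F := Nat.finite_of_card_ne_zero (hF ▸ hq.pos.ne')
  have : Finite K := Nat.finite_of_card_ne_zero (hK ▸ (pow_pos hq.pos 2).ne')
  subst hF
  have : NeZero (2 : F) := ⟨HermTight.two_ne_zero_of_odd_card hq⟩
  obtain ⟨δ, d, Δ⟩ := HermTight.exists_quadExt (F := F) hK
  obtain ⟨m, hm⟩ := hr
  have hr2 : r = 2 * m := by omega
  have hm2 : 2 ≤ m := by omega
  have htight := HermTight.isTight_vecClass Δ hA hdet hr2 hm2
  rw [← HermTight.range_pointsOf_vecClass Δ hA]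
  refine ⟨⟨HermTight.orbits_eq_range Δ hA hdet hr2 hm2,
    HermTight.ncard_range_pointsOf Δ hA hdet hr2 hm2⟩, ?_, ?_, ?_, ?_⟩
  · rw [HermTight.setQ_eq]
    exact htight 0
  · rw [HermTight.setO_eq Δ hA]
    exact htight 1
  · rw [HermTight.setE_eq Δ hA]
    exact htight 2
  · rw [HermTight.setS_eq Δ hA]
    exact htight 3
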